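/- Let $M=(-\infty,0)\times(-\infty,0)\times\mathbb S^2$ with standard coordinates $(u,v)$ on the first two factors, and let $$g=-\frac{\Omega^2(u,v)}{2}\,(du\otimes dv+dv\otimes du)+r^2(u,v)\,\mathring\gamma,$$ where $\mathring\gamma$ is the standard metric on $\mathbb S^2$ and $\Omega,r:(-\infty,0)\times(-\infty,0)\to(0,\infty)$ are smooth. Time-orient $(M,g)$ by stipulating that $\partial_u+\partial_v$ is future directed. Assume that - $\Omega$ and $r$ extend continuously as positive functions to $(-\infty,0]\times(-\infty,0]$; - $\lim_{v\to0}\partial_v r(u,v)=-\infty$ for all $u\in(-\infty,0)$; - $\lim_{u\to0}\partial_u r(u,v)=-\infty$ for all $v\in(-\infty,0)$; - for every $u\in(-\infty,0)$ there is $v_0(u)\in(-\infty,0)$ such that $\partial_u r(u,v)<0$ for all $v\in[v_0(u),0)$; - for every $v\in(-\infty,0)$ there is $u_0(v)\in(-\infty,0)$ such that $\partial_v r(u,v)<0$ for all $u\in[u_0(v),0)$. Then $(M,g)$ is future $C^{0,1}_{\mathrm{loc}}$-inextendible, in the following sense. A $C^{0,1}_{\mathrm{loc}}$-extension of $(M,g)$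 is a smooth isometric embedding $\iota:M\hookrightarrow\tilde M$ into a smooth Lorentzian manifold $(\tilde M,\tilde g)$ of the same dimension, whose metric $\tilde g$ is locally Lipschitz (in every smooth chart its components are Lipschitz on compact sets), such that $\partial\iota(M)\subseteq\tilde M$ is non-empty. There is no $C^{0,1}_{\mathrm{loc}}$-extension $\iota:M\hookrightarrow\tilde M$ for which there exists a future directed timelike curve $\gamma:[a,b)\to M$ (continuous and piecewise smooth, with future directed timelike one-sided tangents everywhere) that is future inextendible, i.e. $\lim_{s\to b}\gamma(s)$ does not exist in $M$, and such that $\iota\circ\gamma$ has a future limit point in $\tilde M$, i.e. $\lim_{s\to b}\iota(\gamma(s))$ exists in $\tilde M$. -/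

import Mathlib

open Set Filter Topology Manifold
open scoped ContDiff

universe w

noncomputable section

/-! ### Lorentzian metrics, extensions, timelike curves -/

/-- A field of bilinear forms on the tangent spaces of `M` (no regularity imposed). -/
abbrev BilinField {E H : Type*} [NormedAddCommGroup E] [NormedSpace ℝ E] [TopologicalSpace H]
    (I : ModelWithCorners ℝ E H) (M : Type*) [TopologicalSpace M] [ChartedSpace H M] :=
  ∀ p : M, LinearMap.BilinForm ℝ (TangentSpace I p)

/-- A bilinear form on a `(d+1)`-dimensional space is Lorentzian if in some basis its matrix is
`diag(-1, 1, …, 1)`. -/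
def IsLorentzForm {V : Type*} [AddCommGroup V] [Module ℝ V] (d : ℕ)
    (B : LinearMap.BilinForm ℝ V) : Prop :=
  ∃ b : Module.Basis (Fin (d + 1)) ℝ V, ∀ i j,
    B (b i) (b j) = if i = j then (if i = 0 then -1 else 1) else 0

/-- The component `g_{μν} ∘ φ⁻¹` of `g` in the chart `φ`, i.e. `g` evaluated on the coordinate
vector fields `∂_μ`, `∂_ν` at the point with coordinates `x`. -/
def metricComponent {d : ℕ} {N : Type*} [TopologicalSpace N]
    [ChartedSpace (EuclideanSpace ℝ (Fin d)) N] (g : BilinField (𝓡 d) N)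
    (φ : OpenPartialHomeomorph N (EuclideanSpace ℝ (Fin d))) (μ ν : Fin d)
    (x : EuclideanSpace ℝ (Fin d)) : ℝ :=
  g (φ.symm x)
    (mfderiv (𝓡 d) (𝓡 d) φ.symm x (EuclideanSpace.single μ (1 : ℝ) : EuclideanSpace ℝ (Fin d)))
    (mfderiv (𝓡 d) (𝓡 d) φ.symm x (EuclideanSpace.single ν (1 : ℝ) : EuclideanSpace ℝ (Fin d)))

/-- `g` is of class `C^{0,1}_loc`: in every smooth chart every component is Lipschitz on every
compact subset of the range of the chart. -/
def IsLocLipschitzField {d : ℕ} {N : Type*} [TopologicalSpace N]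
    [ChartedSpace (EuclideanSpace ℝ (Fin d)) N] (g : BilinField (𝓡 d) N) : Prop :=
  ∀ φ ∈ IsManifold.maximalAtlas (𝓡 d) ∞ N, ∀ K ⊆ φ.target, IsCompact K →
    ∀ μ ν : Fin d, ∃ Λ : NNReal, LipschitzOnWith Λ (metricComponent g φ μ ν) K

section Extension

variable {E H : Type*} [NormedAddCommGroup E] [NormedSpace ℝ E] [TopologicalSpace H]
  (I : ModelWithCorners ℝ E H) {M : Type*} [TopologicalSpace M] [ChartedSpace H M]

/-- `ι : M → N` is a `C^{0,1}_loc`-extension of `(M, g)`: `(N, g')` is a Lorentzian manifold of the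
same dimension with locally Lipschitz metric `g'`, and `ι` is a smooth isometric embedding whose
image has non-empty boundary in `N`. -/
structure IsLocLipExtension (g : BilinField I M) {d : ℕ} {N : Type*} [TopologicalSpace N]
    [ChartedSpace (EuclideanSpace ℝ (Fin (d + 1))) N] (g' : BilinField (𝓡 (d + 1)) N)
    (ι : M → N) : Prop where
  same_dim : Module.finrank ℝ E = d + 1
  lorentzian : ∀ q, IsLorentzForm d (g' q)
  locLipschitz : IsLocLipschitzField g'
  smoothEmbedding : IsSmoothEmbedding I (𝓡 (d + 1)) ∞ ι
  isometric : ∀ (p : M) (X Y : TangentSpace I p),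
    g' (ι p) (mfderiv I (𝓡 (d + 1)) ι p X) (mfderiv I (𝓡 (d + 1)) ι p Y) = g p X Y
  frontier_nonempty : (frontier (range ι)).Nonempty

variable {I}

/-- `X` is timelike and future directed, for the time orientation in which the timelike vector
field `T` is future directed. -/
def IsFutureTimelike (g : BilinField I M) (T : ∀ p : M, TangentSpace I p) (p : M)
    (X : TangentSpace I p) : Prop :=
  g p X X < 0 ∧ g p X (T p) < 0

/-- `γ : [a, b) → M` is a future directed timelike curve: continuous and piecewise smooth (with
locally finitely many break points `t n`), all tangents, including both one-sided tangents at the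
break points, being timelike and future directed. -/
def IsFutureTimelikeCurve (g : BilinField I M) (T : ∀ p : M, TangentSpace I p)
    (γ : ℝ → M) (a b : ℝ) : Prop :=
  ∃ t : ℕ → ℝ, StrictMono t ∧ t 0 = a ∧ Tendsto t atTop (𝓝 b) ∧
    ∀ n, ContMDiffOn 𝓘(ℝ, ℝ) I ∞ γ (Icc (t n) (t (n + 1))) ∧
      ∀ s ∈ Icc (t n) (t (n + 1)), IsFutureTimelike g T (γ s)
        (mfderivWithin 𝓘(ℝ, ℝ) I γ (Icc (t n) (t (n + 1))) s (1 : ℝ))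

/-- A curve `[a, b) → M` is future inextendible if it has no limit in `M` at `b`. -/
def IsFutureInextendibleCurve (γ : ℝ → M) (b : ℝ) : Prop :=
  ¬ ∃ p : M, Tendsto γ (𝓝[<] b) (𝓝 p)

/-- `(M, g)`, time-oriented by `T`, is future `C^{0,1}_loc`-inextendible: no `C^{0,1}_loc`-extension
`ι : M → N` admits a future directed, future inextendible timelike curve `γ` in `M` such that
`ι ∘ γ` has a future limit point in `N`. -/
def FutureLocLipInextendible (g : BilinField I M) (T : ∀ p : M, TangentSpace I p) : Prop :=
  ∀ (d : ℕ) (N : Type w) [TopologicalSpace N] [T2Space N]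
    [ChartedSpace (EuclideanSpace ℝ (Fin (d + 1))) N] [IsManifold (𝓡 (d + 1)) ∞ N]
    (g' : BilinField (𝓡 (d + 1)) N) (ι : M → N), IsLocLipExtension I g g' ι →
      ¬ ∃ (γ : ℝ → M) (a b : ℝ), IsFutureTimelikeCurve g T γ a b ∧
        IsFutureInextendibleCurve γ b ∧ ∃ q : N, Tendsto (ι ∘ γ) (𝓝[<] b) (𝓝 q)

end Extension

/-! ### The spherically symmetric double null spacetime -/

/-- The interval `(-∞, 0)` as an open submanifold of `ℝ`. -/
abbrev NegLine : TopologicalSpace.Opens ℝ := ⟨Iio 0, isOpen_Iio⟩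

/-- The unit sphere in Euclidean 3-space. -/
abbrev UnitSphere : Type := Metric.sphere (0 : EuclideanSpace ℝ (Fin 3)) 1

/-- `M = (-∞, 0) × (-∞, 0) × 𝕊²`. -/
abbrev DoubleNull : Type := NegLine × NegLine × UnitSphere

/-- The model of `M`. -/
abbrev DoubleNullModel :=
  (𝓘(ℝ, ℝ)).prod ((𝓘(ℝ, ℝ)).prod (𝓡 2))

/-- The differential `du` at `p`. -/
def diffU (p : DoubleNull) : TangentSpace DoubleNullModel p →ₗ[ℝ] ℝ :=
  (mfderiv DoubleNullModel 𝓘(ℝ, ℝ) (fun x : DoubleNull => (x.1 : ℝ)) p).toLinearMap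

/-- The differential `dv` at `p`. -/
def diffV (p : DoubleNull) : TangentSpace DoubleNullModel p →ₗ[ℝ] ℝ :=
  (mfderiv DoubleNullModel 𝓘(ℝ, ℝ) (fun x : DoubleNull => (x.2.1 : ℝ)) p).toLinearMap

/-- The differential at `p` of `M → 𝕊² ⊆ ℝ³`. -/
def diffSphere (p : DoubleNull) :
    TangentSpace DoubleNullModel p →ₗ[ℝ] EuclideanSpace ℝ (Fin 3) :=
  (mfderiv DoubleNullModel 𝓘(ℝ, EuclideanSpace ℝ (Fin 3))
    (fun x : DoubleNull => (x.2.2 : EuclideanSpace ℝ (Fin 3))) p).toLinearMap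

/-- The standard metric of `𝕊²` (induced from `ℝ³`), pulled back to `M`. -/
def roundMetric (p : DoubleNull) : LinearMap.BilinForm ℝ (TangentSpace DoubleNullModel p) :=
  (innerₗ (EuclideanSpace ℝ (Fin 3))).compl₁₂ (diffSphere p) (diffSphere p)

/-- `g = -(Ω²/2) (du ⊗ dv + dv ⊗ du) + r² γ̊`. -/
def doubleNullMetric (Ω r : ℝ → ℝ → ℝ) : BilinField DoubleNullModel DoubleNull := fun p =>
  (-(Ω p.1 p.2.1 ^ 2 / 2)) •
      (LinearMap.BilinForm.linMulLin (diffU p) (diffV p) +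
        LinearMap.BilinForm.linMulLin (diffV p) (diffU p)) +
    (r p.1 p.2.1 ^ 2) • roundMetric p

/-- The vector field `∂_u + ∂_v`. -/
def timeVector (p : DoubleNull) : TangentSpace DoubleNullModel p :=
  ((1, 1, 0) : ℝ × ℝ × EuclideanSpace ℝ (Fin 2))

/-- `f : (-∞,0)² → (0,∞)` is smooth, positive, and extends continuously as a positive function to
`(-∞,0]²`. Values of `f` outside `(-∞,0)²` are irrelevant. -/
structure IsAdmissibleCoefficient (f : ℝ → ℝ → ℝ) : Prop where
  smooth : ContDiffOn ℝ ∞ (fun x : ℝ × ℝ => f x.1 x.2) (Iio 0 ×ˢ Iio 0)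
  pos : ∀ u < 0, ∀ v < 0, 0 < f u v
  extends_pos : ∃ F : ℝ × ℝ → ℝ, ContinuousOn F (Iic 0 ×ˢ Iic 0) ∧
    (∀ u < 0, ∀ v < 0, F (u, v) = f u v) ∧ ∀ u ≤ 0, ∀ v ≤ 0, 0 < F (u, v)

end

noncomputable section

/-!
Suppose that `ι ∘ γ` converges to `q`. Then `γ` leaves through `{v = 0}` or, after exchanging `u`
and `v`, through `{u = 0}`, and its spherical component converges to some `ω`. Let `Y` be `ι` read
in a small chart around `q`, in which the extended metric has Lipschitz coefficients and
`‖X‖ ≤ C |τ X|` for a linear functional `τ` and all causal `X`. The curve `γ` and a copy delayed by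
the time which the spherical motion can afford bound a family of causal rectangles. Causal curves
between two points near `q` stay near `q`, so a null line `{u = κ, ω fixed}` reaching `v = 0` stays
in the chart. Transport along null lines loses only a bounded factor, so the first derivatives of
`Y` are bounded on a strip of such lines over an arc of a great circle. By the Gauss formula the
second derivative of `τ ∘ Y` along the arc is, up to a bounded error, the second fundamental form
of the spheres, which tends to `-∞` with `∂_v (r²)`: this contradicts the bound on the first one.
-/

section Pullback

variable {F E : Type*} [NormedAddCommGroup F] [NormedSpace ℝ F]
  [NormedAddCommGroup E] [NormedSpace ℝ E]

theorem norm_deriv_le_of_norm_sub_le {f : ℝ → F} {k : ℝ → E} {c : ℝ → ℝ} {f' : F} {k' : E} {t₀ : ℝ}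
    (hf : HasDerivAt f f' t₀) (hk : HasDerivAt k k' t₀) (hc : ContinuousAt c t₀)
    (h : ∀ᶠ t in 𝓝 t₀, ‖f t - f t₀‖ ≤ c t * ‖k t - k t₀‖) : ‖f'‖ ≤ c t₀ * ‖k'‖ := by
  refine le_of_tendsto_of_tendsto hf.tendsto_slope.norm
    ((hc.tendsto.mono_left nhdsWithin_le_nhds).mul hk.tendsto_slope.norm) ?_
  filter_upwards [h.filter_mono nhdsWithin_le_nhds] with t ht
  rw [slope_def_module, slope_def_module, norm_smul, norm_smul, mul_left_comm]
  gcongr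

theorem hasLineDerivAt_fderiv_apply {Y : F → E} {x : F} (hY : ContDiffAt ℝ 2 Y x) (z₁ z₂ : F) :
    HasLineDerivAt ℝ (fun p => fderiv ℝ Y p z₂) (fderiv ℝ (fderiv ℝ Y) x z₁ z₂) x z₁ := by
  have hY₂ := ((hY.fderiv_right (m := 1) (by norm_num)).differentiableAt (by norm_num)).hasFDerivAt
  simpa using (hY₂.clm_apply (hasFDerivAt_const z₂ x)).hasLineDerivAt z₁

theorem hasLineDerivAt_bilin_fderiv {Y : F → E} {x : F} (hY : ContDiffAt ℝ 2 Y x)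
    (B : E →L[ℝ] E →L[ℝ] ℝ) (z₁ z₂ z₃ : F) :
    HasLineDerivAt ℝ (fun p => B (fderiv ℝ Y p z₂) (fderiv ℝ Y p z₃))
      (B (fderiv ℝ (fderiv ℝ Y) x z₁ z₂) (fderiv ℝ Y x z₃)
        + B (fderiv ℝ Y x z₂) (fderiv ℝ (fderiv ℝ Y) x z₁ z₃)) x z₁ := by
  have hB := B.hasFDerivAt.comp_hasDerivAt 0 (hasLineDerivAt_fderiv_apply hY z₁ z₂)
  simpa [HasLineDerivAt] using hB.clm_apply (hasLineDerivAt_fderiv_apply hY z₁ z₃)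

theorem abs_lineDeriv_pullback_sub_le {Y : F → E} {G : E → E →L[ℝ] E →L[ℝ] ℝ} {g : F → F → F → ℝ}
    {x z₁ z₂ z₃ : F} {Λ g' : ℝ} (hY : ContDiffAt ℝ 2 Y x)
    (hg : ∀ᶠ p in 𝓝 x, ∀ z w, G (Y p) (fderiv ℝ Y p z) (fderiv ℝ Y p w) = g p z w)
    (hG : ∀ᶠ p in 𝓝 x, ‖G (Y p) - G (Y x)‖ ≤ Λ * ‖Y p - Y x‖)
    (hg' : HasLineDerivAt ℝ (fun p => g p z₂ z₃) g' x z₁) :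
    |g' - G (Y x) (fderiv ℝ (fderiv ℝ Y) x z₁ z₂) (fderiv ℝ Y x z₃)
      - G (Y x) (fderiv ℝ Y x z₂) (fderiv ℝ (fderiv ℝ Y) x z₁ z₃)|
      ≤ Λ * ‖fderiv ℝ Y x z₁‖ * ‖fderiv ℝ Y x z₂‖ * ‖fderiv ℝ Y x z₃‖ := by
  set γ : ℝ → F := fun t => x + t • z₁ with hγ
  have hγ0 : γ 0 = x := by simp [hγ]
  have hγx : Tendsto γ (𝓝 0) (𝓝 x) := by
    have : Continuous γ := by fun_prop
    simpa [hγ0] using this.tendsto 0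
  have hYγ : HasDerivAt (fun t => Y (γ t)) (fderiv ℝ Y x z₁) 0 :=
    (hY.differentiableAt (by norm_num)).hasFDerivAt.hasLineDerivAt z₁
  have hDY (z : F) : HasDerivAt (fun t => fderiv ℝ Y (γ t) z) (fderiv ℝ (fderiv ℝ Y) x z₁ z) 0 :=
    hasLineDerivAt_fderiv_apply hY z₁ z
  have hcont : ContinuousAt
      (fun t => Λ * ‖fderiv ℝ Y (γ t) z₂‖ * ‖fderiv ℝ Y (γ t) z₃‖) 0 :=
    ((hDY z₂).continuousAt.norm.const_mul Λ).mul (hDY z₃).continuousAt.norm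
  -- Freezing the coefficients `G` at `Y x` isolates the second derivative of `Y`.
  have hbound := norm_deriv_le_of_norm_sub_le
    (HasDerivAt.fun_sub hg' (hasLineDerivAt_bilin_fderiv hY (G (Y x)) z₁ z₂ z₃)) hYγ hcont ?_
  · rw [sub_sub]
    refine hbound.trans_eq ?_
    rw [hγ0]
    ring
  filter_upwards [hγx.eventually (hg.and hG)] with t ht
  have hdiff : g (γ t) z₂ z₃ - G (Y x) (fderiv ℝ Y (γ t) z₂) (fderiv ℝ Y (γ t) z₃)
      = (G (Y (γ t)) - G (Y x)) (fderiv ℝ Y (γ t) z₂) (fderiv ℝ Y (γ t) z₃) := by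
    rw [← ht.1, sub_apply, sub_apply]
  have hzero : g (γ 0) z₂ z₃ - G (Y x) (fderiv ℝ Y (γ 0) z₂) (fderiv ℝ Y (γ 0) z₃) = 0 := by
    rw [hγ0, hg.self_of_nhds, sub_self]
  calc ‖_ - _‖ = ‖(G (Y (γ t)) - G (Y x)) (fderiv ℝ Y (γ t) z₂) (fderiv ℝ Y (γ t) z₃)‖ :=
        congrArg norm ((sub_eq_self.2 hzero).trans hdiff)
    _ ≤ ‖G (Y (γ t)) - G (Y x)‖ * ‖fderiv ℝ Y (γ t) z₂‖ * ‖fderiv ℝ Y (γ t) z₃‖ :=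
        ContinuousLinearMap.le_opNorm₂ _ _ _
    _ ≤ Λ * ‖Y (γ t) - Y (γ 0)‖ * ‖fderiv ℝ Y (γ t) z₂‖ * ‖fderiv ℝ Y (γ t) z₃‖ := by
        rw [hγ0]
        gcongr
        exact ht.2
    _ = _ := by ring

/-- The Gauss formula with a bounded error: by the Koszul formula `hc`, the vector `c` is the
covariant derivative of `z₂` along `z₁` for `g`, and for smooth `G` the difference would be a
Christoffel symbol of `G`. -/
theorem norm_fderiv_fderiv_sub_le {Y : F → E} {G : E → E →L[ℝ] E →L[ℝ] ℝ} {g : F → F → F → ℝ}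
    {x z₁ z₂ c : F} {Λ C : ℝ} {k₁ k₂ k₃ : F → ℝ} (hC : 0 ≤ C) (hΛ : 0 ≤ Λ)
    (hY : ContDiffAt ℝ 2 Y x)
    (hg : ∀ᶠ p in 𝓝 x, ∀ z w, G (Y p) (fderiv ℝ Y p z) (fderiv ℝ Y p w) = g p z w)
    (hG : ∀ᶠ p in 𝓝 x, ‖G (Y p) - G (Y x)‖ ≤ Λ * ‖Y p - Y x‖)
    (hsymm : ∀ V W, G (Y x) V W = G (Y x) W V)
    (hnondeg : ∀ V, ‖V‖ ≤ C * ‖G (Y x) V‖)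
    (hsurj : Function.Surjective (fderiv ℝ Y x))
    (h₁ : ∀ z, HasLineDerivAt ℝ (fun p => g p z₂ z) (k₁ z) x z₁)
    (h₂ : ∀ z, HasLineDerivAt ℝ (fun p => g p z₁ z) (k₂ z) x z₂)
    (h₃ : ∀ z, HasLineDerivAt ℝ (fun p => g p z₁ z₂) (k₃ z) x z)
    (hc : ∀ z, 2 * g x c z = k₁ z + k₂ z - k₃ z) :
    ‖fderiv ℝ (fderiv ℝ Y) x z₁ z₂ - fderiv ℝ Y x c‖
      ≤ 2 * C * Λ * ‖fderiv ℝ Y x z₁‖ * ‖fderiv ℝ Y x z₂‖ := by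
  have hsndSymm (a b : F) : fderiv ℝ (fderiv ℝ Y) x a b = fderiv ℝ (fderiv ℝ Y) x b a :=
    (hY.isSymmSndFDerivAt (by simp)) a b
  have hlowered : ‖G (Y x) (fderiv ℝ (fderiv ℝ Y) x z₁ z₂ - fderiv ℝ Y x c)‖
      ≤ 2 * Λ * ‖fderiv ℝ Y x z₁‖ * ‖fderiv ℝ Y x z₂‖ := by
    refine ContinuousLinearMap.opNorm_le_bound _ (by positivity) fun Z => ?_
    obtain ⟨z, rfl⟩ := hsurj Z
    have b₁ := abs_le.1 (abs_lineDeriv_pullback_sub_le hY hg hG (h₁ z))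
    have b₂ := abs_le.1 (abs_lineDeriv_pullback_sub_le hY hg hG (h₂ z))
    have b₃ := abs_le.1 (abs_lineDeriv_pullback_sub_le hY hg hG (h₃ z))
    rw [hsndSymm z₂ z₁] at b₂
    rw [hsndSymm z z₁, hsndSymm z z₂, hsymm (fderiv ℝ (fderiv ℝ Y) x z₁ z)] at b₃
    have herr : 0 ≤ Λ * ‖fderiv ℝ Y x z₁‖ * ‖fderiv ℝ Y x z₂‖ * ‖fderiv ℝ Y x z‖ := by positivity
    rw [map_sub, sub_apply, hg.self_of_nhds c z, Real.norm_eq_abs, abs_le]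
    constructor <;> nlinarith [hc z, herr]
  calc ‖_‖ ≤ C * ‖G (Y x) (fderiv ℝ (fderiv ℝ Y) x z₁ z₂ - fderiv ℝ Y x c)‖ := hnondeg _
    _ ≤ C * (2 * Λ * ‖fderiv ℝ Y x z₁‖ * ‖fderiv ℝ Y x z₂‖) := by gcongr
    _ = _ := by ring

end Pullback

section Cone

variable {V : Type*} [NormedAddCommGroup V]

/-- The coordinate space `(u, v, x)` in which the unit sphere of `V` is replaced by the cone
`V \ {0}` over it, so that the sphere needs no charts. -/
abbrev ConeSpace (V : Type*) : Type _ := ℝ × ℝ × V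

/-- The cone over the double null spacetime. -/
def coneDomain (V : Type*) [NormedAddCommGroup V] : Set (ConeSpace V) :=
  {p | p.1 < 0 ∧ p.2.1 < 0 ∧ p.2.2 ≠ 0}

theorem isOpen_coneDomain : IsOpen (coneDomain V) :=
  (isOpen_lt continuous_fst continuous_const).inter
    ((isOpen_lt continuous_snd.fst continuous_const).inter
      (isOpen_ne_fun continuous_snd.snd continuous_const))

variable [InnerProductSpace ℝ V] {Q R : ℝ → ℝ → ℝ}

/-- The pullback of the round metric under the radial projection `x ↦ x / ‖x‖`. -/
def coneRound (x a b : V) : ℝ :=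
  inner ℝ a b / inner ℝ x x - inner ℝ x a * inner ℝ x b / inner ℝ x x ^ 2

/-- The pullback of `-(Q/2)(du ⊗ dv + dv ⊗ du) + R γ̊` to the cone. It is degenerate exactly in the
radial direction. In the application `Q = Ω²` and `R = r²`. -/
def coneMetric (Q R : ℝ → ℝ → ℝ) (p z w : ConeSpace V) : ℝ :=
  -(Q p.1 p.2.1 / 2) * (z.1 * w.2.1 + z.2.1 * w.1) +
    R p.1 p.2.1 * coneRound p.2.2 z.2.2 w.2.2

theorem coneMetric_of_norm_eq_one {x : ConeSpace V} (hx : ‖x.2.2‖ = 1) (z w : ConeSpace V) :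
    coneMetric Q R x z w = -(Q x.1 x.2.1 / 2) * (z.1 * w.2.1 + z.2.1 * w.1) +
      R x.1 x.2.1 * (inner ℝ z.2.2 w.2.2 - inner ℝ x.2.2 z.2.2 * inner ℝ x.2.2 w.2.2) := by
  simp [coneMetric, coneRound, hx]

theorem coneMetric_null_plane (p : ConeSpace V) (α β : ℝ) :
    coneMetric Q R p (α, β, 0) (α, β, 0) = -(Q p.1 p.2.1 * α * β) := by
  simp only [coneMetric, coneRound, inner_zero_right]
  ring

theorem coneMetric_radial {x : ConeSpace V} (hx : ‖x.2.2‖ = 1) (w : ConeSpace V) :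
    coneMetric Q R x (0, 0, x.2.2) w = 0 := by
  simp [coneMetric_of_norm_eq_one hx, hx]

theorem eq_smul_radial_of_coneMetric_eq_zero {x z : ConeSpace V} (hQ : Q x.1 x.2.1 ≠ 0)
    (hR : R x.1 x.2.1 ≠ 0) (hx : ‖x.2.2‖ = 1) (hz : ∀ w, coneMetric Q R x z w = 0) :
    z = (inner ℝ x.2.2 z.2.2 : ℝ) • ((0, 0, x.2.2) : ConeSpace V) := by
  simp only [coneMetric_of_norm_eq_one hx] at hz
  have hu : z.1 = 0 := by simpa [hQ] using hz (0, 1, 0)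
  have hv : z.2.1 = 0 := by simpa [hQ] using hz (1, 0, 0)
  set y := z.2.2 - (inner ℝ x.2.2 z.2.2 : ℝ) • x.2.2 with hy
  have hxy : inner ℝ x.2.2 y = (0 : ℝ) := by
    simp [hy, inner_sub_right, inner_smul_right, hx]
  have hzy : inner ℝ z.2.2 y = (0 : ℝ) := by simpa [hu, hv, hR, hxy] using hz (0, 0, y)
  have hyy : inner ℝ y y = (0 : ℝ) := by
    nth_rewrite 1 [hy]
    rw [inner_sub_left, inner_smul_left, hzy, hxy, mul_zero, sub_zero]
  refine Prod.ext (by simp [hu]) (Prod.ext (by simp [hv]) ?_)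
  simpa using sub_eq_zero.1 (inner_self_eq_zero.1 hyy)

theorem hasLineDerivAt_coneRound {x : V} (hx : ‖x‖ = 1) (z a b : V) :
    HasLineDerivAt ℝ (fun p => coneRound p a b)
      (-2 * inner ℝ x z * inner ℝ a b - inner ℝ z a * inner ℝ x b - inner ℝ x a * inner ℝ z b
        + 4 * inner ℝ x a * inner ℝ x b * inner ℝ x z) x z := by
  have hline : HasDerivAt (fun t : ℝ => x + t • z) z 0 := by
    simpa using ((hasDerivAt_id (0 : ℝ)).smul_const z).const_add x
  have hx0 : x ≠ 0 := norm_ne_zero_iff.1 (by simp [hx])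
  have hxx := hline.inner ℝ hline
  have hxa := hline.inner ℝ (hasDerivAt_const 0 a)
  have hxb := hline.inner ℝ (hasDerivAt_const 0 b)
  have hquot := ((hasDerivAt_const (0 : ℝ) (inner ℝ a b : ℝ)).div hxx (by simp [hx0])).sub
    ((hxa.mul hxb).div (hxx.pow 2) (by simp [hx0]))
  unfold coneRound HasLineDerivAt
  convert! hquot using 1
  simp [hx, real_inner_comm x z]
  ring

theorem hasLineDerivAt_coneMetric {Q' R' : ℝ × ℝ →L[ℝ] ℝ} {p : ConeSpace V}
    (hQ : HasFDerivAt (fun q : ℝ × ℝ => Q q.1 q.2) Q' (p.1, p.2.1))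
    (hR : HasFDerivAt (fun q : ℝ × ℝ => R q.1 q.2) R' (p.1, p.2.1))
    (hp : ‖p.2.2‖ = 1) (z a b : ConeSpace V) :
    HasLineDerivAt ℝ (fun p => coneMetric Q R p a b)
      (-(Q' (z.1, z.2.1) / 2) * (a.1 * b.2.1 + a.2.1 * b.1) +
        (R' (z.1, z.2.1) * (inner ℝ a.2.2 b.2.2 - inner ℝ p.2.2 a.2.2 * inner ℝ p.2.2 b.2.2) +
        R p.1 p.2.1 * (-2 * inner ℝ p.2.2 z.2.2 * inner ℝ a.2.2 b.2.2
          - inner ℝ z.2.2 a.2.2 * inner ℝ p.2.2 b.2.2 - inner ℝ p.2.2 a.2.2 * inner ℝ z.2.2 b.2.2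
          + 4 * inner ℝ p.2.2 a.2.2 * inner ℝ p.2.2 b.2.2 * inner ℝ p.2.2 z.2.2))) p z := by
  have hquot := ((((hQ.hasLineDerivAt (z.1, z.2.1)).div_const 2).neg.mul_const
    (a.1 * b.2.1 + a.2.1 * b.1)).add
    ((hR.hasLineDerivAt (z.1, z.2.1)).mul (hasLineDerivAt_coneRound hp z.2.2 a.2.2 b.2.2)))
  unfold coneMetric HasLineDerivAt
  convert! hquot using 1
  simp [coneRound, hp]

end Cone

/-- The partial derivative `∂_u f`. -/
def partialU (f : ℝ → ℝ → ℝ) (u v : ℝ) : ℝ := deriv (fun x => f x v) u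

/-- The partial derivative `∂_v f`. -/
def partialV (f : ℝ → ℝ → ℝ) (u v : ℝ) : ℝ := deriv (fun y => f u y) v

/-- A differentiable function on `(-∞, 0)²` which is bounded above and away from zero on every
bounded subset. -/
structure IsBoundedCoefficient (Q : ℝ → ℝ → ℝ) : Prop where
  differentiable : DifferentiableOn ℝ (fun x : ℝ × ℝ => Q x.1 x.2) (Iio 0 ×ˢ Iio 0)
  bounds : ∀ a < 0, ∃ m > 0, ∃ M, ∀ u ∈ Ico a 0, ∀ v ∈ Ico a 0, m ≤ Q u v ∧ Q u v ≤ M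

namespace IsBoundedCoefficient

variable {Q : ℝ → ℝ → ℝ} {u v : ℝ}

theorem pos (hQ : IsBoundedCoefficient Q) (hu : u < 0) (hv : v < 0) : 0 < Q u v := by
  obtain ⟨m, hm, M, h⟩ := hQ.bounds (min u v) (by simp [hu])
  exact hm.trans_le (h u ⟨by simp, hu⟩ v ⟨by simp, hv⟩).1

theorem differentiableAt (hQ : IsBoundedCoefficient Q) (hu : u < 0) (hv : v < 0) :
    DifferentiableAt ℝ (fun x : ℝ × ℝ => Q x.1 x.2) (u, v) :=
  hQ.differentiable.differentiableAt (prod_mem_nhds (Iio_mem_nhds hu) (Iio_mem_nhds hv))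

theorem differentiableAt_left (hQ : IsBoundedCoefficient Q) (hu : u < 0) (hv : v < 0) :
    DifferentiableAt ℝ (fun x => Q x v) u :=
  (hQ.differentiableAt hu hv).comp (f := fun x : ℝ => (x, v)) u (by fun_prop)

theorem differentiableAt_right (hQ : IsBoundedCoefficient Q) (hu : u < 0) (hv : v < 0) :
    DifferentiableAt ℝ (fun y => Q u y) v :=
  (hQ.differentiableAt hu hv).comp (f := fun y : ℝ => (u, y)) v (by fun_prop)

theorem hasDerivAt_right (hQ : IsBoundedCoefficient Q) (hu : u < 0) (hv : v < 0) :
    HasDerivAt (fun y => Q u y) (partialV Q u v) v :=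
  (hQ.differentiableAt_right hu hv).hasDerivAt

theorem hasFDerivAt (hQ : IsBoundedCoefficient Q) (hu : u < 0) (hv : v < 0) :
    HasFDerivAt (fun x : ℝ × ℝ => Q x.1 x.2)
      (partialU Q u v • ContinuousLinearMap.fst ℝ ℝ ℝ +
        partialV Q u v • ContinuousLinearMap.snd ℝ ℝ ℝ) (u, v) := by
  have hD := (hQ.differentiableAt hu hv).hasFDerivAt
  set D := fderiv ℝ (fun x : ℝ × ℝ => Q x.1 x.2) (u, v)
  have hU : HasDerivAt (fun x => Q x v) (D (1, 0)) u :=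
    hD.comp_hasDerivAt (f := fun x => (x, v)) u ((hasDerivAt_id u).prodMk (hasDerivAt_const u v))
  have hV : HasDerivAt (fun y => Q u y) (D (0, 1)) v :=
    hD.comp_hasDerivAt v ((hasDerivAt_const v u).prodMk (hasDerivAt_id v))
  convert! hD using 1
  ext <;> simp [partialU, partialV, hU.deriv, hV.deriv]

end IsBoundedCoefficient

/-- A map `Y` from an open subset `O` of the cone over the double null spacetime to the range of a
chart in which the metric `G` is Lipschitz, and so close to a constant Lorentzian metric that its
causal vectors lie in a fixed cone `‖V‖ ≤ C |τ V|`. The ball of radius `ρ` about `y₀` is where these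
bounds hold, and `closed` says that the part of the spacetime which `Y` maps to this ball has no
boundary points inside the spacetime other than those in `O`. -/
structure BoundaryChart {V E : Type*} [NormedAddCommGroup V] [InnerProductSpace ℝ V]
    [NormedAddCommGroup E] [NormedSpace ℝ E] (Q R : ℝ → ℝ → ℝ) (Y : ConeSpace V → E)
    (O : Set (ConeSpace V)) (G : E → E →L[ℝ] E →L[ℝ] ℝ) (τ : E →L[ℝ] ℝ) (y₀ : E) (ρ Λ C : ℝ) :
    Prop where
  finrank_eq : Module.finrank ℝ E = Module.finrank ℝ V + 1
  isOpen : IsOpen O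
  subset : O ⊆ coneDomain V
  smooth : ContDiffOn ℝ 2 Y O
  closed : ∀ x ∈ coneDomain V, x ∈ closure {p ∈ O | Y p ∈ Metric.closedBall y₀ ρ} → x ∈ O
  isometric : ∀ x ∈ O, ∀ z w, G (Y x) (fderiv ℝ Y x z) (fderiv ℝ Y x w) = coneMetric Q R x z w
  lipschitzConst_nonneg : 0 ≤ Λ
  lipschitz : ∀ x ∈ Metric.closedBall y₀ ρ, ∀ y ∈ Metric.closedBall y₀ ρ, ‖G x - G y‖ ≤ Λ * ‖x - y‖
  bound_pos : 0 < C
  symm : ∀ y ∈ Metric.closedBall y₀ ρ, ∀ V W, G y V W = G y W V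
  nondegenerate : ∀ y ∈ Metric.closedBall y₀ ρ, ∀ V, ‖V‖ ≤ C * ‖G y V‖
  bounded : ∀ y ∈ Metric.closedBall y₀ ρ, ‖G y‖ ≤ C
  cone : ∀ y ∈ Metric.closedBall y₀ ρ, ∀ V, G y V V ≤ 0 → ‖V‖ ≤ C * |τ V|

/-- The set of points which `Y` maps to the closed ball of radius `σ`, and at which `∂_u + ∂_v` is
future directed with respect to the time function `τ`. -/
def chartRegion {V E : Type*} [NormedAddCommGroup V] [InnerProductSpace ℝ V]
    [NormedAddCommGroup E] [NormedSpace ℝ E] (Y : ConeSpace V → E) (O : Set (ConeSpace V))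
    (τ : E →L[ℝ] ℝ) (y₀ : E) (σ : ℝ) : Set (ConeSpace V) :=
  {x | x ∈ O ∧ Y x ∈ Metric.closedBall y₀ σ ∧ 0 < τ (fderiv ℝ Y x (1, 1, 0))}

namespace BoundaryChart

variable {V E : Type*} [NormedAddCommGroup V] [InnerProductSpace ℝ V]
  [NormedAddCommGroup E] [NormedSpace ℝ E] {Q R : ℝ → ℝ → ℝ} {Y : ConeSpace V → E}
  {O : Set (ConeSpace V)} {G : E → E →L[ℝ] E →L[ℝ] ℝ} {τ : E →L[ℝ] ℝ} {y₀ : E} {ρ Λ C : ℝ}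
  {x : ConeSpace V}

variable (h : BoundaryChart Q R Y O G τ y₀ ρ Λ C)

include h

section Derivatives

theorem contDiffAt (hx : x ∈ O) : ContDiffAt ℝ 2 Y x :=
  h.smooth.contDiffAt (h.isOpen.mem_nhds hx)

theorem hasFDerivAt (hx : x ∈ O) : HasFDerivAt Y (fderiv ℝ Y x) x :=
  ((h.contDiffAt hx).differentiableAt (by simp)).hasFDerivAt

theorem hasFDerivAt_fderiv (hx : x ∈ O) :
    HasFDerivAt (fderiv ℝ Y) (fderiv ℝ (fderiv ℝ Y) x) x :=
  (((h.contDiffAt hx).fderiv_right (m := 1) (by norm_num)).differentiableAt (by simp)).hasFDerivAt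

theorem continuousAt_fderiv_apply (hx : x ∈ O) (z : ConeSpace V) :
    ContinuousAt (fun p => fderiv ℝ Y p z) x :=
  (h.hasFDerivAt_fderiv hx).continuousAt.clm_apply continuousAt_const

end Derivatives

section Gauss

variable [FiniteDimensional ℝ V] (hQ : IsBoundedCoefficient Q) (hR : IsBoundedCoefficient R)

include hQ hR

theorem surjective_fderiv (hx : x ∈ O) (hx₁ : ‖x.2.2‖ = 1) :
    Function.Surjective (fderiv ℝ Y x) := by
  have hdom := h.subset hx
  have : FiniteDimensional ℝ E := Module.finite_of_finrank_pos (by rw [h.finrank_eq]; positivity)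
  set D := (fderiv ℝ Y x).toLinearMap
  have hker : LinearMap.ker D ≤ Submodule.span ℝ {((0, 0, x.2.2) : ConeSpace V)} := by
    intro z hz
    refine Submodule.mem_span_singleton.2 ⟨_, (eq_smul_radial_of_coneMetric_eq_zero
      (hQ.pos hdom.1 hdom.2.1).ne' (hR.pos hdom.1 hdom.2.1).ne' hx₁ fun w => ?_).symm⟩
    rw [← h.isometric x hx, show fderiv ℝ Y x z = 0 from hz]
    simp
  have hker₁ : Module.finrank ℝ (LinearMap.ker D) ≤ 1 :=
    (Submodule.finrank_mono hker).trans ((finrank_span_le_card _).trans (by simp))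
  have hrankNullity := LinearMap.finrank_range_add_finrank_ker D
  have hdim : Module.finrank ℝ (ConeSpace V) = Module.finrank ℝ V + 2 := by
    simp only [Module.finrank_prod, Module.finrank_self]
    ring
  have hrange := Submodule.finrank_le (LinearMap.range D)
  have hrange_eq : Module.finrank ℝ (LinearMap.range D) = Module.finrank ℝ E := by
    have := h.finrank_eq
    omega
  exact LinearMap.range_eq_top.1 (Submodule.eq_top_of_finrank_eq hrange_eq)

theorem fderiv_radial (hx : x ∈ O) (hy : Y x ∈ Metric.closedBall y₀ ρ) (hx₁ : ‖x.2.2‖ = 1) :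
    fderiv ℝ Y x (0, 0, x.2.2) = 0 := by
  have hG : G (Y x) (fderiv ℝ Y x (0, 0, x.2.2)) = 0 := by
    ext Z
    obtain ⟨z, rfl⟩ := h.surjective_fderiv hQ hR hx hx₁ Z
    rw [h.isometric x hx, coneMetric_radial hx₁, zero_apply]
  simpa [hG] using h.nondegenerate _ hy (fderiv ℝ Y x (0, 0, x.2.2))

theorem gauss (hx : x ∈ O) (hy : Y x ∈ Metric.ball y₀ ρ) (hx₁ : ‖x.2.2‖ = 1)
    {z₁ z₂ c : ConeSpace V} {Q' R' : ℝ × ℝ →L[ℝ] ℝ}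
    (hQ' : HasFDerivAt (fun x : ℝ × ℝ => Q x.1 x.2) Q' (x.1, x.2.1))
    (hR' : HasFDerivAt (fun x : ℝ × ℝ => R x.1 x.2) R' (x.1, x.2.1))
    (hz₁ : inner ℝ x.2.2 z₁.2.2 = (0 : ℝ)) (hz₂ : inner ℝ x.2.2 z₂.2.2 = (0 : ℝ))
    (hc : ∀ z, 2 * coneMetric Q R x c z =
      -(Q' (z₁.1, z₁.2.1) / 2) * (z₂.1 * z.2.1 + z₂.2.1 * z.1)
      + R' (z₁.1, z₁.2.1) * inner ℝ z₂.2.2 z.2.2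
      - (Q' (z₂.1, z₂.2.1) / 2) * (z₁.1 * z.2.1 + z₁.2.1 * z.1)
      + R' (z₂.1, z₂.2.1) * inner ℝ z₁.2.2 z.2.2
      + (Q' (z.1, z.2.1) / 2) * (z₁.1 * z₂.2.1 + z₁.2.1 * z₂.1)
      - R' (z.1, z.2.1) * inner ℝ z₁.2.2 z₂.2.2) :
    ‖fderiv ℝ (fderiv ℝ Y) x z₁ z₂ - fderiv ℝ Y x c‖
      ≤ 2 * C * Λ * ‖fderiv ℝ Y x z₁‖ * ‖fderiv ℝ Y x z₂‖ := by
  have hyc := Metric.ball_subset_closedBall hy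
  refine norm_fderiv_fderiv_sub_le h.bound_pos.le h.lipschitzConst_nonneg (h.contDiffAt hx)
    (mem_of_superset (h.isOpen.mem_nhds hx) fun p hp => h.isometric p hp)
    ?_ (h.symm _ hyc) (h.nondegenerate _ hyc) (h.surjective_fderiv hQ hR hx hx₁)
    (fun z => hasLineDerivAt_coneMetric hQ' hR' hx₁ z₁ z₂ z)
    (fun z => hasLineDerivAt_coneMetric hQ' hR' hx₁ z₂ z₁ z)
    (fun z => hasLineDerivAt_coneMetric hQ' hR' hx₁ z z₁ z₂) fun z => ?_
  · filter_upwards [(h.contDiffAt hx).continuousAt.preimage_mem_nhds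
      (Metric.isOpen_ball.mem_nhds hy)] with p hp
    exact h.lipschitz _ (Metric.ball_subset_closedBall hp) _ hyc
  · rw [hc]
    simp only [hz₁, hz₂, real_inner_comm z₁.2.2 z₂.2.2]
    ring

theorem gauss_vv (hx : x ∈ O) (hy : Y x ∈ Metric.ball y₀ ρ) (hx₁ : ‖x.2.2‖ = 1) :
    ‖fderiv ℝ (fderiv ℝ Y) x (0, 1, 0) (0, 1, 0) -
        (partialV Q x.1 x.2.1 / Q x.1 x.2.1) • fderiv ℝ Y x (0, 1, 0)‖
      ≤ 2 * C * Λ * ‖fderiv ℝ Y x (0, 1, 0)‖ * ‖fderiv ℝ Y x (0, 1, 0)‖ := by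
  obtain ⟨hu, hv, -⟩ := h.subset hx
  have hQx := hQ.pos hu hv
  rw [← map_smul]
  refine h.gauss hQ hR hx hy hx₁ (hQ.hasFDerivAt hu hv) (hR.hasFDerivAt hu hv) (by simp) (by simp)
    fun z => ?_
  rw [coneMetric_of_norm_eq_one hx₁]
  simp
  field_simp
  ring

theorem gauss_va (hx : x ∈ O) (hy : Y x ∈ Metric.ball y₀ ρ) (hx₁ : ‖x.2.2‖ = 1) {a : V}
    (ha : inner ℝ x.2.2 a = (0 : ℝ)) :
    ‖fderiv ℝ (fderiv ℝ Y) x (0, 1, 0) (0, 0, a) -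
        (partialV R x.1 x.2.1 / (2 * R x.1 x.2.1)) • fderiv ℝ Y x (0, 0, a)‖
      ≤ 2 * C * Λ * ‖fderiv ℝ Y x (0, 1, 0)‖ * ‖fderiv ℝ Y x (0, 0, a)‖ := by
  obtain ⟨hu, hv, -⟩ := h.subset hx
  have hRx := hR.pos hu hv
  rw [← map_smul]
  refine h.gauss hQ hR hx hy hx₁ (hQ.hasFDerivAt hu hv) (hR.hasFDerivAt hu hv) (by simp)
    (by simpa using ha) fun z => ?_
  rw [coneMetric_of_norm_eq_one hx₁]
  simp [inner_smul_left, inner_smul_right, ha]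
  field_simp

theorem gauss_aa (hx : x ∈ O) (hy : Y x ∈ Metric.ball y₀ ρ) (hx₁ : ‖x.2.2‖ = 1) {a : V}
    (ha : inner ℝ x.2.2 a = (0 : ℝ)) (ha₁ : ‖a‖ = 1) :
    ‖fderiv ℝ (fderiv ℝ Y) x (0, 0, a) (0, 0, a) -
        ((partialV R x.1 x.2.1 / Q x.1 x.2.1) • fderiv ℝ Y x (1, 0, 0) +
        (partialU R x.1 x.2.1 / Q x.1 x.2.1) • fderiv ℝ Y x (0, 1, 0))‖
      ≤ 2 * C * Λ * ‖fderiv ℝ Y x (0, 0, a)‖ * ‖fderiv ℝ Y x (0, 0, a)‖ := by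
  obtain ⟨hu, hv, -⟩ := h.subset hx
  have hQx := hQ.pos hu hv
  rw [← map_smul, ← map_smul, ← map_add]
  refine h.gauss hQ hR hx hy hx₁ (hQ.hasFDerivAt hu hv) (hR.hasFDerivAt hu hv) (by simpa using ha)
    (by simpa using ha) fun z => ?_
  rw [coneMetric_of_norm_eq_one hx₁]
  simp [ha₁]
  field_simp
  ring

end Gauss

section Region

theorem apply_fderiv_ne_zero_of_timelike (hx : x ∈ O) (hy : Y x ∈ Metric.closedBall y₀ ρ)
    {X : ConeSpace V} (hX : coneMetric Q R x X X < 0) : τ (fderiv ℝ Y x X) ≠ 0 := by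
  intro hτ
  rw [← h.isometric x hx] at hX
  have hzero : fderiv ℝ Y x X = 0 := by simpa [hτ] using h.cone _ hy _ hX.le
  simp [hzero] at hX

/-- Moving a causal vector with negative time component towards `∂_u + ∂_v` would produce a timelike
vector with vanishing time component. -/
theorem norm_fderiv_le (hQ : IsBoundedCoefficient Q) {σ : ℝ} (hσ : σ ≤ ρ)
    (hx : x ∈ chartRegion Y O τ y₀ σ) {X : ConeSpace V} (hXu : 0 ≤ X.1) (hXv : 0 ≤ X.2.1)
    (hX : coneMetric Q R x X X ≤ 0) : ‖fderiv ℝ Y x X‖ ≤ C * τ (fderiv ℝ Y x X) := by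
  obtain ⟨hxO, hxY, hT⟩ := hx
  have hQx := hQ.pos (h.subset hxO).1 (h.subset hxO).2.1
  have hy := Metric.closedBall_subset_closedBall hσ hxY
  have hfuture : 0 ≤ τ (fderiv ℝ Y x X) := by
    by_contra! hneg
    set l := -τ (fderiv ℝ Y x X) / τ (fderiv ℝ Y x (1, 1, 0)) with hl
    have hl_pos : 0 < l := div_pos (by linarith) hT
    have htimelike : coneMetric Q R x (X + l • (1, 1, 0)) (X + l • (1, 1, 0)) < 0 := by
      calc coneMetric Q R x (X + l • (1, 1, 0)) (X + l • (1, 1, 0))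
          = coneMetric Q R x X X - Q x.1 x.2.1 * l * (X.1 + X.2.1 + l) := by
            simp [coneMetric]
            ring
        _ < 0 := by
            have : 0 < Q x.1 x.2.1 * l * (X.1 + X.2.1 + l) := by positivity
            linarith
    refine h.apply_fderiv_ne_zero_of_timelike hxO hy htimelike ?_
    rw [map_add, map_smul, map_add, map_smul, hl, smul_eq_mul]
    field_simp
    ring
  have hcone := h.cone _ hy (fderiv ℝ Y x X) (by rw [h.isometric x hxO]; exact hX)
  rwa [abs_of_nonneg hfuture] at hcone

theorem mem_chartRegion_of_mem_closure (hQ : IsBoundedCoefficient Q) {σ : ℝ} (hσ : σ ≤ ρ)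
    (hx : x ∈ coneDomain V) (hcl : x ∈ closure (chartRegion Y O τ y₀ σ)) :
    x ∈ chartRegion Y O τ y₀ σ := by
  have hsub : chartRegion Y O τ y₀ σ ⊆ {p ∈ O | Y p ∈ Metric.closedBall y₀ ρ} := fun p hp =>
    ⟨hp.1, Metric.closedBall_subset_closedBall hσ hp.2.1⟩
  have hxO : x ∈ O := h.closed x hx (closure_mono hsub hcl)
  have hlim : ∃ᶠ p in 𝓝 x, p ∈ chartRegion Y O τ y₀ σ := mem_closure_iff_frequently.1 hcl
  have hYx : Y x ∈ Metric.closedBall y₀ σ :=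
    Metric.isClosed_closedBall.mem_of_frequently_of_tendsto (hlim.mono fun p hp => hp.2.1)
      (h.contDiffAt hxO).continuousAt
  have hτ_nonneg : τ (fderiv ℝ Y x (1, 1, 0)) ∈ Ici 0 :=
    isClosed_Ici.mem_of_frequently_of_tendsto (hlim.mono fun p hp => hp.2.2.le)
      (τ.continuous.continuousAt.comp (h.continuousAt_fderiv_apply hxO _))
  have htimelike : coneMetric Q R x (1, 1, 0) (1, 1, 0) < 0 := by
    simpa [coneMetric_null_plane] using hQ.pos hx.1 hx.2.1
  exact ⟨hxO, hYx, lt_of_le_of_ne' hτ_nonneg (h.apply_fderiv_ne_zero_of_timelike hxO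
    (Metric.closedBall_subset_closedBall hσ hYx) htimelike)⟩

theorem eventually_mem_chartRegion {σ σ' : ℝ} (hσ : σ < σ') (hx : x ∈ chartRegion Y O τ y₀ σ) :
    ∀ᶠ p in 𝓝 x, p ∈ chartRegion Y O τ y₀ σ' := by
  have hball : Y x ∈ Metric.ball y₀ σ' := Metric.closedBall_subset_ball hσ hx.2.1
  filter_upwards [h.isOpen.mem_nhds hx.1, (h.contDiffAt hx.1).continuousAt.preimage_mem_nhds
    (Metric.isOpen_ball.mem_nhds hball), (τ.continuous.continuousAt.comp
      (h.continuousAt_fderiv_apply hx.1 (1, 1, 0))).eventually (lt_mem_nhds hx.2.2)] with p hO hY hτ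
  exact ⟨hO, Metric.ball_subset_closedBall hY, hτ⟩

end Region

end BoundaryChart

theorem norm_le_mul_exp_of_norm_deriv_le {E : Type*} [NormedAddCommGroup E] [NormedSpace ℝ E]
    {j j' : ℝ → E} {φ φ' : ℝ → ℝ} {a b : ℝ} (hab : a ≤ b)
    (hj : ∀ x ∈ Icc a b, HasDerivAt j (j' x) x) (hφ : ∀ x ∈ Icc a b, HasDerivAt φ (φ' x) x)
    (bound : ∀ x ∈ Icc a b, ‖j' x‖ ≤ φ' x * ‖j x‖) : ‖j b‖ ≤ Real.exp (φ b - φ a) * ‖j a‖ := by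
  have hε : ∀ ε > 0, ‖j b‖ ≤ (‖j a‖ + ε) * Real.exp (φ b - φ a + ε * (b - a)) := by
    intro ε hε
    set B : ℝ → ℝ := fun x => (‖j a‖ + ε) * Real.exp (φ x - φ a + ε * (x - a)) with hB
    have hB' (x) (hx : x ∈ Icc a b) : HasDerivAt B (B x * (φ' x + ε)) x := by
      convert! ((((hφ x hx).sub_const (φ a)).add
        (((hasDerivAt_id x).sub_const a).const_mul ε)).exp).const_mul (‖j a‖ + ε) using 1
      simp [hB]
      ring
    refine image_norm_le_of_norm_deriv_right_lt_deriv_boundary' (f' := j')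
      (fun x hx => (hj x hx).continuousAt.continuousWithinAt)
      (fun x hx => (hj x (Ico_subset_Icc_self hx)).hasDerivWithinAt) (by simp [hB, hε.le])
      (fun x hx => (hB' x hx).continuousAt.continuousWithinAt)
      (fun x hx => (hB' x (Ico_subset_Icc_self hx)).hasDerivWithinAt) (fun x hx hxB => ?_)
      (right_mem_Icc.2 hab)
    have hB_pos : 0 < B x := by positivity
    calc ‖j' x‖ ≤ φ' x * B x := hxB ▸ bound x (Ico_subset_Icc_self hx)
      _ < B x * (φ' x + ε) := by nlinarith
  have hcont : Continuous fun ε => (‖j a‖ + ε) * Real.exp (φ b - φ a + ε * (b - a)) := by fun_prop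
  have hlim := (hcont.tendsto 0).mono_left (nhdsWithin_le_nhds (s := Ioi 0))
  rw [add_zero, zero_mul, add_zero, mul_comm] at hlim
  exact ge_of_tendsto hlim (eventually_mem_nhdsWithin.mono hε)

theorem apply_sub_apply_le_of_mem_closedBall {E : Type*} [NormedAddCommGroup E] [NormedSpace ℝ E]
    (τ : E →L[ℝ] ℝ) {y p q : E} {ρ : ℝ} (hp : p ∈ Metric.closedBall y ρ)
    (hq : q ∈ Metric.closedBall y ρ) : τ p - τ q ≤ ‖τ‖ * (2 * ρ) := by
  rw [← map_sub]
  refine (le_abs_self _).trans ((τ.le_opNorm _).trans ?_)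
  rw [← dist_eq_norm, two_mul]
  gcongr
  exact (dist_triangle_right _ _ y).trans (add_le_add hp hq)

namespace BoundaryChart

variable {V E : Type*} [NormedAddCommGroup V] [InnerProductSpace ℝ V]
  [NormedAddCommGroup E] [NormedSpace ℝ E] {Q R : ℝ → ℝ → ℝ} {Y : ConeSpace V → E}
  {O : Set (ConeSpace V)} {G : E → E →L[ℝ] E →L[ℝ] ℝ} {τ : E →L[ℝ] ℝ} {y₀ : E} {ρ Λ C : ℝ}
  {u v v₁ v₂ σ : ℝ} {e : V}

variable (h : BoundaryChart Q R Y O G τ y₀ ρ Λ C) (hQ : IsBoundedCoefficient Q)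

include h hQ

theorem norm_fderiv_u_le (hσ : σ ≤ ρ) {x : ConeSpace V} (hx : x ∈ chartRegion Y O τ y₀ σ) :
    ‖fderiv ℝ Y x (1, 0, 0)‖ ≤ C * τ (fderiv ℝ Y x (1, 0, 0)) :=
  h.norm_fderiv_le hQ hσ hx zero_le_one le_rfl (by simp [coneMetric_null_plane])

theorem norm_fderiv_v_le (hσ : σ ≤ ρ) {x : ConeSpace V} (hx : x ∈ chartRegion Y O τ y₀ σ) :
    ‖fderiv ℝ Y x (0, 1, 0)‖ ≤ C * τ (fderiv ℝ Y x (0, 1, 0)) :=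
  h.norm_fderiv_le hQ hσ hx le_rfl zero_le_one (by simp [coneMetric_null_plane])

omit hQ in
theorem hasDerivAt_nullLine (hx : (u, v, e) ∈ O) :
    HasDerivAt (fun v => Y (u, v, e)) (fderiv ℝ Y (u, v, e) (0, 1, 0)) v :=
  (h.hasFDerivAt hx).comp_hasDerivAt v
    ((hasDerivAt_const v u).prodMk ((hasDerivAt_id v).prodMk (hasDerivAt_const v e)))

omit hQ in
theorem nullLine_mem_closedBall {D : ℝ} (hv : v₁ ≤ v₂) (hline : ∀ v ∈ Icc v₁ v₂, (u, v, e) ∈ O)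
    (hstart : Y (u, v₁, e) ∈ Metric.closedBall y₀ σ)
    (hD : ∀ v ∈ Ico v₁ v₂, ‖fderiv ℝ Y (u, v, e) (0, 1, 0)‖ ≤ D) :
    Y (u, v₂, e) ∈ Metric.closedBall y₀ (σ + D * (v₂ - v₁)) := by
  have hY := norm_image_sub_le_of_norm_deriv_right_le_segment (f := fun y => Y (u, y, e))
    (fun y hy => (h.hasDerivAt_nullLine (hline y hy)).continuousAt.continuousWithinAt)
    (fun y hy => (h.hasDerivAt_nullLine (hline y (Ico_subset_Icc_self hy))).hasDerivWithinAt)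
    hD v₂ (right_mem_Icc.2 hv)
  rw [← dist_eq_norm] at hY
  rw [add_comm]
  exact (dist_triangle _ _ _).trans (add_le_add hY hstart)

omit hQ in
theorem hasDerivAt_fderiv_nullLine (hx : (u, v, e) ∈ O) (z : ConeSpace V) :
    HasDerivAt (fun v => fderiv ℝ Y (u, v, e) z)
      (fderiv ℝ (fderiv ℝ Y) (u, v, e) (0, 1, 0) z) v := by
  have hline : HasDerivAt (fun v => ((u, v, e) : ConeSpace V)) (0, 1, 0) v :=
    (hasDerivAt_const v u).prodMk ((hasDerivAt_id v).prodMk (hasDerivAt_const v e))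
  have hD := (h.hasFDerivAt_fderiv hx).comp_hasDerivAt (E := ConeSpace V →L[ℝ] E) v hline
  simpa using hD.clm_apply (hasDerivAt_const v z)

/-- A bound for the factor by which the norm of a vector can grow under parallel transport along a
causal curve inside the ball of radius `ρ` about `y₀`. -/
def transportFactor (τ : E →L[ℝ] ℝ) (ρ Λ C : ℝ) : ℝ :=
  Real.exp (2 * C * Λ * (C * (‖τ‖ * (2 * ρ))))

/-- The error in `hz` is proportional to the velocity of the null line, hence to the derivative of
`τ ∘ Y` along it, and `τ ∘ Y` is bounded. -/
theorem norm_fderiv_nullLine_le (hσ : σ ≤ ρ) (hv : v₁ ≤ v₂)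
    (hline : ∀ v ∈ Icc v₁ v₂, (u, v, e) ∈ chartRegion Y O τ y₀ σ) {z : ConeSpace V} {g g' : ℝ → ℝ}
    (hg₀ : ∀ v ∈ Icc v₁ v₂, 0 < g v) (hg : ∀ v ∈ Icc v₁ v₂, HasDerivAt g (g' v) v)
    (hz : ∀ v ∈ Icc v₁ v₂,
      ‖fderiv ℝ (fderiv ℝ Y) (u, v, e) (0, 1, 0) z - (g' v / g v) • fderiv ℝ Y (u, v, e) z‖
        ≤ 2 * C * Λ * ‖fderiv ℝ Y (u, v, e) (0, 1, 0)‖ * ‖fderiv ℝ Y (u, v, e) z‖) :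
    ‖fderiv ℝ Y (u, v₂, e) z‖
      ≤ g v₂ / g v₁ * (transportFactor τ ρ Λ C * ‖fderiv ℝ Y (u, v₁, e) z‖) := by
  have hΛ := h.lipschitzConst_nonneg
  have hC := h.bound_pos
  have hgrowth := norm_le_mul_exp_of_norm_deriv_le hv
    (j := fun v => (g v)⁻¹ • fderiv ℝ Y (u, v, e) z)
    (φ := fun v => 2 * C * Λ * (C * τ (Y (u, v, e))))
    (fun v hv => ((hg v hv).inv (hg₀ v hv).ne').smul
      (h.hasDerivAt_fderiv_nullLine (hline v hv).1 z))
    (fun v hv => ((τ.hasFDerivAt.comp_hasDerivAt v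
      (h.hasDerivAt_nullLine (hline v hv).1)).const_mul C).const_mul _) fun v hv => ?_
  · have hball (v) (hv : v ∈ Icc v₁ v₂) : Y (u, v, e) ∈ Metric.closedBall y₀ ρ :=
      Metric.closedBall_subset_closedBall hσ (hline v hv).2.1
    have hτ := apply_sub_apply_le_of_mem_closedBall τ (hball _ (right_mem_Icc.2 hv))
      (hball _ (left_mem_Icc.2 hv))
    have hg₁ := hg₀ _ (left_mem_Icc.2 hv)
    have hg₂ := hg₀ _ (right_mem_Icc.2 hv)
    rw [norm_smul, norm_smul, Real.norm_of_nonneg (inv_nonneg.2 hg₂.le),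
      Real.norm_of_nonneg (inv_nonneg.2 hg₁.le), inv_mul_le_iff₀ hg₂, ← mul_sub, ← mul_sub]
      at hgrowth
    calc ‖fderiv ℝ Y (u, v₂, e) z‖ ≤ _ := hgrowth
      _ ≤ g v₂ * (transportFactor τ ρ Λ C * ((g v₁)⁻¹ * ‖fderiv ℝ Y (u, v₁, e) z‖)) := by
        unfold transportFactor
        gcongr
      _ = _ := by ring
  · have hgv := hg₀ v hv
    calc _ = ‖(g v)⁻¹ • (fderiv ℝ (fderiv ℝ Y) (u, v, e) (0, 1, 0) z -
            (g' v / g v) • fderiv ℝ Y (u, v, e) z)‖ := by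
          rw [smul_sub, smul_smul, sub_eq_add_neg, ← neg_smul]
          congr 3
          field_simp
      _ ≤ (g v)⁻¹ * (2 * C * Λ * (C * τ (fderiv ℝ Y (u, v, e) (0, 1, 0))) *
            ‖fderiv ℝ Y (u, v, e) z‖) := by
          rw [norm_smul, Real.norm_of_nonneg (inv_nonneg.2 hgv.le)]
          refine mul_le_mul_of_nonneg_left ((hz v hv).trans ?_) (inv_nonneg.2 hgv.le)
          gcongr
          exact h.norm_fderiv_v_le hQ hσ (hline v hv)
      _ = _ := by
          rw [norm_smul, Real.norm_of_nonneg (inv_nonneg.2 hgv.le)]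
          ring

section FrameBounds

variable [FiniteDimensional ℝ V] (hR : IsBoundedCoefficient R)

include hR

theorem norm_fderiv_v_nullLine_le (hσ : σ < ρ) (hv : v₁ ≤ v₂) (he : ‖e‖ = 1)
    (hline : ∀ v ∈ Icc v₁ v₂, (u, v, e) ∈ chartRegion Y O τ y₀ σ) :
    ‖fderiv ℝ Y (u, v₂, e) (0, 1, 0)‖
      ≤ Q u v₂ / Q u v₁ * (transportFactor τ ρ Λ C * ‖fderiv ℝ Y (u, v₁, e) (0, 1, 0)‖) := by
  have hdom (v) (hv : v ∈ Icc v₁ v₂) := h.subset (hline v hv).1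
  exact h.norm_fderiv_nullLine_le hQ hσ.le hv hline
    (fun v hv => hQ.pos (hdom v hv).1 (hdom v hv).2.1)
    (fun v hv => hQ.hasDerivAt_right (hdom v hv).1 (hdom v hv).2.1) fun v hv =>
      h.gauss_vv hQ hR (hline v hv).1 (Metric.closedBall_subset_ball hσ (hline v hv).2.1) he

theorem norm_fderiv_sphere_nullLine_le (hσ : σ < ρ) (hv : v₁ ≤ v₂) (he : ‖e‖ = 1)
    (hline : ∀ v ∈ Icc v₁ v₂, (u, v, e) ∈ chartRegion Y O τ y₀ σ) {a : V}
    (ha : inner ℝ e a = (0 : ℝ)) :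
    ‖fderiv ℝ Y (u, v₂, e) (0, 0, a)‖
      ≤ √(R u v₂) / √(R u v₁) * (transportFactor τ ρ Λ C * ‖fderiv ℝ Y (u, v₁, e) (0, 0, a)‖) := by
  have hdom (v) (hv : v ∈ Icc v₁ v₂) := h.subset (hline v hv).1
  have hR_pos (v) (hv : v ∈ Icc v₁ v₂) := hR.pos (hdom v hv).1 (hdom v hv).2.1
  refine h.norm_fderiv_nullLine_le hQ hσ.le hv hline (fun v hv => Real.sqrt_pos.2 (hR_pos v hv))
    (fun v hv => (hR.hasDerivAt_right (hdom v hv).1 (hdom v hv).2.1).sqrt (hR_pos v hv).ne')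
    fun v hv => ?_
  rw [div_div, mul_assoc, Real.mul_self_sqrt (hR_pos v hv).le]
  exact h.gauss_va hQ hR (hline v hv).1 (Metric.closedBall_subset_ball hσ (hline v hv).2.1) he ha

/-- The ratio `M / m` bounds the quotient of the values of `Q` along the null line. -/
theorem nullLine_mem_chartRegion {σ' m M D : ℝ} (hσ' : σ' < ρ) (he : ‖e‖ = 1) (hm : 0 < m)
    (hbound : ∀ v ∈ Ico v₁ 0, m ≤ Q u v ∧ Q u v ≤ M)
    (hstart : (u, v₁, e) ∈ chartRegion Y O τ y₀ σ)
    (hD : M / m * (transportFactor τ ρ Λ C * ‖fderiv ℝ Y (u, v₁, e) (0, 1, 0)‖) ≤ D)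
    (hshort : σ + D * -v₁ < σ') (hv : v ∈ Ico v₁ 0) :
    (u, v, e) ∈ chartRegion Y O τ y₀ σ' ∧ ‖fderiv ℝ Y (u, v, e) (0, 1, 0)‖ ≤ D := by
  obtain ⟨hu, hv₁, he₀⟩ := h.subset hstart.1
  have hv₁mem : v₁ ∈ Ico v₁ 0 := ⟨le_rfl, hv₁⟩
  have hM : 0 < M := hm.trans_le ((hbound _ hv₁mem).1.trans (hbound _ hv₁mem).2)
  have hD₀ : 0 ≤ D := by unfold transportFactor at hD; exact le_trans (by positivity) hD
  have hσσ' : σ ≤ σ' := by nlinarith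
  have hframe {x : ℝ} (hx : x ∈ Ico v₁ 0)
      (hline : Icc v₁ x ⊆ {y | (u, y, e) ∈ chartRegion Y O τ y₀ σ'}) :
      ‖fderiv ℝ Y (u, x, e) (0, 1, 0)‖ ≤ D := by
    refine (h.norm_fderiv_v_nullLine_le hQ hR hσ' hx.1 he hline).trans (le_trans ?_ hD)
    unfold transportFactor
    gcongr
    · exact (hbound x hx).2
    · exact (hbound v₁ hv₁mem).1
  suffices hline : Icc v₁ v ⊆ {y | (u, y, e) ∈ chartRegion Y O τ y₀ σ'} from
    ⟨hline (right_mem_Icc.2 hv.1), hframe hv hline⟩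
  have hpt : Continuous fun y : ℝ => ((u, y, e) : ConeSpace V) := by fun_prop
  refine IsClosed.Icc_subset_of_forall_mem_nhdsGT_of_Icc_subset ?_
    ⟨hstart.1, Metric.closedBall_subset_closedBall hσσ' hstart.2.1, hstart.2.2⟩
    fun x hx hline => ?_
  · refine isClosed_of_closure_subset fun x hx => ?_
    have hxI := closure_minimal inter_subset_right isClosed_Icc hx
    exact ⟨h.mem_chartRegion_of_mem_closure hQ hσ'.le ⟨hu, hxI.2.trans_lt hv.2, he₀⟩
      (map_mem_closure (f := fun y : ℝ => ((u, y, e) : ConeSpace V)) hpt hx fun y hy => hy.1), hxI⟩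
  · have hxY := h.nullLine_mem_closedBall hx.1 (fun y hy => (hline hy).1) hstart.2.1
      fun y hy => hframe ⟨hy.1, hy.2.trans (hx.2.trans hv.2)⟩
        ((Icc_subset_Icc_right hy.2.le).trans hline)
    have hxshort : σ + D * (x - v₁) < σ' := by nlinarith [hx.2, hv.2]
    have hxS := hline (right_mem_Icc.2 hx.1)
    exact nhdsWithin_le_nhds (hpt.continuousAt.eventually
      (h.eventually_mem_chartRegion hxshort ⟨hxS.1, hxY, hxS.2.2⟩))

end FrameBounds

end BoundaryChart

theorem exists_unit_orthogonal {V : Type*} [NormedAddCommGroup V] [InnerProductSpace ℝ V]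
    (hV : 1 < Module.finrank ℝ V) (e : V) : ∃ f : V, ‖f‖ = 1 ∧ inner ℝ e f = (0 : ℝ) := by
  have hne : (ℝ ∙ e)ᗮ ≠ ⊥ := by
    rw [Ne, Submodule.orthogonal_eq_bot_iff]
    intro htop
    have hcard := finrank_span_le_card (R := ℝ) ({e} : Set V)
    rw [htop, finrank_top] at hcard
    simp only [toFinset_singleton, Finset.card_singleton] at hcard
    omega
  obtain ⟨f, hf, hf₀⟩ := Submodule.exists_mem_ne_zero_of_ne_bot hne
  exact ⟨‖f‖⁻¹ • f, norm_smul_inv_norm hf₀,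
    by rw [inner_smul_right, Submodule.mem_orthogonal_singleton_iff_inner_right.1 hf, mul_zero]⟩

theorem exists_deriv_ge_of_abs_le {q q' : ℝ → ℝ} {δ K : ℝ} (hδ : 0 < δ)
    (hq : ∀ α ∈ Icc 0 δ, HasDerivAt q (q' α) α) (hK : ∀ α ∈ Icc 0 δ, |q α| ≤ K) :
    ∃ α ∈ Icc 0 δ, -(2 * K) / δ ≤ q' α := by
  obtain ⟨α, hα, hslope⟩ := exists_hasDerivAt_eq_slope q q' hδ
    (fun α hα => (hq α hα).continuousAt.continuousWithinAt)
    (fun α hα => hq α (Ioo_subset_Icc_self hα))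
  refine ⟨α, Ioo_subset_Icc_self hα, ?_⟩
  rw [hslope, sub_zero]
  have h₀ := (abs_le.1 (hK 0 (left_mem_Icc.2 hδ.le))).2
  have hδK := (abs_le.1 (hK δ (right_mem_Icc.2 hδ.le))).1
  gcongr
  linarith

section Arc

variable {V : Type*} [NormedAddCommGroup V] [InnerProductSpace ℝ V] {e f : V}

/-- The great circle through `e` with initial velocity `f`. -/
def greatCircle (e f : V) (α : ℝ) : V := Real.cos α • e + Real.sin α • f

/-- The velocity of the great circle through `e` with initial velocity `f`. -/
def greatCircleDeriv (e f : V) (α : ℝ) : V := -Real.sin α • e + Real.cos α • f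

theorem greatCircle_zero : greatCircle e f 0 = e := by simp [greatCircle]

theorem hasDerivAt_greatCircle (α : ℝ) :
    HasDerivAt (greatCircle e f) (greatCircleDeriv e f α) α :=
  ((Real.hasDerivAt_cos α).smul_const e).add ((Real.hasDerivAt_sin α).smul_const f)

theorem hasDerivAt_greatCircleDeriv (α : ℝ) :
    HasDerivAt (greatCircleDeriv e f) (-greatCircle e f α) α := by
  convert! ((Real.hasDerivAt_sin α).neg.smul_const e).add
    ((Real.hasDerivAt_cos α).smul_const f) using 1
  simp [greatCircle, add_comm]

theorem norm_smul_add_smul_eq_one {a b : ℝ} (hab : a ^ 2 + b ^ 2 = 1) (he : ‖e‖ = 1) (hf : ‖f‖ = 1)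
    (hef : inner ℝ e f = (0 : ℝ)) : ‖a • e + b • f‖ = 1 := by
  rw [← sq_eq_sq₀ (norm_nonneg _) zero_le_one, sq, norm_add_sq_eq_norm_sq_add_norm_sq_real
    (by rw [inner_smul_left, inner_smul_right, hef, mul_zero, mul_zero]), norm_smul, norm_smul,
    he, hf, mul_one, mul_one, Real.norm_eq_abs, Real.norm_eq_abs, abs_mul_abs_self,
    abs_mul_abs_self]
  linarith

theorem norm_greatCircle (he : ‖e‖ = 1) (hf : ‖f‖ = 1) (hef : inner ℝ e f = (0 : ℝ)) (α : ℝ) :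
    ‖greatCircle e f α‖ = 1 :=
  norm_smul_add_smul_eq_one (Real.cos_sq_add_sin_sq α) he hf hef

theorem norm_greatCircleDeriv (he : ‖e‖ = 1) (hf : ‖f‖ = 1) (hef : inner ℝ e f = (0 : ℝ)) (α : ℝ) :
    ‖greatCircleDeriv e f α‖ = 1 :=
  norm_smul_add_smul_eq_one (by rw [neg_sq, Real.sin_sq_add_cos_sq]) he hf hef

theorem inner_greatCircle_greatCircleDeriv (he : ‖e‖ = 1) (hf : ‖f‖ = 1)
    (hef : inner ℝ e f = (0 : ℝ)) (α : ℝ) :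
    inner ℝ (greatCircle e f α) (greatCircleDeriv e f α) = (0 : ℝ) := by
  simp only [greatCircle, greatCircleDeriv, inner_add_left, inner_add_right, inner_smul_left,
    inner_smul_right, hef, real_inner_comm e f, real_inner_self_eq_norm_sq, he, hf]
  simp
  ring

end Arc

theorem IsBoundedCoefficient.exists_bounds_right {Q : ℝ → ℝ → ℝ} (hQ : IsBoundedCoefficient Q)
    {u : ℝ} (hu : u < 0) (v₁ : ℝ) :
    ∃ m > 0, ∃ M, ∀ v ∈ Ico v₁ 0, m ≤ Q u v ∧ Q u v ≤ M := by
  obtain ⟨m, hm, M, h⟩ := hQ.bounds (min u v₁) (min_lt_of_left_lt hu)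
  exact ⟨m, hm, M, fun v hv =>
    h u ⟨min_le_left _ _, hu⟩ v ⟨(min_le_right _ _).trans hv.1, hv.2⟩⟩

namespace BoundaryChart

variable {V E : Type*} [NormedAddCommGroup V] [InnerProductSpace ℝ V] [FiniteDimensional ℝ V]
  [NormedAddCommGroup E] [NormedSpace ℝ E] {Q R : ℝ → ℝ → ℝ} {Y : ConeSpace V → E}
  {O : Set (ConeSpace V)} {G : E → E →L[ℝ] E →L[ℝ] ℝ} {τ : E →L[ℝ] ℝ} {y₀ : E} {ρ Λ C : ℝ}
  {u v v₁ σ σ' A B D : ℝ} {e f a : V}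

variable (h : BoundaryChart Q R Y O G τ y₀ ρ Λ C) (hQ : IsBoundedCoefficient Q)
  (hR : IsBoundedCoefficient R)

include h hQ

omit [FiniteDimensional ℝ V] in
theorem le_mul_apply_fderiv_u (hσ : σ ≤ ρ) (hx : (u, v, e) ∈ chartRegion Y O τ y₀ σ)
    (hD : ‖fderiv ℝ Y (u, v, e) (0, 1, 0)‖ ≤ D) :
    Q u v ≤ 2 * C ^ 2 * D * τ (fderiv ℝ Y (u, v, e) (1, 0, 0)) := by
  have hC := h.bound_pos
  have hnull : ‖coneMetric Q R (u, v, e) (1, 0, 0) (0, 1, 0)‖ = Q u v / 2 := by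
    simp [coneMetric, coneRound, (hQ.pos (h.subset hx.1).1 (h.subset hx.1).2.1).le]
  have hbound : Q u v / 2 ≤ C * (C * τ (fderiv ℝ Y (u, v, e) (1, 0, 0))) * D := by
    rw [← hnull, ← h.isometric _ hx.1]
    refine ((G _).le_opNorm₂ _ _).trans ?_
    gcongr
    · exact mul_nonneg hC.le ((norm_nonneg _).trans (h.norm_fderiv_u_le hQ hσ hx))
    · exact h.bounded _ (Metric.closedBall_subset_closedBall hσ hx.2.1)
    · exact h.norm_fderiv_u_le hQ hσ hx
  linarith

include hR

/-- This is the second fundamental form of the spheres in the time direction of the chart: it is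
as negative as `∂_v r²`. -/
theorem apply_fderiv_fderiv_sphere_le (hσ : σ < ρ) (hx : (u, v, e) ∈ chartRegion Y O τ y₀ σ)
    (he : ‖e‖ = 1) (ha : inner ℝ e a = (0 : ℝ)) (ha₁ : ‖a‖ = 1) (hD₀ : 0 < D)
    (hD : ‖fderiv ℝ Y (u, v, e) (0, 1, 0)‖ ≤ D) (hA : ‖fderiv ℝ Y (u, v, e) (0, 0, a)‖ ≤ A)
    (hB : 0 ≤ B) (hRv : partialV R u v ≤ -B) (hRu : partialU R u v ≤ 0) :
    τ (fderiv ℝ (fderiv ℝ Y) (u, v, e) (0, 0, a) (0, 0, a))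
      ≤ ‖τ‖ * (2 * C * Λ * A * A) - B / (2 * C ^ 2 * D) := by
  have hC := h.bound_pos
  have hΛ := h.lipschitzConst_nonneg
  have hQ₀ := hQ.pos (h.subset hx.1).1 (h.subset hx.1).2.1
  set W := fderiv ℝ (fderiv ℝ Y) (u, v, e) (0, 0, a) (0, 0, a)
  set H := (partialV R u v / Q u v) • fderiv ℝ Y (u, v, e) (1, 0, 0) +
    (partialU R u v / Q u v) • fderiv ℝ Y (u, v, e) (0, 1, 0) with hH
  have herror : τ (W - H) ≤ ‖τ‖ * (2 * C * Λ * A * A) := by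
    refine (le_abs_self _).trans (τ.le_opNorm_of_le ?_)
    refine (h.gauss_aa hQ hR hx.1 (Metric.closedBall_subset_ball hσ hx.2.1) he ha ha₁).trans ?_
    have hA₀ : 0 ≤ A := (norm_nonneg _).trans hA
    gcongr
  have hmain : τ H ≤ -(B / (2 * C ^ 2 * D)) := by
    have hτv : 0 ≤ τ (fderiv ℝ Y (u, v, e) (0, 1, 0)) :=
      nonneg_of_mul_nonneg_right ((norm_nonneg _).trans (h.norm_fderiv_v_le hQ hσ.le hx)) hC
    have hτu : (2 * C ^ 2 * D)⁻¹ ≤ τ (fderiv ℝ Y (u, v, e) (1, 0, 0)) / Q u v := by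
      rw [inv_le_iff_one_le_mul₀ (by positivity), div_mul_eq_mul_div, one_le_div hQ₀, mul_comm]
      exact h.le_mul_apply_fderiv_u hQ hσ.le hx hD
    calc τ H = partialV R u v * (τ (fderiv ℝ Y (u, v, e) (1, 0, 0)) / Q u v) +
          partialU R u v * (τ (fderiv ℝ Y (u, v, e) (0, 1, 0)) / Q u v) := by
          rw [hH, map_add, map_smul, map_smul, smul_eq_mul, smul_eq_mul]
          ring
      _ ≤ -B * (2 * C ^ 2 * D)⁻¹ + 0 := by
          have hinv : 0 ≤ (2 * C ^ 2 * D)⁻¹ := by positivity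
          exact add_le_add (by nlinarith)
            (mul_nonpos_of_nonpos_of_nonneg hRu (div_nonneg hτv hQ₀.le))
      _ = -(B / (2 * C ^ 2 * D)) := by ring
  have hsplit : τ W = τ H + τ (W - H) := by rw [← map_add, add_sub_cancel]
  linarith

/-- The velocity of a great circle changes in the radial direction, which `Y` does not see. -/
theorem hasDerivAt_fderiv_greatCircle {α : ℝ} (hx : (u, v, greatCircle e f α) ∈ O)
    (hy : Y (u, v, greatCircle e f α) ∈ Metric.closedBall y₀ ρ) (hα : ‖greatCircle e f α‖ = 1) :
    HasDerivAt (fun α => fderiv ℝ Y (u, v, greatCircle e f α) (0, 0, greatCircleDeriv e f α))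
      (fderiv ℝ (fderiv ℝ Y) (u, v, greatCircle e f α) (0, 0, greatCircleDeriv e f α)
        (0, 0, greatCircleDeriv e f α)) α := by
  have hpoint : HasDerivAt (fun α => ((u, v, greatCircle e f α) : ConeSpace V))
      (0, 0, greatCircleDeriv e f α) α :=
    (hasDerivAt_const α u).prodMk ((hasDerivAt_const α v).prodMk (hasDerivAt_greatCircle α))
  have hvelocity : HasDerivAt (fun α => ((0, 0, greatCircleDeriv e f α) : ConeSpace V))
      (-(0, 0, greatCircle e f α)) α := by
    simpa using (hasDerivAt_const α (0 : ℝ)).prodMk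
      ((hasDerivAt_const α (0 : ℝ)).prodMk (hasDerivAt_greatCircleDeriv (e := e) (f := f) α))
  have hderiv := ((h.hasFDerivAt_fderiv hx).comp_hasDerivAt (E := ConeSpace V →L[ℝ] E) α
    hpoint).clm_apply hvelocity
  rwa [map_neg, Function.comp_apply, h.fderiv_radial hQ hR hx hy hα, neg_zero, add_zero] at hderiv

theorem exists_nullStrip (hσσ' : σ < σ') (hσ' : σ' < ρ) (he : ‖e‖ = 1) (hu : u < 0)
    (hv₁ : v₁ < 0) (hline : ∀ v ∈ Ico v₁ 0, (u, v, e) ∈ chartRegion Y O τ y₀ σ) :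
    ∃ v₂ ∈ Ico v₁ 0, ∃ D > 0, ∀ᶠ e' in 𝓝 e, ‖e'‖ = 1 → ∀ v ∈ Ico v₂ 0,
      (u, v, e') ∈ chartRegion Y O τ y₀ σ' ∧ ‖fderiv ℝ Y (u, v, e') (0, 1, 0)‖ ≤ D := by
  obtain ⟨m, hm, M, hQb⟩ := hQ.exists_bounds_right hu v₁
  have hM : 0 < M := hm.trans_le ((hQb v₁ ⟨le_rfl, hv₁⟩).1.trans (hQb v₁ ⟨le_rfl, hv₁⟩).2)
  have hT : 0 < transportFactor τ ρ Λ C := Real.exp_pos _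
  set K := M / m * (transportFactor τ ρ Λ C * ‖fderiv ℝ Y (u, v₁, e) (0, 1, 0)‖) with hK
  set D := M / m * (transportFactor τ ρ Λ C * (K + 1)) with hD
  have hD_pos : 0 < D := by positivity
  obtain ⟨σ'', hσσ'', hσ''⟩ := exists_between hσσ'
  have hK_bound : ∀ v ∈ Ico v₁ 0, ‖fderiv ℝ Y (u, v, e) (0, 1, 0)‖ ≤ K := fun v hv => by
    refine (h.norm_fderiv_v_nullLine_le hQ hR (hσσ'.trans hσ') hv.1 he
      fun y hy => hline y ⟨hy.1, hy.2.trans_lt hv.2⟩).trans ?_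
    rw [hK]
    gcongr
    exacts [(hQb v hv).2, (hQb v₁ ⟨le_rfl, hv₁⟩).1]
  obtain ⟨v₂, hshort, hv₂⟩ : ∃ v₂, σ'' + D * -v₂ < σ' ∧ v₂ ∈ Ico v₁ 0 := by
    have hcont : Continuous fun v => σ'' + D * -v := by fun_prop
    have hlim := (hcont.tendsto 0).mono_left (nhdsWithin_le_nhds (s := Iio 0))
    rw [neg_zero, mul_zero, add_zero] at hlim
    exact ((hlim.eventually (gt_mem_nhds hσ'')).and (Ico_mem_nhdsLT hv₁)).exists
  refine ⟨v₂, hv₂, D, hD_pos, ?_⟩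
  have hpt : ContinuousAt (fun e' : V => ((u, v₂, e') : ConeSpace V)) e := by fun_prop
  have hnorm := hpt.eventually (((h.continuousAt_fderiv_apply (hline v₂ hv₂).1
    (0, 1, 0)).norm).eventually (gt_mem_nhds ((hK_bound v₂ hv₂).trans_lt (lt_add_one K))))
  filter_upwards [hpt.eventually (h.eventually_mem_chartRegion hσσ'' (hline v₂ hv₂)), hnorm]
    with e' hmem hlt he' v hv
  refine h.nullLine_mem_chartRegion hQ hR hσ' he' hm
    (fun v hv => hQb v ⟨hv₂.1.trans hv.1, hv.2⟩) hmem ?_ hshort hv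
  rw [hD]
  gcongr

theorem exists_greatCircle_strip (hσσ' : σ < σ') (hσ' : σ' < ρ) (he : ‖e‖ = 1) (hf : ‖f‖ = 1)
    (hef : inner ℝ e f = (0 : ℝ)) (hu : u < 0) (hv₁ : v₁ < 0)
    (hline : ∀ v ∈ Ico v₁ 0, (u, v, e) ∈ chartRegion Y O τ y₀ σ) :
    ∃ δ > 0, ∃ D > 0, ∃ A, ∀ᶠ v in 𝓝[<] 0, ∀ α ∈ Icc 0 δ,
      (u, v, greatCircle e f α) ∈ chartRegion Y O τ y₀ σ' ∧
      ‖fderiv ℝ Y (u, v, greatCircle e f α) (0, 1, 0)‖ ≤ D ∧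
      ‖fderiv ℝ Y (u, v, greatCircle e f α) (0, 0, greatCircleDeriv e f α)‖ ≤ A := by
  obtain ⟨m, hm, M, hRb⟩ := hR.exists_bounds_right hu v₁
  obtain ⟨v₂, hv₂, D, hD, hstrip⟩ := h.exists_nullStrip hQ hR hσσ' hσ' he hu hv₁ hline
  have hcircle : ContinuousAt (greatCircle e f) 0 := (hasDerivAt_greatCircle 0).continuousAt
  have hframe : ContinuousAt
      (fun α => ‖fderiv ℝ Y (u, v₂, greatCircle e f α) (0, 0, greatCircleDeriv e f α)‖) 0 := by
    refine (h.hasDerivAt_fderiv_greatCircle hQ hR ?_ ?_ (norm_greatCircle he hf hef 0)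
      ).continuousAt.norm <;> rw [greatCircle_zero]
    exacts [(hline v₂ hv₂).1, Metric.closedBall_subset_closedBall (hσσ'.trans hσ').le
      (hline v₂ hv₂).2.1]
  set A₀ := ‖fderiv ℝ Y (u, v₂, greatCircle e f 0) (0, 0, greatCircleDeriv e f 0)‖ + 1
  rw [← greatCircle_zero (e := e) (f := f)] at hstrip
  obtain ⟨δ, hδ, hball⟩ := Metric.nhds_basis_closedBall.eventually_iff.1
    ((hcircle.eventually hstrip).and (hframe.eventually (gt_mem_nhds (lt_add_one _))))
  refine ⟨δ, hδ, D, hD, √M / √m * (transportFactor τ ρ Λ C * A₀), ?_⟩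
  filter_upwards [Ico_mem_nhdsLT hv₂.2] with v hv α hα
  have hn := norm_greatCircle he hf hef α
  obtain ⟨hαstrip, hα₀⟩ := hball (x := α)
    (by rw [Real.closedBall_eq_Icc]; exact ⟨by linarith [hα.1], by linarith [hα.2]⟩)
  refine ⟨(hαstrip hn v hv).1, (hαstrip hn v hv).2, ?_⟩
  refine (h.norm_fderiv_sphere_nullLine_le hQ hR hσ' hv.1 hn
    (fun y hy => (hαstrip hn y ⟨hy.1, hy.2.trans_lt hv.2⟩).1)
    (inner_greatCircle_greatCircleDeriv he hf hef α)).trans ?_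
  have hT : 0 < transportFactor τ ρ Λ C := Real.exp_pos _
  gcongr
  exacts [(hRb v ⟨hv₂.1.trans hv.1, hv.2⟩).2, (hRb v₂ hv₂).1]

/-- Along the limiting null line the derivative of `τ ∘ Y` with respect to the angle of an arc of
fixed length stays bounded, while its second derivative is the expansion, which tends to `-∞`. -/
theorem false_of_nullLine (hV : 1 < Module.finrank ℝ V) (hσ : σ < ρ) (he : ‖e‖ = 1) (hu : u < 0)
    (hv₁ : v₁ < 0) (hline : ∀ v ∈ Ico v₁ 0, (u, v, e) ∈ chartRegion Y O τ y₀ σ)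
    (hRv : Tendsto (partialV R u) (𝓝[<] 0) atBot)
    (hRu : ∀ᶠ v in 𝓝[<] 0, partialU R u v ≤ 0) : False := by
  have hC := h.bound_pos
  obtain ⟨f, hf, hef⟩ := exists_unit_orthogonal hV e
  obtain ⟨σ', hσσ', hσ'⟩ := exists_between hσ
  obtain ⟨δ, hδ, D, hD, A, hstrip⟩ :=
    h.exists_greatCircle_strip hQ hR hσσ' hσ' he hf hef hu hv₁ hline
  set K := ‖τ‖ * A
  set B := |2 * C ^ 2 * D * (‖τ‖ * (2 * C * Λ * A * A) + 2 * K / δ + 1)|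
  obtain ⟨v, ⟨hv, hRvB⟩, hRu₀⟩ :=
    ((hstrip.and (hRv.eventually (eventually_le_atBot (-B)))).and hRu).exists
  obtain ⟨α, hα, hlower⟩ := exists_deriv_ge_of_abs_le hδ
    (fun α hα => τ.hasFDerivAt.comp_hasDerivAt α (h.hasDerivAt_fderiv_greatCircle hQ hR
      (hv α hα).1.1 (Metric.closedBall_subset_closedBall hσ'.le (hv α hα).1.2.1)
      (norm_greatCircle he hf hef α)))
    (fun α hα => τ.le_opNorm_of_le (hv α hα).2.2)
  have hupper := h.apply_fderiv_fderiv_sphere_le hQ hR hσ' (hv α hα).1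
    (norm_greatCircle he hf hef α) (inner_greatCircle_greatCircleDeriv he hf hef α)
    (norm_greatCircleDeriv he hf hef α) hD (hv α hα).2.1 (hv α hα).2.2 (abs_nonneg _) hRvB hRu₀
  have hB : ‖τ‖ * (2 * C * Λ * A * A) + 2 * K / δ + 1 ≤ B / (2 * C ^ 2 * D) := by
    rw [le_div_iff₀' (by positivity)]
    exact le_abs_self _
  rw [neg_div] at hlower
  linarith

end BoundaryChart

section RightDerivative

variable {E : Type*} [NormedAddCommGroup E] [NormedSpace ℝ E] {a b : ℝ}

theorem norm_sub_le_of_norm_deriv_right_le {f f' : ℝ → E} {B B' : ℝ → ℝ}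
    (hf : ContinuousOn f (Icc a b)) (hf' : ∀ x ∈ Ico a b, HasDerivWithinAt f (f' x) (Ici x) x)
    (hB : ContinuousOn B (Icc a b)) (hB' : ∀ x ∈ Ico a b, HasDerivWithinAt B (B' x) (Ici x) x)
    (bound : ∀ x ∈ Ico a b, ‖f' x‖ ≤ B' x) {x : ℝ} (hx : x ∈ Icc a b) :
    ‖f x - f a‖ ≤ B x - B a :=
  image_norm_le_of_norm_deriv_right_le_deriv_boundary' (f := fun x => f x - f a)
    (B := fun x => B x - B a) (hf.sub continuousOn_const) (fun x hx => (hf' x hx).sub_const _)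
    (by simp) (hB.sub continuousOn_const) (fun x hx => (hB' x hx).sub_const _) bound hx

theorem le_of_deriv_right_nonneg {f f' : ℝ → ℝ} (hab : a ≤ b)
    (hf : ContinuousOn f (Icc a b)) (hf' : ∀ x ∈ Ico a b, HasDerivWithinAt f (f' x) (Ici x) x)
    (hnonneg : ∀ x ∈ Ico a b, 0 ≤ f' x) : f a ≤ f b := by
  simpa using norm_sub_le_of_norm_deriv_right_le (f := fun _ => (0 : ℝ)) (f' := fun _ => 0)
    continuousOn_const (fun x _ => hasDerivWithinAt_const _ _ _) hf hf' (by simpa using hnonneg)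
    (right_mem_Icc.2 hab)

theorem monotoneOn_of_deriv_right_nonneg {f f' : ℝ → ℝ}
    (hf : ContinuousOn f (Ico a b)) (hf' : ∀ x ∈ Ico a b, HasDerivWithinAt f (f' x) (Ici x) x)
    (hnonneg : ∀ x ∈ Ico a b, 0 ≤ f' x) : MonotoneOn f (Ico a b) := fun s hs t ht hst =>
  have hsub : Icc s t ⊆ Ico a b := fun _ hx => ⟨hs.1.trans hx.1, hx.2.trans_lt ht.2⟩
  le_of_deriv_right_nonneg hst (hf.mono hsub) (fun x hx => hf' x (hsub (Ico_subset_Icc_self hx)))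
    fun x hx => hnonneg x (hsub (Ico_subset_Icc_self hx))

theorem strictMonoOn_of_deriv_right_pos {f f' : ℝ → ℝ}
    (hf : ContinuousOn f (Ico a b)) (hf' : ∀ x ∈ Ico a b, HasDerivWithinAt f (f' x) (Ici x) x)
    (hpos : ∀ x ∈ Ico a b, 0 < f' x) : StrictMonoOn f (Ico a b) := by
  have hmono := monotoneOn_of_deriv_right_nonneg hf hf' fun x hx => (hpos x hx).le
  refine fun s hs t ht hst => (hmono hs ht hst.le).lt_of_ne fun heq => (hpos s hs).ne ?_
  have hconst : ∀ x ∈ Icc s t, f x = f s := fun x hx =>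
    have hxI : x ∈ Ico a b := ⟨hs.1.trans hx.1, hx.2.trans_lt ht.2⟩
    ((hmono hxI ht hx.2).trans heq.ge).antisymm (hmono hs hxI hx.1)
  exact (uniqueDiffOn_Icc hst s ⟨le_rfl, hst.le⟩).eq_deriv _
    ((hasDerivWithinAt_const s _ (f s)).congr hconst rfl) ((hf' s hs).mono Icc_subset_Ici_self)

theorem hasDerivWithinAt_of_comp_eq {F l k : ℝ → ℝ} {t F' l' : ℝ}
    (hF : HasDerivWithinAt F F' (Ici (k t)) (k t)) (hF' : F' ≠ 0)
    (hk : Tendsto k (𝓝[≥] t) (𝓝[≥] (k t))) (hcomp : F ∘ k =ᶠ[𝓝[≥] t] l)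
    (hl : HasDerivWithinAt l l' (Ici t) t) : HasDerivWithinAt k (l' / F') (Ici t) t := by
  have hinv : Function.LeftInverse (ContinuousLinearMap.toSpanSingleton ℝ F'⁻¹)
      (ContinuousLinearMap.toSpanSingleton ℝ F') := fun x => by simp [hF']
  simpa [div_eq_mul_inv] using
    (hF.hasFDerivWithinAt.of_comp_of_leftInverse hk hl.hasFDerivWithinAt hcomp hinv
      self_mem_Ici).hasDerivWithinAt

theorem exists_tendsto_of_monotoneOn {f : ℝ → ℝ} {B : ℝ} (hab : a < b)
    (hf : MonotoneOn f (Ico a b)) (hB : ∀ t ∈ Ico a b, f t ≤ B) :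
    ∃ c, Tendsto f (𝓝[<] b) (𝓝 c) ∧ ∀ t ∈ Ico a b, f t ≤ c := by
  have hlim := MonotoneOn.tendsto_nhdsWithin_Ioo_left (nonempty_Ioo.2 hab)
    (hf.mono Ioo_subset_Ico_self) ⟨B, by rintro _ ⟨t, ht, rfl⟩; exact hB t ⟨ht.1.le, ht.2⟩⟩
  refine ⟨_, hlim, fun t ht => ge_of_tendsto hlim ?_⟩
  filter_upwards [Ico_mem_nhdsLT ht.2] with x hx
  exact hf ht ⟨ht.1.trans hx.1, hx.2⟩ hx.1

omit [NormedSpace ℝ E] in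
theorem exists_tendsto_of_norm_sub_le [CompleteSpace E] {f : ℝ → E} {l : ℝ → ℝ} {c : ℝ}
    (hab : a < b) (hl : Tendsto l (𝓝[<] b) (𝓝 c))
    (hfl : ∀ s ∈ Ico a b, ∀ t ∈ Ico a b, s ≤ t → ‖f t - f s‖ ≤ l t - l s) :
    ∃ e, Tendsto f (𝓝[<] b) (𝓝 e) := by
  have hdist : ∀ s ∈ Ico a b, ∀ t ∈ Ico a b, dist (f s) (f t) ≤ dist (l s) (l t) := by
    intro s hs t ht
    wlog hst : s ≤ t generalizing s t
    · simpa only [dist_comm] using this t ht s hs (not_le.1 hst).le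
    · rw [dist_comm, dist_comm (l s), dist_eq_norm]
      exact (hfl s hs t ht hst).trans (le_abs_self _)
  rw [← cauchy_map_iff_exists_tendsto, cauchy_map_iff', tendsto_uniformity_iff_dist_tendsto_zero]
  have hI := Ico_mem_nhdsLT hab
  refine squeeze_zero' (.of_forall fun _ => dist_nonneg) ?_
    (tendsto_uniformity_iff_dist_tendsto_zero.1 (cauchy_map_iff'.1 hl.cauchy_map))
  filter_upwards [prod_mem_prod hI hI] with p hp using hdist _ hp.1 _ hp.2

end RightDerivative

section Lag

theorem exists_continuousOn_rightInvOn {F : ℝ → ℝ} {a T : ℝ} (haT : a ≤ T)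
    (hF : ContinuousOn F (Icc a T)) (hmono : StrictMonoOn F (Icc a T)) :
    ∃ G, MapsTo G (Icc (F a) (F T)) (Icc a T) ∧ RightInvOn G F (Icc (F a) (F T)) ∧
      MonotoneOn G (Icc (F a) (F T)) ∧ ContinuousOn G (Icc (F a) (F T)) := by
  have hsurj : SurjOn F (Icc a T) (Icc (F a) (F T)) := intermediate_value_Icc haT hF
  set G := Function.invFunOn F (Icc a T)
  have hmaps : MapsTo G (Icc (F a) (F T)) (Icc a T) := hsurj.mapsTo_invFunOn
  have hinv : RightInvOn G F (Icc (F a) (F T)) := hsurj.rightInvOn_invFunOn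
  have hG : MonotoneOn G (Icc (F a) (F T)) := fun x hx y hy hxy =>
    (hmono.le_iff_le (hmaps hx) (hmaps hy)).1 (by rwa [hinv hx, hinv hy])
  refine ⟨G, hmaps, hinv, hG, continuousOn_iff_continuous_domRestrict.2 ?_⟩
  have hGsurj : Function.Surjective hmaps.restrict := fun x => by
    have hFx : F x ∈ Icc (F a) (F T) :=
      ⟨hmono.monotoneOn (left_mem_Icc.2 haT) x.2 x.2.1,
        hmono.monotoneOn x.2 (right_mem_Icc.2 haT) x.2.2⟩
    exact ⟨⟨F x, hFx⟩, Subtype.ext (hmono.injOn (hmaps hFx) x.2 (hinv hFx))⟩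
  exact continuous_subtype_val.comp
    (Monotone.continuous_of_surjective (f := hmaps.restrict)
      (fun x y hxy => hG x.2 y.2 hxy) hGsurj)

/-- The time change `k` by which a clock `F` with rate `F'` at time `k t` has advanced as much since
`a` as a slower clock `l` with rate `l'` has at time `t`. It converges to some `κ < b`. -/
structure IsLag (F' l' k : ℝ → ℝ) (κ a b : ℝ) : Prop where
  start : k a = a
  limit_mem : κ ∈ Ico a b
  mem_Icc : ∀ t ∈ Ico a b, k t ∈ Icc a t
  le_limit : ∀ t ∈ Ico a b, k t ≤ κ
  monotone : MonotoneOn k (Ico a b)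
  continuous : ContinuousOn k (Ico a b)
  tendsto : Tendsto k (𝓝[<] b) (𝓝 κ)
  deriv : ∀ t ∈ Ico a b, HasDerivWithinAt k (l' t / F' (k t)) (Ici t) t

variable {F F' l l' : ℝ → ℝ} {a b : ℝ}

theorem exists_tendsto_lt_increment {B : ℝ} (hab : a < b) (hF : MonotoneOn F (Ico a b))
    (hl : MonotoneOn l (Ico a b)) (hFl : StrictMonoOn (fun t => F t - l t) (Ico a b))
    (hB : ∀ t ∈ Ico a b, F t ≤ B) :
    ∃ c, Tendsto l (𝓝[<] b) (𝓝 c) ∧ (∀ t ∈ Ico a b, l t ≤ c) ∧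
      ∃ T ∈ Ico a b, c - l a < F T - F a := by
  have ha : a ∈ Ico a b := ⟨le_rfl, hab⟩
  obtain ⟨cF, hcF, -⟩ := exists_tendsto_of_monotoneOn hab hF hB
  obtain ⟨c, hc, hlc⟩ := exists_tendsto_of_monotoneOn (B := B - (F a - l a)) hab hl fun t ht => by
    have : F a - l a ≤ F t - l t := hFl.monotoneOn ha ht ht.1
    linarith [hB t ht]
  obtain ⟨s, has, hsb⟩ := exists_between hab
  have hs : s ∈ Ico a b := ⟨has.le, hsb⟩
  have hgap : F a - l a < cF - c := by
    refine (hFl ha hs has).trans_le (ge_of_tendsto (hcF.sub hc) ?_)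
    filter_upwards [Ico_mem_nhdsLT hsb] with t ht
    exact hFl.monotoneOn hs ⟨hs.1.trans ht.1, ht.2⟩ ht.1
  obtain ⟨T, hT, hTI⟩ := ((hcF.eventually (lt_mem_nhds
    (show F a + (c - l a) < cF by linarith))).and (Ico_mem_nhdsLT hab)).exists
  exact ⟨c, hc, hlc, T, hTI, by linarith⟩

theorem exists_isLag {B : ℝ} (hab : a < b) (hF : ContinuousOn F (Ico a b))
    (hl : ContinuousOn l (Ico a b)) (hF' : ∀ t ∈ Ico a b, HasDerivWithinAt F (F' t) (Ici t) t)
    (hl' : ∀ t ∈ Ico a b, HasDerivWithinAt l (l' t) (Ici t) t) (hnonneg : ∀ t ∈ Ico a b, 0 ≤ l' t)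
    (hlt : ∀ t ∈ Ico a b, l' t < F' t) (hB : ∀ t ∈ Ico a b, F t ≤ B) :
    ∃ k κ, IsLag F' l' k κ a b := by
  have ha : a ∈ Ico a b := ⟨le_rfl, hab⟩
  have hF'pos : ∀ t ∈ Ico a b, 0 < F' t := fun t ht => (hnonneg t ht).trans_lt (hlt t ht)
  have hFm := strictMonoOn_of_deriv_right_pos hF hF' hF'pos
  have hlm := monotoneOn_of_deriv_right_nonneg hl hl' hnonneg
  have hFlm := strictMonoOn_of_deriv_right_pos (hF.sub hl)
    (fun t ht => (hF' t ht).sub (hl' t ht)) fun t ht => sub_pos.2 (hlt t ht)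
  obtain ⟨c, hc, hlc, T, hT, hcT⟩ := exists_tendsto_lt_increment hab hFm.monotoneOn hlm hFlm hB
  have hsub : Icc a T ⊆ Ico a b := fun x hx => ⟨hx.1, hx.2.trans_lt hT.2⟩
  obtain ⟨G, hmaps, hinv, hGm, hGc⟩ :=
    exists_continuousOn_rightInvOn hT.1 (hF.mono hsub) (hFm.mono hsub)
  set m : ℝ → ℝ := fun t => F a + (l t - l a)
  have hm : MapsTo m (Ico a b) (Icc (F a) (F T)) := fun t ht =>
    ⟨by simpa [m] using hlm ha ht ht.1, by linarith [hlc t ht]⟩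
  have hcI : F a + (c - l a) ∈ Icc (F a) (F T) := ⟨by linarith [hlc a ha], by linarith⟩
  have hk : ∀ t ∈ Ico a b, G (m t) ∈ Ico a b := fun t ht => hsub (hmaps (hm ht))
  have hkm : MonotoneOn (G ∘ m) (Ico a b) := hGm.comp (fun s hs t ht hst => by
    simpa [m] using hlm hs ht hst) hm
  have hkc : ContinuousOn (G ∘ m) (Ico a b) := hGc.comp (by fun_prop) hm
  refine ⟨G ∘ m, G (F a + (c - l a)), ?_, hsub (hmaps hcI), fun t ht => ⟨(hk t ht).1, ?_⟩,
    fun t ht => hGm (hm ht) hcI (by simpa [m] using hlc t ht), hkm, hkc, ?_, fun t ht => ?_⟩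
  · exact hFm.injOn (hk a ha) ha ((hinv (hm ha)).trans (by simp [m]))
  · refine (hFm.le_iff_le (hk t ht) ht).1 ((hinv (hm ht)).trans_le ?_)
    have : F a - l a ≤ F t - l t := hFlm.monotoneOn ha ht ht.1
    linarith
  · refine (hGc _ hcI).tendsto.comp (tendsto_nhdsWithin_iff.2
      ⟨(hc.sub_const (l a)).const_add (F a), ?_⟩)
    filter_upwards [Ico_mem_nhdsLT hab] with t ht using hm ht
  · have hI : ∀ᶠ x in 𝓝[≥] t, x ∈ Ico a b := by
      filter_upwards [Ico_mem_nhdsGE ht.2] with x hx using ⟨ht.1.trans hx.1, hx.2⟩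
    refine hasDerivWithinAt_of_comp_eq (hF' _ (hk t ht)) (hF'pos _ (hk t ht)).ne'
      (tendsto_nhdsWithin_iff.2 ⟨(hkc t ht).mono_left (nhdsWithin_le_of_mem hI), ?_⟩)
      (hI.mono fun x hx => hinv (hm hx)) (((hl' t ht).sub_const _).const_add _)
    filter_upwards [hI, self_mem_nhdsWithin] with x hx htx using hkm ht hx htx

end Lag

/-- The speed on the unit sphere at which a curve over the curve `(u, v)` with velocity `(u', v')`
becomes null. -/
def nullSpeed (Q R : ℝ → ℝ → ℝ) (u v u' v' : ℝ → ℝ) (t : ℝ) : ℝ :=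
  √(Q (u t) (v t) / R (u t) (v t) * (u' t * v' t))

/-- A future directed timelike curve `(u, v, θ)` in the double null spacetime, with right
derivatives `u'`, `v'`, `θ'`, together with the length `l` of its projection to the sphere and the
maximal length `F` which is compatible with its projection to the `(u, v)` plane. -/
structure IsConeCurve {V : Type*} [NormedAddCommGroup V] [NormedSpace ℝ V] (Q R : ℝ → ℝ → ℝ)
    (u v u' v' F l : ℝ → ℝ) (θ θ' : ℝ → V) (a b : ℝ) : Prop where
  lt : a < b
  u_neg : ∀ t ∈ Ico a b, u t < 0
  v_neg : ∀ t ∈ Ico a b, v t < 0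
  norm_eq : ∀ t ∈ Ico a b, ‖θ t‖ = 1
  u_cont : ContinuousOn u (Ico a b)
  v_cont : ContinuousOn v (Ico a b)
  θ_cont : ContinuousOn θ (Ico a b)
  F_cont : ContinuousOn F (Ico a b)
  l_cont : ContinuousOn l (Ico a b)
  u_deriv : ∀ t ∈ Ico a b, HasDerivWithinAt u (u' t) (Ici t) t
  v_deriv : ∀ t ∈ Ico a b, HasDerivWithinAt v (v' t) (Ici t) t
  θ_deriv : ∀ t ∈ Ico a b, HasDerivWithinAt θ (θ' t) (Ici t) t
  F_deriv : ∀ t ∈ Ico a b, HasDerivWithinAt F (nullSpeed Q R u v u' v' t) (Ici t) t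
  l_deriv : ∀ t ∈ Ico a b, HasDerivWithinAt l ‖θ' t‖ (Ici t) t
  u'_pos : ∀ t ∈ Ico a b, 0 < u' t
  v'_pos : ∀ t ∈ Ico a b, 0 < v' t
  timelike : ∀ t ∈ Ico a b, R (u t) (v t) * ‖θ' t‖ ^ 2 < Q (u t) (v t) * (u' t * v' t)

namespace IsConeCurve

variable {V : Type*} [NormedAddCommGroup V] [NormedSpace ℝ V] {Q R : ℝ → ℝ → ℝ}
  {u v u' v' F l : ℝ → ℝ} {θ θ' : ℝ → V} {a b : ℝ} (h : IsConeCurve Q R u v u' v' F l θ θ' a b)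

include h

theorem mono_left {s : ℝ} (hs : s ∈ Ico a b) : IsConeCurve Q R u v u' v' F l θ θ' s b := by
  have hsub : Ico s b ⊆ Ico a b := Ico_subset_Ico_left hs.1
  exact ⟨hs.2, fun t ht => h.u_neg t (hsub ht), fun t ht => h.v_neg t (hsub ht),
    fun t ht => h.norm_eq t (hsub ht), h.u_cont.mono hsub, h.v_cont.mono hsub,
    h.θ_cont.mono hsub, h.F_cont.mono hsub, h.l_cont.mono hsub,
    fun t ht => h.u_deriv t (hsub ht), fun t ht => h.v_deriv t (hsub ht),
    fun t ht => h.θ_deriv t (hsub ht), fun t ht => h.F_deriv t (hsub ht),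
    fun t ht => h.l_deriv t (hsub ht), fun t ht => h.u'_pos t (hsub ht),
    fun t ht => h.v'_pos t (hsub ht), fun t ht => h.timelike t (hsub ht)⟩

theorem u_strictMono : StrictMonoOn u (Ico a b) :=
  strictMonoOn_of_deriv_right_pos h.u_cont h.u_deriv h.u'_pos

theorem v_strictMono : StrictMonoOn v (Ico a b) :=
  strictMonoOn_of_deriv_right_pos h.v_cont h.v_deriv h.v'_pos

theorem mul_nullSpeed_sq (hQ : IsBoundedCoefficient Q) (hR : IsBoundedCoefficient R) {t : ℝ}
    (ht : t ∈ Ico a b) :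
    R (u t) (v t) * nullSpeed Q R u v u' v' t ^ 2 = Q (u t) (v t) * (u' t * v' t) := by
  have hQt := hQ.pos (h.u_neg t ht) (h.v_neg t ht)
  have hRt := hR.pos (h.u_neg t ht) (h.v_neg t ht)
  have hu' := h.u'_pos t ht
  have hv' := h.v'_pos t ht
  rw [nullSpeed, Real.sq_sqrt (by positivity)]
  field_simp

theorem norm_θ'_lt_nullSpeed (hR : IsBoundedCoefficient R) {t : ℝ} (ht : t ∈ Ico a b) :
    ‖θ' t‖ < nullSpeed Q R u v u' v' t := by
  refine Real.lt_sqrt_of_sq_lt ?_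
  rw [div_mul_eq_mul_div, lt_div_iff₀ (hR.pos (h.u_neg t ht) (h.v_neg t ht)), mul_comm]
  exact h.timelike t ht

theorem norm_θ_sub_le (hR : IsBoundedCoefficient R) {s t : ℝ} (hs : s ∈ Ico a b)
    (ht : t ∈ Ico a b) (hst : s ≤ t) : ‖θ t - θ s‖ ≤ F t - F s := by
  have hsub : Icc s t ⊆ Ico a b := fun x hx => ⟨hs.1.trans hx.1, hx.2.trans_lt ht.2⟩
  have hsub' : Ico s t ⊆ Ico a b := Ico_subset_Icc_self.trans hsub
  exact norm_sub_le_of_norm_deriv_right_le (h.θ_cont.mono hsub)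
    (fun x hx => h.θ_deriv x (hsub' hx)) (h.F_cont.mono hsub)
    (fun x hx => h.F_deriv x (hsub' hx)) (fun x hx => (h.norm_θ'_lt_nullSpeed hR (hsub' hx)).le)
    ⟨hst, le_rfl⟩

theorem exists_nullSpeed_le (hQ : IsBoundedCoefficient Q) (hR : IsBoundedCoefficient R) :
    ∃ c ≥ 0, ∀ t ∈ Ico a b, nullSpeed Q R u v u' v' t ≤ c * (u' t + v' t) := by
  have ha : a ∈ Ico a b := ⟨le_rfl, h.lt⟩
  have hneg : min (u a) (v a) < 0 := min_lt_of_left_lt (h.u_neg a ha)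
  obtain ⟨mR, hmR, MR, hRb⟩ := hR.bounds _ hneg
  obtain ⟨mQ, hmQ, MQ, hQb⟩ := hQ.bounds _ hneg
  refine ⟨√(MQ / mR), Real.sqrt_nonneg _, fun t ht => ?_⟩
  have hut : u t ∈ Ico (min (u a) (v a)) 0 :=
    ⟨(min_le_left _ _).trans (h.u_strictMono.monotoneOn ha ht ht.1), h.u_neg t ht⟩
  have hvt : v t ∈ Ico (min (u a) (v a)) 0 :=
    ⟨(min_le_right _ _).trans (h.v_strictMono.monotoneOn ha ht ht.1), h.v_neg t ht⟩
  obtain ⟨hmQt, hMQt⟩ := hQb _ hut _ hvt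
  obtain ⟨hmRt, -⟩ := hRb _ hut _ hvt
  have hMQ : 0 ≤ MQ := hmQ.le.trans (hmQt.trans hMQt)
  have hu' := h.u'_pos t ht
  have hv' := h.v'_pos t ht
  have hratio : Q (u t) (v t) / R (u t) (v t) ≤ MQ / mR := div_le_div₀ hMQ hMQt hmR hmRt
  calc nullSpeed Q R u v u' v' t
      ≤ √(MQ / mR * (u' t + v' t) ^ 2) := Real.sqrt_le_sqrt (by gcongr; nlinarith)
    _ = √(MQ / mR) * (u' t + v' t) := by
      rw [Real.sqrt_mul (by positivity), Real.sqrt_sq (by positivity)]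

theorem exists_F_le (hQ : IsBoundedCoefficient Q) (hR : IsBoundedCoefficient R) :
    ∃ B, ∀ t ∈ Ico a b, F t ≤ B := by
  obtain ⟨c, hc, hspeed⟩ := h.exists_nullSpeed_le hQ hR
  refine ⟨F a + c * (-(u a) - v a), fun t ht => ?_⟩
  have hsub : Icc a t ⊆ Ico a b := fun x hx => ⟨hx.1, hx.2.trans_lt ht.2⟩
  have hsub' : Ico a t ⊆ Ico a b := Ico_subset_Icc_self.trans hsub
  have hFt := (le_abs_self _).trans <| norm_sub_le_of_norm_deriv_right_le (h.F_cont.mono hsub)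
    (fun x hx => h.F_deriv x (hsub' hx))
    (B := fun x => c * (u x + v x)) (B' := fun x => c * (u' x + v' x))
    (continuousOn_const.mul ((h.u_cont.mono hsub).add (h.v_cont.mono hsub)))
    (fun x hx => ((h.u_deriv x (hsub' hx)).add (h.v_deriv x (hsub' hx))).const_mul c)
    (fun x hx => (Real.norm_of_nonneg (Real.sqrt_nonneg _)).trans_le (hspeed x (hsub' hx)))
    (right_mem_Icc.2 ht.1)
  have huv : c * (u t + v t) ≤ 0 :=
    mul_nonpos_of_nonneg_of_nonpos hc (by linarith [h.u_neg t ht, h.v_neg t ht])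
  linarith

theorem exists_tendsto_θ [CompleteSpace V] (hQ : IsBoundedCoefficient Q)
    (hR : IsBoundedCoefficient R) : ∃ e, ‖e‖ = 1 ∧ Tendsto θ (𝓝[<] b) (𝓝 e) := by
  obtain ⟨B, hB⟩ := h.exists_F_le hQ hR
  have hF := monotoneOn_of_deriv_right_nonneg h.F_cont h.F_deriv fun _ _ => Real.sqrt_nonneg _
  obtain ⟨c, hc, -⟩ := exists_tendsto_of_monotoneOn h.lt hF hB
  obtain ⟨e, he⟩ := exists_tendsto_of_norm_sub_le h.lt hc
    fun s hs t ht => h.norm_θ_sub_le hR hs ht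
  refine ⟨e, tendsto_nhds_unique he.norm (tendsto_const_nhds.congr' ?_), he⟩
  filter_upwards [Ico_mem_nhdsLT h.lt] with t ht using (h.norm_eq t ht).symm

theorem exists_isLag (hQ : IsBoundedCoefficient Q) (hR : IsBoundedCoefficient R) :
    ∃ k κ, IsLag (nullSpeed Q R u v u' v') (fun t => ‖θ' t‖) k κ a b := by
  obtain ⟨B, hB⟩ := h.exists_F_le hQ hR
  exact _root_.exists_isLag h.lt h.F_cont h.l_cont h.F_deriv h.l_deriv (fun _ _ => norm_nonneg _)
    (fun _ => h.norm_θ'_lt_nullSpeed hR) hB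

end IsConeCurve

section CausalOrder

variable {E : Type*} [NormedAddCommGroup E] [NormedSpace ℝ E] {τ : E →L[ℝ] ℝ} {C : ℝ} {p q x : E}

/-- The point `q` lies in the future cone of `p` in which the causal vectors of a boundary chart
lie. -/
def CausalLE (τ : E →L[ℝ] ℝ) (C : ℝ) (p q : E) : Prop := ‖q - p‖ ≤ C * (τ q - τ p)

theorem CausalLE.trans (hpx : CausalLE τ C p x) (hxq : CausalLE τ C x q) : CausalLE τ C p q :=
  calc ‖q - p‖ ≤ ‖q - x‖ + ‖x - p‖ := norm_sub_le_norm_sub_add_norm_sub q x p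
    _ ≤ C * (τ q - τ x) + C * (τ x - τ p) := add_le_add hxq hpx
    _ = C * (τ q - τ p) := by ring

theorem CausalLE.apply_le (hC : 0 < C) (hpq : CausalLE τ C p q) : τ p ≤ τ q :=
  sub_nonneg.1 (nonneg_of_mul_nonneg_right ((norm_nonneg _).trans hpq) hC)

theorem CausalLE.mem_closedBall {y : E} {ε : ℝ} (hC : 0 < C) (hp : p ∈ Metric.closedBall y ε)
    (hq : q ∈ Metric.closedBall y ε) (hpx : CausalLE τ C p x) (hxq : CausalLE τ C x q) :
    x ∈ Metric.closedBall y (ε + C * (‖τ‖ * (2 * ε))) := by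
  have hτ : τ x - τ p ≤ ‖τ‖ * (2 * ε) :=
    (sub_le_sub_right (hxq.apply_le hC) _).trans (apply_sub_apply_le_of_mem_closedBall τ hq hp)
  rw [mem_closedBall_iff_norm] at hp ⊢
  calc ‖x - y‖ ≤ ‖x - p‖ + ‖p - y‖ := norm_sub_le_norm_sub_add_norm_sub x p y
    _ ≤ C * (τ x - τ p) + ε := add_le_add hpx hp
    _ ≤ ε + C * (‖τ‖ * (2 * ε)) := by
      rw [add_comm]
      gcongr

theorem causalLE_of_deriv_right {f f' : ℝ → E} {a b : ℝ} (hab : a ≤ b)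
    (hf : ContinuousOn f (Icc a b)) (hf' : ∀ t ∈ Ico a b, HasDerivWithinAt f (f' t) (Ici t) t)
    (bound : ∀ t ∈ Ico a b, ‖f' t‖ ≤ C * τ (f' t)) : CausalLE τ C (f a) (f b) := by
  rw [CausalLE, mul_sub]
  exact norm_sub_le_of_norm_deriv_right_le hf hf'
    (B := fun t => C * τ (f t)) (continuousOn_const.mul (τ.continuous.comp_continuousOn hf))
    (fun t ht => (τ.hasFDerivAt.comp_hasDerivWithinAt t (hf' t ht)).const_mul C) bound
    (right_mem_Icc.2 hab)

end CausalOrder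

namespace BoundaryChart

variable {V E : Type*} [NormedAddCommGroup V] [InnerProductSpace ℝ V]
  [NormedAddCommGroup E] [NormedSpace ℝ E] {Q R : ℝ → ℝ → ℝ} {Y : ConeSpace V → E}
  {O : Set (ConeSpace V)} {G : E → E →L[ℝ] E →L[ℝ] ℝ} {τ : E →L[ℝ] ℝ} {y₀ : E} {ρ Λ C : ℝ}
  {σ σ' a b t : ℝ}

variable (h : BoundaryChart Q R Y O G τ y₀ ρ Λ C)

include h

theorem causalLE_of_curve (hQ : IsBoundedCoefficient Q) (hσ : σ ≤ ρ) {c c' : ℝ → ConeSpace V}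
    (hab : a ≤ b) (hc : ContinuousOn c (Icc a b))
    (hc' : ∀ t ∈ Ico a b, HasDerivWithinAt c (c' t) (Ici t) t)
    (hmem : ∀ t ∈ Icc a b, c t ∈ chartRegion Y O τ y₀ σ)
    (hcausal : ∀ t ∈ Ico a b, 0 ≤ (c' t).1 ∧ 0 ≤ (c' t).2.1 ∧
      coneMetric Q R (c t) (c' t) (c' t) ≤ 0) : CausalLE τ C (Y (c a)) (Y (c b)) := by
  refine causalLE_of_deriv_right (f := fun t => Y (c t)) (f' := fun t => fderiv ℝ Y (c t) (c' t))
    hab (h.smooth.continuousOn.comp hc fun t ht => (hmem t ht).1) (fun t ht => ?_) fun t ht => ?_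
  · exact (h.hasFDerivAt (hmem t ⟨ht.1, ht.2.le⟩).1).comp_hasDerivWithinAt t (hc' t ht)
  · obtain ⟨hu, hv, hnonpos⟩ := hcausal t ht
    exact h.norm_fderiv_le hQ hσ (hmem t ⟨ht.1, ht.2.le⟩) hu hv hnonpos

theorem isClosed_setOf_forall_mem_chartRegion (hQ : IsBoundedCoefficient Q) (hσ : σ ≤ ρ)
    {S : Type*} {L : ℝ → S → ConeSpace V} {K : Set S}
    (hL : ∀ s ∈ K, ContinuousOn (fun t => L t s) (Icc a b))
    (hdom : ∀ t ∈ Icc a b, ∀ s ∈ K, L t s ∈ coneDomain V) :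
    IsClosed ({t | ∀ s ∈ K, L t s ∈ chartRegion Y O τ y₀ σ} ∩ Icc a b) := by
  refine isClosed_of_closure_subset fun t ht => ?_
  have htI : t ∈ Icc a b := closure_minimal inter_subset_right isClosed_Icc ht
  refine ⟨fun s hs => h.mem_chartRegion_of_mem_closure hQ hσ (hdom t htI s hs) ?_, htI⟩
  refine closure_mono ?_ (((hL s hs t htI).mono inter_subset_right).mem_closure_image ht)
  rintro _ ⟨r, hr, rfl⟩
  exact hr.1 s hs

theorem eventually_forall_mem_chartRegion (hσ : σ < σ') {S : Type*} [TopologicalSpace S]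
    {L : ℝ → S → ConeSpace V} {K : Set S} (hK : IsCompact K) {l : Filter ℝ}
    (hL : ∀ s ∈ K, Tendsto (fun p : ℝ × S => L p.1 p.2) (l ×ˢ 𝓝 s) (𝓝 (L t s)))
    (ht : ∀ s ∈ K, L t s ∈ chartRegion Y O τ y₀ σ) :
    ∀ᶠ r in l, ∀ s ∈ K, L r s ∈ chartRegion Y O τ y₀ σ' := by
  have hnear : {p : ℝ × S | L p.1 p.2 ∈ chartRegion Y O τ y₀ σ'} ∈ l ×ˢ 𝓝ˢ K :=
    hK.mem_prod_nhdsSet_of_forall fun s hs =>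
      (hL s hs).eventually (h.eventually_mem_chartRegion hσ (ht s hs))
  obtain ⟨A, hA, B, hB, hAB⟩ := mem_prod_iff.1 hnear
  filter_upwards [hA] with r hr s hs using hAB (mk_mem_prod hr (subset_of_mem_nhdsSet hB hs))

end BoundaryChart

/-- For `s ∈ [0, 1]²`, the points of the rectangle spanned by `(u, v)` at the delayed time `k t` and
at time `t`, all taken at the spherical coordinate `θ t`. For `s = 0` this is the delayed curve and
for `s = (1, 1)` the original one. -/
def lagRect {V : Type*} (u v : ℝ → ℝ) (θ : ℝ → V) (k : ℝ → ℝ) (t : ℝ) (s : ℝ × ℝ) : ConeSpace V :=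
  (u (k t) + s.1 * (u t - u (k t)), v (k t) + s.2 * (v t - v (k t)), θ t)

theorem lagRect_zero {V : Type*} (u v : ℝ → ℝ) (θ : ℝ → V) (k : ℝ → ℝ) (t : ℝ) :
    lagRect u v θ k t 0 = (u (k t), v (k t), θ t) := by simp [lagRect]

theorem lagRect_one {V : Type*} (u v : ℝ → ℝ) (θ : ℝ → V) (k : ℝ → ℝ) (t : ℝ) :
    lagRect u v θ k t 1 = (u t, v t, θ t) := by simp [lagRect]

theorem IsLag.mem_Ico {F' l' k : ℝ → ℝ} {κ a b t : ℝ} (hk : IsLag F' l' k κ a b)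
    (ht : t ∈ Ico a b) : k t ∈ Ico a b :=
  ⟨(hk.mem_Icc t ht).1, (hk.mem_Icc t ht).2.trans_lt ht.2⟩

theorem IsLag.hasDerivWithinAt_comp {F' l' k f f' : ℝ → ℝ} {κ a b t : ℝ}
    (hk : IsLag F' l' k κ a b) (hf : ∀ t ∈ Ico a b, HasDerivWithinAt f (f' t) (Ici t) t)
    (ht : t ∈ Ico a b) :
    HasDerivWithinAt (fun t => f (k t)) (f' (k t) * (l' t / F' (k t))) (Ici t) t :=
  ((hf _ (hk.mem_Ico ht)).comp t ((hk.deriv t ht).mono inter_subset_left)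
    fun _ hx => hk.monotone ht ⟨ht.1.trans hx.1, hx.2⟩ hx.1).mono_of_mem_nhdsWithin
    (inter_mem self_mem_nhdsWithin (mem_nhdsWithin_of_mem_nhds (Iio_mem_nhds ht.2)))

namespace IsConeCurve

variable {V : Type*} [NormedAddCommGroup V] [NormedSpace ℝ V] {Q R : ℝ → ℝ → ℝ}
  {u v u' v' F l : ℝ → ℝ} {θ θ' : ℝ → V} {a b t : ℝ} {k F' l' : ℝ → ℝ} {κ : ℝ}
  (h : IsConeCurve Q R u v u' v' F l θ θ' a b) (hk : IsLag F' l' k κ a b)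

include h hk

theorem u_lag_le (ht : t ∈ Ico a b) : u (k t) ≤ u t :=
  h.u_strictMono.monotoneOn (hk.mem_Ico ht) ht (hk.mem_Icc t ht).2

theorem v_lag_le (ht : t ∈ Ico a b) : v (k t) ≤ v t :=
  h.v_strictMono.monotoneOn (hk.mem_Ico ht) ht (hk.mem_Icc t ht).2

theorem lagRect_mem_coneDomain (ht : t ∈ Ico a b) {s : ℝ × ℝ} (hs : s ∈ Icc 0 1) :
    lagRect u v θ k t s ∈ coneDomain V := by
  have hs₁ : s.1 ≤ 1 := hs.2.1
  have hs₂ : s.2 ≤ 1 := hs.2.2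
  have hu : u (k t) + s.1 * (u t - u (k t)) ≤ u t := by
    nlinarith [mul_nonneg (sub_nonneg.2 hs₁) (sub_nonneg.2 (h.u_lag_le hk ht))]
  have hv : v (k t) + s.2 * (v t - v (k t)) ≤ v t := by
    nlinarith [mul_nonneg (sub_nonneg.2 hs₂) (sub_nonneg.2 (h.v_lag_le hk ht))]
  exact ⟨hu.trans_lt (h.u_neg t ht), hv.trans_lt (h.v_neg t ht),
    ne_zero_of_norm_ne_zero ((h.norm_eq t ht).trans_ne one_ne_zero)⟩

theorem continuousOn_lagRect :
    ContinuousOn (fun p : ℝ × ℝ × ℝ => lagRect u v θ k p.1 p.2) (Ico a b ×ˢ univ) := by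
  have hfst : ContinuousOn (Prod.fst : ℝ × ℝ × ℝ → ℝ) (Ico a b ×ˢ univ) := continuousOn_fst
  have hmaps : MapsTo (Prod.fst : ℝ × ℝ × ℝ → ℝ) (Ico a b ×ˢ univ) (Ico a b) := fun _ hp => hp.1
  have hkmaps : MapsTo k (Ico a b) (Ico a b) := fun _ => hk.mem_Ico
  have hu := h.u_cont.comp hfst hmaps
  have hv := h.v_cont.comp hfst hmaps
  have huk := (h.u_cont.comp hk.continuous hkmaps).comp hfst hmaps
  have hvk := (h.v_cont.comp hk.continuous hkmaps).comp hfst hmaps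
  exact (huk.add (continuousOn_snd.fst.mul (hu.sub huk))).prodMk
    ((hvk.add (continuousOn_snd.snd.mul (hv.sub hvk))).prodMk (h.θ_cont.comp hfst hmaps))

end IsConeCurve

/-- The delay makes the delayed curve null up to the radial component of `θ'`. -/
theorem IsConeCurve.coneMetric_delayed_nonpos {V : Type*} [NormedAddCommGroup V]
    [InnerProductSpace ℝ V] {Q R : ℝ → ℝ → ℝ} {u v u' v' F l : ℝ → ℝ} {θ θ' : ℝ → V} {a b s t : ℝ}
    (h : IsConeCurve Q R u v u' v' F l θ θ' a b) (hQ : IsBoundedCoefficient Q)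
    (hR : IsBoundedCoefficient R) (hs : s ∈ Ico a b) (ht : t ∈ Ico a b) :
    coneMetric Q R (u s, v s, θ t)
      (u' s * (‖θ' t‖ / nullSpeed Q R u v u' v' s), v' s * (‖θ' t‖ / nullSpeed Q R u v u' v' s),
        θ' t)
      (u' s * (‖θ' t‖ / nullSpeed Q R u v u' v' s), v' s * (‖θ' t‖ / nullSpeed Q R u v u' v' s),
        θ' t) ≤ 0 := by
  have hspeed := h.mul_nullSpeed_sq hQ hR hs
  have hpos : 0 < nullSpeed Q R u v u' v' s :=
    (norm_nonneg _).trans_lt (h.norm_θ'_lt_nullSpeed hR hs)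
  set n := nullSpeed Q R u v u' v' s
  rw [coneMetric_of_norm_eq_one (h.norm_eq t ht)]
  calc _ = -(R (u s) (v s) * inner ℝ (θ t) (θ' t) ^ 2)
        + (R (u s) (v s) * n ^ 2 - Q (u s) (v s) * (u' s * v' s)) * (‖θ' t‖ / n) ^ 2 := by
        simp only [real_inner_self_eq_norm_sq]
        field_simp
        ring
    _ ≤ 0 := by
      rw [hspeed, sub_self, zero_mul, add_zero, neg_nonpos]
      exact mul_nonneg (hR.pos (h.u_neg s hs) (h.v_neg s hs)).le (sq_nonneg _)

namespace BoundaryChart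

section Lag

variable {V E : Type*} [NormedAddCommGroup V] [InnerProductSpace ℝ V]
  [NormedAddCommGroup E] [NormedSpace ℝ E] {Q R : ℝ → ℝ → ℝ} {Y : ConeSpace V → E}
  {O : Set (ConeSpace V)} {G : E → E →L[ℝ] E →L[ℝ] ℝ} {τ : E →L[ℝ] ℝ} {y₀ : E} {ρ Λ C : ℝ}
  {u v u' v' F l : ℝ → ℝ} {θ θ' : ℝ → V} {a b t : ℝ} {k : ℝ → ℝ} {κ σ σ' ε : ℝ}

variable (h : BoundaryChart Q R Y O G τ y₀ ρ Λ C) (hQ : IsBoundedCoefficient Q)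
  (hR : IsBoundedCoefficient R) (hc : IsConeCurve Q R u v u' v' F l θ θ' a b)
  (hk : IsLag (nullSpeed Q R u v u' v') (fun t => ‖θ' t‖) k κ a b)

include h hQ hc hk

theorem causalLE_lagRect (hσ : σ ≤ ρ) (ht : t ∈ Ico a b)
    (hmem : ∀ s ∈ Icc 0 1, lagRect u v θ k t s ∈ chartRegion Y O τ y₀ σ) {s s' : ℝ × ℝ}
    (hs : 0 ≤ s) (hss' : s ≤ s') (hs' : s' ≤ 1) :
    CausalLE τ C (Y (lagRect u v θ k t s)) (Y (lagRect u v θ k t s')) := by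
  have hu : 0 ≤ (s' - s).1 * (u t - u (k t)) :=
    mul_nonneg (sub_nonneg.2 hss'.1) (sub_nonneg.2 (hc.u_lag_le hk ht))
  have hv : 0 ≤ (s' - s).2 * (v t - v (k t)) :=
    mul_nonneg (sub_nonneg.2 hss'.2) (sub_nonneg.2 (hc.v_lag_le hk ht))
  have hderiv (r : ℝ) : HasDerivAt (fun r : ℝ => lagRect u v θ k t (s + r • (s' - s)))
      ((s' - s).1 * (u t - u (k t)), (s' - s).2 * (v t - v (k t)), 0) r := by
    have haffine (p q : ℝ) : HasDerivAt (fun r => p + r * q) q r := by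
      simpa using ((hasDerivAt_id r).mul_const q).const_add p
    exact (((haffine _ _).mul_const _).const_add _).prodMk
      ((((haffine _ _).mul_const _).const_add _).prodMk (hasDerivAt_const r (θ t)))
  have hmem_line : ∀ r ∈ Icc (0 : ℝ) 1,
      lagRect u v θ k t (s + r • (s' - s)) ∈ chartRegion Y O τ y₀ σ := fun r hr => by
    refine hmem _ ⟨add_nonneg hs (smul_nonneg hr.1 (sub_nonneg.2 hss')), ?_⟩
    calc s + r • (s' - s) ≤ s + (1 : ℝ) • (s' - s) := by
          gcongr
          exact hr.2
      _ ≤ 1 := by simpa using hs'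
  have hcausal := h.causalLE_of_curve hQ hσ zero_le_one
    (c := fun r => lagRect u v θ k t (s + r • (s' - s)))
    (fun r _ => (hderiv r).continuousAt.continuousWithinAt)
    (fun r _ => (hderiv r).hasDerivWithinAt) hmem_line fun r hr => ⟨hu, hv, ?_⟩
  · simpa using hcausal
  · obtain ⟨hu_neg, hv_neg, -⟩ := h.subset (hmem_line r ⟨hr.1, hr.2.le⟩).1
    rw [coneMetric_null_plane, neg_nonpos, mul_assoc]
    exact mul_nonneg (hQ.pos hu_neg hv_neg).le (mul_nonneg hu hv)

include hR

theorem causalLE_delayed (hσ : σ ≤ ρ) (ht : t ∈ Ico a b)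
    (hmem : ∀ r ∈ Icc a t, lagRect u v θ k r 0 ∈ chartRegion Y O τ y₀ σ) :
    CausalLE τ C (Y (u a, v a, θ a)) (Y (lagRect u v θ k t 0)) := by
  have hsub : Icc a t ⊆ Ico a b := fun r hr => ⟨hr.1, hr.2.trans_lt ht.2⟩
  have hstart : lagRect u v θ k a 0 = (u a, v a, θ a) := by rw [lagRect_zero, hk.start]
  rw [← hstart]
  refine h.causalLE_of_curve hQ hσ (c := fun r => lagRect u v θ k r 0) ht.1
    ((hc.continuousOn_lagRect hk).comp (f := fun r => (r, (0 : ℝ × ℝ)))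
      (by fun_prop) fun r hr => ⟨hsub hr, mem_univ _⟩)
    (c' := fun r => (u' (k r) * (‖θ' r‖ / nullSpeed Q R u v u' v' (k r)),
      v' (k r) * (‖θ' r‖ / nullSpeed Q R u v u' v' (k r)), θ' r))
    (fun r hr => ?_) hmem fun r hr => ?_
  · have hr' := hsub ⟨hr.1, hr.2.le⟩
    simp only [lagRect_zero]
    exact (hk.hasDerivWithinAt_comp hc.u_deriv hr').prodMk
      ((hk.hasDerivWithinAt_comp hc.v_deriv hr').prodMk (hc.θ_deriv r hr'))
  · have hr' := hsub ⟨hr.1, hr.2.le⟩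
    have hkr := hk.mem_Ico hr'
    have hrate : 0 ≤ ‖θ' r‖ / nullSpeed Q R u v u' v' (k r) :=
      div_nonneg (norm_nonneg _) (Real.sqrt_nonneg _)
    refine ⟨mul_nonneg (hc.u'_pos _ hkr).le hrate, mul_nonneg (hc.v'_pos _ hkr).le hrate, ?_⟩
    rw [lagRect_zero]
    exact hc.coneMetric_delayed_nonpos hQ hR hkr hr'

/-- Points of the rectangle at time `t` lie between the points of the curve at times `a` and `t`:
first follow the delayed curve, and then a line in the rectangle. -/
theorem lagRect_mem_chartRegion_of_forall_Icc (hσ : σ ≤ ρ) (ht : t ∈ Ico a b)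
    (ha : Y (u a, v a, θ a) ∈ Metric.closedBall y₀ ε)
    (htε : Y (u t, v t, θ t) ∈ Metric.closedBall y₀ ε)
    (hmem : ∀ r ∈ Icc a t, ∀ s ∈ Icc 0 1, lagRect u v θ k r s ∈ chartRegion Y O τ y₀ σ)
    {s : ℝ × ℝ} (hs : s ∈ Icc 0 1) :
    lagRect u v θ k t s ∈ chartRegion Y O τ y₀ (ε + C * (‖τ‖ * (2 * ε))) := by
  have hmem_t := hmem t (right_mem_Icc.2 ht.1)
  refine ⟨(hmem_t s hs).1, CausalLE.mem_closedBall h.bound_pos ha htε ?_ ?_, (hmem_t s hs).2.2⟩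
  · exact (h.causalLE_delayed hQ hR hc hk hσ ht fun r hr => hmem r hr 0 (by simp)).trans
      (h.causalLE_lagRect hQ hc hk hσ ht hmem_t le_rfl hs.1 hs.2)
  · rw [← lagRect_one u v θ k t]
    exact h.causalLE_lagRect hQ hc hk hσ ht hmem_t hs.1 hs.2 le_rfl

theorem lagRect_mem_chartRegion (hσ : ε + C * (‖τ‖ * (2 * ε)) < σ) (hσ' : σ ≤ ρ)
    (hε : ∀ t ∈ Ico a b, Y (u t, v t, θ t) ∈ Metric.closedBall y₀ ε)
    (hstart : (u a, v a, θ a) ∈ chartRegion Y O τ y₀ σ) (ht : t ∈ Ico a b) {s : ℝ × ℝ}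
    (hs : s ∈ Icc 0 1) : lagRect u v θ k t s ∈ chartRegion Y O τ y₀ σ := by
  have hsub : Icc a t ⊆ Ico a b := fun r hr => ⟨hr.1, hr.2.trans_lt ht.2⟩
  have hL := hc.continuousOn_lagRect hk
  suffices hall : Icc a t ⊆ {r | ∀ s ∈ Icc 0 1, lagRect u v θ k r s ∈ chartRegion Y O τ y₀ σ} from
    hall (right_mem_Icc.2 ht.1) s hs
  refine IsClosed.Icc_subset_of_forall_mem_nhdsGT_of_Icc_subset
    (h.isClosed_setOf_forall_mem_chartRegion hQ hσ'
      (fun s _ => hL.comp (f := fun r => (r, s)) (by fun_prop)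
        fun r hr => ⟨hsub hr, mem_univ _⟩)
      fun r hr s hs => hc.lagRect_mem_coneDomain hk (hsub hr) hs) ?_ fun r hr hIcc => ?_
  · simpa [lagRect, hk.start] using fun _ _ _ _ => hstart
  · have hr' : r ∈ Ico a b := hsub ⟨hr.1, hr.2.le⟩
    have hIco : 𝓝[>] r ≤ 𝓝[Ico a b] r := nhdsWithin_le_of_mem <| by
      filter_upwards [Ioo_mem_nhdsGT hr'.2] with x hx using ⟨hr'.1.trans hx.1.le, hx.2⟩
    refine h.eventually_forall_mem_chartRegion hσ isCompact_Icc (fun s _ => ?_) fun s hs =>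
      h.lagRect_mem_chartRegion_of_forall_Icc hQ hR hc hk hσ' hr'
        (hε a ⟨le_rfl, hc.lt⟩) (hε r hr') (fun x hx => hIcc hx) hs
    have hLr := hL (r, s) ⟨hr', mem_univ s⟩
    rw [ContinuousWithinAt, nhdsWithin_prod_eq, nhdsWithin_univ] at hLr
    exact hLr.mono_left (prod_mono_left _ hIco)

omit hR in
theorem nullLine_mem_chartRegion_of_lagRect (hσ : σ ≤ ρ)
    (hmem : ∀ t ∈ Ico a b, ∀ s ∈ Icc 0 1, lagRect u v θ k t s ∈ chartRegion Y O τ y₀ σ) {e : V}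
    (he : e ≠ 0) (hθ : Tendsto θ (𝓝[<] b) (𝓝 e)) (hv : Tendsto v (𝓝[<] b) (𝓝 0)) {y : ℝ}
    (hy : y ∈ Ico (v κ) 0) : (u κ, y, e) ∈ chartRegion Y O τ y₀ σ := by
  have hκ := hk.limit_mem
  refine h.mem_chartRegion_of_mem_closure hQ hσ ⟨hc.u_neg κ hκ, hy.2, he⟩ ?_
  have huk : Tendsto (fun t => u (k t)) (𝓝[<] b) (𝓝 (u κ)) := by
    refine (hc.u_cont κ hκ).tendsto.comp (tendsto_nhdsWithin_iff.2 ⟨hk.tendsto, ?_⟩)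
    filter_upwards [Ico_mem_nhdsLT hc.lt] with t ht using hk.mem_Ico ht
  have hlim : Tendsto (fun t => ((u (k t), y, θ t) : ConeSpace V)) (𝓝[<] b) (𝓝 (u κ, y, e)) :=
    huk.prodMk_nhds (tendsto_const_nhds.prodMk_nhds hθ)
  refine mem_closure_of_tendsto hlim ?_
  filter_upwards [Ico_mem_nhdsLT hc.lt, hv.eventually (lt_mem_nhds hy.2)] with t ht hyt
  have hvk : v (k t) ≤ y :=
    (hc.v_strictMono.monotoneOn (hk.mem_Ico ht) hκ (hk.le_limit t ht)).trans hy.1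
  have hpos : 0 < v t - v (k t) := sub_pos.2 (hvk.trans_lt hyt)
  have hs : ((0, (y - v (k t)) / (v t - v (k t))) : ℝ × ℝ) ∈ Icc 0 1 :=
    ⟨⟨le_rfl, div_nonneg (sub_nonneg.2 hvk) hpos.le⟩,
      ⟨zero_le_one, (div_le_one hpos).2 (sub_le_sub_right hyt.le _)⟩⟩
  simpa [lagRect, div_mul_cancel₀ _ hpos.ne'] using hmem t ht _ hs

end Lag

section Curve

variable {V E : Type*} [NormedAddCommGroup V] [InnerProductSpace ℝ V] [FiniteDimensional ℝ V]
  [NormedAddCommGroup E] [NormedSpace ℝ E] {Q R : ℝ → ℝ → ℝ} {Y : ConeSpace V → E}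
  {O : Set (ConeSpace V)} {G : E → E →L[ℝ] E →L[ℝ] ℝ} {τ : E →L[ℝ] ℝ} {y₀ : E} {ρ Λ C : ℝ}
  {u v u' v' F l : ℝ → ℝ} {θ θ' : ℝ → V} {a b σ ε : ℝ}

theorem false_of_future_curve (h : BoundaryChart Q R Y O G τ y₀ ρ Λ C)
    (hQ : IsBoundedCoefficient Q) (hR : IsBoundedCoefficient R)
    (hc : IsConeCurve Q R u v u' v' F l θ θ' a b) (hV : 1 < Module.finrank ℝ V)
    (hεσ : ε + C * (‖τ‖ * (2 * ε)) < σ) (hσ : σ < ρ)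
    (hε : ∀ t ∈ Ico a b, Y (u t, v t, θ t) ∈ Metric.closedBall y₀ ε)
    (hstart : (u a, v a, θ a) ∈ chartRegion Y O τ y₀ σ) (hv : Tendsto v (𝓝[<] b) (𝓝 0))
    (hRv : ∀ u < 0, Tendsto (partialV R u) (𝓝[<] 0) atBot)
    (hRu : ∀ u < 0, ∀ᶠ v in 𝓝[<] 0, partialU R u v ≤ 0) : False := by
  obtain ⟨k, κ, hk⟩ := hc.exists_isLag hQ hR
  obtain ⟨e, he, hθ⟩ := hc.exists_tendsto_θ hQ hR
  have huκ := hc.u_neg κ hk.limit_mem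
  refine h.false_of_nullLine hQ hR hV hσ he huκ (hc.v_neg κ hk.limit_mem) (fun y hy => ?_)
    (hRv _ huκ) (hRu _ huκ)
  exact h.nullLine_mem_chartRegion_of_lagRect hQ hc hk hσ.le
    (fun t ht s hs => h.lagRect_mem_chartRegion hQ hR hc hk hεσ hσ.le hε hstart ht hs)
    (ne_zero_of_norm_ne_zero (he.trans_ne one_ne_zero)) hθ hv hy

omit [FiniteDimensional ℝ V] in
theorem neg (h : BoundaryChart Q R Y O G τ y₀ ρ Λ C) : BoundaryChart Q R Y O G (-τ) y₀ ρ Λ C :=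
  { h with cone := fun y hy V hV => by simpa using h.cone y hy V hV }

theorem false_of_curve (h : BoundaryChart Q R Y O G τ y₀ ρ Λ C) (hρ : 0 < ρ)
    (hQ : IsBoundedCoefficient Q) (hR : IsBoundedCoefficient R)
    (hc : IsConeCurve Q R u v u' v' F l θ θ' a b) (hV : 1 < Module.finrank ℝ V)
    (hO : ∀ᶠ t in 𝓝[<] b, (u t, v t, θ t) ∈ O)
    (hY : Tendsto (fun t => Y (u t, v t, θ t)) (𝓝[<] b) (𝓝 y₀)) (hv : Tendsto v (𝓝[<] b) (𝓝 0))
    (hRv : ∀ u < 0, Tendsto (partialV R u) (𝓝[<] 0) atBot)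
    (hRu : ∀ u < 0, ∀ᶠ v in 𝓝[<] 0, partialU R u v ≤ 0) : False := by
  have hC := h.bound_pos
  have hlim : Tendsto (fun ε => ε + C * (‖τ‖ * (2 * ε))) (𝓝[>] 0) (𝓝 0) :=
    tendsto_nhdsWithin_of_tendsto_nhds
      (Continuous.tendsto' (by fun_prop) 0 0 (by simp))
  obtain ⟨ε, hεσ, hε₀⟩ :=
    ((hlim.eventually (gt_mem_nhds (half_pos hρ))).and self_mem_nhdsWithin).exists
  obtain ⟨s, hsb, hs⟩ := mem_nhdsLT_iff_exists_Ico_subset.1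
    ((hO.and (hY.eventually (Metric.closedBall_mem_nhds y₀ hε₀))).and (Ico_mem_nhdsLT hc.lt))
  obtain ⟨⟨hsO, hsε⟩, hsI⟩ := hs ⟨le_rfl, hsb⟩
  have hε_half : ε ≤ ρ / 2 := by
    have : 0 ≤ C * (‖τ‖ * (2 * ε)) := by positivity
    linarith
  have hs_half := Metric.closedBall_subset_closedBall hε_half hsε
  have htimelike : coneMetric Q R (u s, v s, θ s) (1, 1, 0) (1, 1, 0) < 0 := by
    simpa [coneMetric_null_plane] using hQ.pos (hc.u_neg s hsI) (hc.v_neg s hsI)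
  have hball : ∀ t ∈ Ico s b, Y (u t, v t, θ t) ∈ Metric.closedBall y₀ ε := fun t ht =>
    (hs ht).1.2
  rcases (h.apply_fderiv_ne_zero_of_timelike hsO
    (Metric.closedBall_subset_closedBall (half_le_self hρ.le) hs_half) htimelike).lt_or_gt
    with hτ | hτ
  · exact h.neg.false_of_future_curve hQ hR (hc.mono_left hsI) hV (by rwa [norm_neg])
      (half_lt_self hρ) hball ⟨hsO, hs_half, by simpa using hτ⟩ hv hRv hRu
  · exact h.false_of_future_curve hQ hR (hc.mono_left hsI) hV hεσ (half_lt_self hρ) hball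
      ⟨hsO, hs_half, hτ⟩ hv hRv hRu

end Curve

end BoundaryChart

section Swap

variable {V E : Type*} [NormedAddCommGroup V] [InnerProductSpace ℝ V] [NormedAddCommGroup E]
  [NormedSpace ℝ E] {Q R : ℝ → ℝ → ℝ}

/-- The map which exchanges `u` and `v`. -/
def swapNull (V : Type*) [NormedAddCommGroup V] [NormedSpace ℝ V] : ConeSpace V ≃L[ℝ] ConeSpace V :=
  ((ContinuousLinearEquiv.prodAssoc ℝ ℝ ℝ V).symm.trans
    ((ContinuousLinearEquiv.prodComm ℝ ℝ ℝ).prodCongr (ContinuousLinearEquiv.refl ℝ V))).trans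
    (ContinuousLinearEquiv.prodAssoc ℝ ℝ ℝ V)

theorem swapNull_apply (x : ConeSpace V) : swapNull V x = (x.2.1, x.1, x.2.2) := rfl

theorem BoundaryChart.swap {Y : ConeSpace V → E} {O : Set (ConeSpace V)}
    {G : E → E →L[ℝ] E →L[ℝ] ℝ} {τ : E →L[ℝ] ℝ} {y₀ : E} {ρ Λ C : ℝ}
    (h : BoundaryChart Q R Y O G τ y₀ ρ Λ C) :
    BoundaryChart (fun u v => Q v u) (fun u v => R v u) (Y ∘ swapNull V) (swapNull V ⁻¹' O)
      G τ y₀ ρ Λ C :=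
  { h with
    isOpen := h.isOpen.preimage (swapNull V).continuous
    subset := fun x hx => ⟨(h.subset hx).2.1, (h.subset hx).1, (h.subset hx).2.2⟩
    smooth := h.smooth.comp (swapNull V).contDiff.contDiffOn fun _ hx => hx
    closed := fun x hx hcl => h.closed (swapNull V x) ⟨hx.2.1, hx.1, hx.2.2⟩
      (map_mem_closure (swapNull V).continuous hcl fun p hp => hp)
    isometric := fun x hx z w => by
      have hd : fderiv ℝ (Y ∘ swapNull V) x = (fderiv ℝ Y (swapNull V x)).comp
          (swapNull V : ConeSpace V →L[ℝ] ConeSpace V) :=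
        ((h.hasFDerivAt hx).comp x (swapNull V).hasFDerivAt).fderiv
      rw [hd]
      refine (h.isometric _ hx (swapNull V z) (swapNull V w)).trans ?_
      simp only [coneMetric, swapNull_apply]
      ring }

theorem IsBoundedCoefficient.swap (hQ : IsBoundedCoefficient Q) :
    IsBoundedCoefficient fun u v => Q v u where
  differentiable := hQ.differentiable.comp (f := fun x : ℝ × ℝ => (x.2, x.1)) (by fun_prop)
    fun _ hx => ⟨hx.2, hx.1⟩
  bounds := fun a ha => by
    obtain ⟨m, hm, M, h⟩ := hQ.bounds a ha
    exact ⟨m, hm, M, fun u hu v hv => h v hv u hu⟩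

theorem IsConeCurve.swap {V : Type*} [NormedAddCommGroup V] [NormedSpace ℝ V]
    {u v u' v' F l : ℝ → ℝ} {θ θ' : ℝ → V} {a b : ℝ}
    (hc : IsConeCurve Q R u v u' v' F l θ θ' a b) :
    IsConeCurve (fun u v => Q v u) (fun u v => R v u) v u v' u' F l θ θ' a b :=
  { hc with
    u_neg := hc.v_neg
    v_neg := hc.u_neg
    u_cont := hc.v_cont
    v_cont := hc.u_cont
    u_deriv := hc.v_deriv
    v_deriv := hc.u_deriv
    u'_pos := hc.v'_pos
    v'_pos := hc.u'_pos
    F_deriv := fun t ht => by simpa only [nullSpeed, mul_comm (v' t)] using hc.F_deriv t ht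
    timelike := fun t ht => by simpa only [mul_comm (v' t)] using hc.timelike t ht }

end Swap

section Normalize

variable {V : Type*} [NormedAddCommGroup V] [InnerProductSpace ℝ V]

/-- The derivative at `x` of the radial projection `y ↦ y / ‖y‖`. -/
def normalizeDeriv (x : V) : V →L[ℝ] V :=
  ‖x‖⁻¹ • ContinuousLinearMap.id ℝ V - (‖x‖⁻¹ ^ 3 • innerSL ℝ x).smulRight x

theorem hasFDerivAt_normalize {x : V} (hx : x ≠ 0) :
    HasFDerivAt (fun y : V => ‖y‖⁻¹ • y) (normalizeDeriv x) x := by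
  have hx0 : ‖x‖ ≠ 0 := norm_ne_zero_iff.2 hx
  have hnorm : HasFDerivAt (fun y : V => √(‖y‖ ^ 2)) _ x :=
    (hasStrictFDerivAt_norm_sq x).hasFDerivAt.sqrt (by positivity)
  simp only [Real.sqrt_sq (norm_nonneg _)] at hnorm
  convert! ((hasDerivAt_inv hx0).comp_hasFDerivAt x hnorm).smul (hasFDerivAt_id x) using 1
  ext a
  simp [normalizeDeriv, smul_smul, sub_eq_add_neg, ← neg_smul]
  congr 1
  field_simp

theorem inner_normalizeDeriv {x : V} (hx : x ≠ 0) (a b : V) :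
    inner ℝ (normalizeDeriv x a) (normalizeDeriv x b) = coneRound x a b := by
  have hx0 : ‖x‖ ≠ 0 := norm_ne_zero_iff.2 hx
  simp [normalizeDeriv, coneRound, inner_sub_left, inner_sub_right, inner_smul_left,
    inner_smul_right, real_inner_comm x a]
  field_simp
  ring

end Normalize

theorem hasMFDerivAt_negLine_val (x : NegLine) :
    HasMFDerivAt 𝓘(ℝ, ℝ) 𝓘(ℝ, ℝ) (Subtype.val : NegLine → ℝ) x (ContinuousLinearMap.id ℝ ℝ) := by
  refine ⟨continuous_subtype_val.continuousAt, ?_⟩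
  have hev : writtenInExtChartAt 𝓘(ℝ, ℝ) 𝓘(ℝ, ℝ) x (Subtype.val : NegLine → ℝ)
      =ᶠ[𝓝 (extChartAt 𝓘(ℝ, ℝ) x x)] id := by
    filter_upwards [extChartAt_target_mem_nhds (I := 𝓘(ℝ, ℝ)) x] with y hy
    exact (extChartAt 𝓘(ℝ, ℝ) x).right_inv hy
  exact ((hasFDerivAt_id _).congr_of_eventuallyEq hev).hasFDerivWithinAt

theorem hasMFDerivAt_u (p : DoubleNull) :
    HasMFDerivAt DoubleNullModel 𝓘(ℝ, ℝ) (fun x : DoubleNull => (x.1 : ℝ)) p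
      ((ContinuousLinearMap.id ℝ ℝ).comp
        (ContinuousLinearMap.fst ℝ ℝ (ℝ × EuclideanSpace ℝ (Fin 2)))) :=
  (hasMFDerivAt_negLine_val p.1).comp p (hasMFDerivAt_fst p)

theorem hasMFDerivAt_v (p : DoubleNull) :
    HasMFDerivAt DoubleNullModel 𝓘(ℝ, ℝ) (fun x : DoubleNull => (x.2.1 : ℝ)) p
      ((ContinuousLinearMap.id ℝ ℝ).comp
        ((ContinuousLinearMap.fst ℝ ℝ (EuclideanSpace ℝ (Fin 2))).comp
          (ContinuousLinearMap.snd ℝ ℝ (ℝ × EuclideanSpace ℝ (Fin 2))))) :=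
  (hasMFDerivAt_negLine_val p.2.1).comp p ((hasMFDerivAt_fst p.2).comp p (hasMFDerivAt_snd p))

theorem mdifferentiableAt_sphere_val (x : UnitSphere) :
    MDifferentiableAt (𝓡 2) 𝓘(ℝ, EuclideanSpace ℝ (Fin 3))
      ((↑) : UnitSphere → EuclideanSpace ℝ (Fin 3)) x := by
  have : Fact (Module.finrank ℝ (EuclideanSpace ℝ (Fin 3)) = 2 + 1) := ⟨by simp⟩
  exact (contMDiff_coe_sphere (n := 2) (m := 1) x).mdifferentiableAt one_ne_zero

theorem hasMFDerivAt_sphere (p : DoubleNull) :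
    HasMFDerivAt DoubleNullModel 𝓘(ℝ, EuclideanSpace ℝ (Fin 3))
      (fun x : DoubleNull => (x.2.2 : EuclideanSpace ℝ (Fin 3))) p
      ((mfderiv (𝓡 2) 𝓘(ℝ, EuclideanSpace ℝ (Fin 3))
        ((↑) : UnitSphere → EuclideanSpace ℝ (Fin 3)) p.2.2).comp
        ((ContinuousLinearMap.snd ℝ ℝ (EuclideanSpace ℝ (Fin 2))).comp
          (ContinuousLinearMap.snd ℝ ℝ (ℝ × EuclideanSpace ℝ (Fin 2))))) :=
  (mdifferentiableAt_sphere_val p.2.2).hasMFDerivAt.comp p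
    ((hasMFDerivAt_snd p.2).comp p (hasMFDerivAt_snd p))

theorem diffU_timeVector (p : DoubleNull) : diffU p (timeVector p) = 1 := by
  unfold diffU
  rw [(hasMFDerivAt_u p).mfderiv]
  rfl

theorem diffV_timeVector (p : DoubleNull) : diffV p (timeVector p) = 1 := by
  unfold diffV
  rw [(hasMFDerivAt_v p).mfderiv]
  rfl

theorem diffSphere_timeVector (p : DoubleNull) : diffSphere p (timeVector p) = 0 := by
  unfold diffSphere
  rw [(hasMFDerivAt_sphere p).mfderiv]
  exact map_zero (mfderiv (𝓡 2) 𝓘(ℝ, EuclideanSpace ℝ (Fin 3))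
    ((↑) : UnitSphere → EuclideanSpace ℝ (Fin 3)) p.2.2)

theorem doubleNullMetric_apply (Ω r : ℝ → ℝ → ℝ) (p : DoubleNull)
    (X Y : TangentSpace DoubleNullModel p) :
    doubleNullMetric Ω r p X Y = -(Ω p.1 p.2.1 ^ 2 / 2) *
      (diffU p X * diffV p Y + diffV p X * diffU p Y) +
      r p.1 p.2.1 ^ 2 * inner ℝ (diffSphere p X) (diffSphere p Y) := by
  simp only [doubleNullMetric, roundMetric, neg_smul, LinearMap.add_apply, LinearMap.neg_apply,
    LinearMap.smul_apply, LinearMap.BilinForm.linMulLin_apply, LinearMap.compl₁₂_apply,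
    innerₗ_apply_apply, smul_eq_mul]
  ring

/-- The point of `(-∞, 0)` given by a negative real number, with junk value `-1`. -/
def negPoint (t : ℝ) : NegLine := if h : t < 0 then ⟨t, h⟩ else ⟨-1, by simp⟩

theorem coe_negPoint {t : ℝ} (h : t < 0) : (negPoint t : ℝ) = t := by simp [negPoint, h]

theorem contMDiffAt_negPoint {t : ℝ} (h : t < 0) :
    ContMDiffAt 𝓘(ℝ, ℝ) 𝓘(ℝ, ℝ) ∞ negPoint t := by
  rw [← ContMDiffAt.subtypeVal_comp_iff]
  refine contMDiffAt_id.congr_of_eventuallyEq ?_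
  filter_upwards [Iio_mem_nhds h] with s hs using coe_negPoint hs

/-- The radial projection of `ℝ³ \ {0}` to the sphere, with a junk value at `0`. -/
def spherePoint (x : EuclideanSpace ℝ (Fin 3)) : UnitSphere :=
  if h : x = 0 then ⟨EuclideanSpace.single 0 1, by simp⟩
  else ⟨‖x‖⁻¹ • x, by simp [norm_smul, h]⟩

theorem coe_spherePoint {x : EuclideanSpace ℝ (Fin 3)} (h : x ≠ 0) :
    (spherePoint x : EuclideanSpace ℝ (Fin 3)) = ‖x‖⁻¹ • x := by simp [spherePoint, h]

theorem contMDiffAt_spherePoint {x : EuclideanSpace ℝ (Fin 3)} (h : x ≠ 0) :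
    ContMDiffAt 𝓘(ℝ, EuclideanSpace ℝ (Fin 3)) (𝓡 2) ∞ spherePoint x := by
  have : Fact (Module.finrank ℝ (EuclideanSpace ℝ (Fin 3)) = 2 + 1) := ⟨by simp⟩
  let U : TopologicalSpace.Opens (EuclideanSpace ℝ (Fin 3)) := ⟨{0}ᶜ, isOpen_compl_singleton⟩
  have hU (y : U) : (y : EuclideanSpace ℝ (Fin 3)) ≠ 0 := y.2
  have hf : ContMDiff 𝓘(ℝ, EuclideanSpace ℝ (Fin 3)) 𝓘(ℝ, EuclideanSpace ℝ (Fin 3)) ∞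
      (fun y : U => ‖(y : EuclideanSpace ℝ (Fin 3))‖⁻¹ • (y : EuclideanSpace ℝ (Fin 3))) :=
    fun y => (contMDiffAt_subtype_iff (U := U)
      (f := fun y : EuclideanSpace ℝ (Fin 3) => ‖y‖⁻¹ • y)).2
      (((contDiffAt_norm ℝ (hU y)).inv (norm_ne_zero_iff.2 (hU y))).smul
        contDiffAt_id).contMDiffAt
  rw [← contMDiffAt_subtype_iff (U := U) (x := ⟨x, h⟩)]
  refine (hf.codRestrict_sphere (n := 2) (fun y => by simp [norm_smul, hU y])
    ⟨x, h⟩).congr_of_eventuallyEq (Eventually.of_forall fun y => ?_)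
  exact Subtype.ext (coe_spherePoint (hU y))

/-- The coordinate space of the cone over the double null spacetime. -/
abbrev DoubleNullCone : Type := ConeSpace (EuclideanSpace ℝ (Fin 3))

/-- The inclusion of the double null spacetime in its cone as the points over the unit sphere. -/
def coneCoord (p : DoubleNull) : DoubleNullCone := (p.1, p.2.1, p.2.2)

/-- The radial projection of the cone to the double null spacetime. -/
def conePoint (x : DoubleNullCone) : DoubleNull :=
  (negPoint x.1, negPoint x.2.1, spherePoint x.2.2)

theorem norm_coneCoord (p : DoubleNull) : ‖(coneCoord p).2.2‖ = 1 := by simp [coneCoord]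

theorem coneCoord_mem (p : DoubleNull) : coneCoord p ∈ coneDomain (EuclideanSpace ℝ (Fin 3)) :=
  ⟨p.1.2, p.2.1.2, norm_ne_zero_iff.1 (by simp [norm_coneCoord])⟩

theorem conePoint_coneCoord (p : DoubleNull) : conePoint (coneCoord p) = p :=
  Prod.ext (Subtype.ext (coe_negPoint p.1.2)) (Prod.ext (Subtype.ext (coe_negPoint p.2.1.2))
    (Subtype.ext ((coe_spherePoint (coneCoord_mem p).2.2).trans (by
      rw [norm_coneCoord, inv_one, one_smul, coneCoord]))))

section ConePoint

variable {x : DoubleNullCone}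

theorem contMDiffAt_conePoint (hx : x ∈ coneDomain (EuclideanSpace ℝ (Fin 3))) :
    ContMDiffAt 𝓘(ℝ, DoubleNullCone) DoubleNullModel ∞ conePoint x :=
  ((contMDiffAt_negPoint hx.1).comp x contDiffAt_fst.contMDiffAt).prodMk
    (((contMDiffAt_negPoint hx.2.1).comp x contDiffAt_snd.fst.contMDiffAt).prodMk
      ((contMDiffAt_spherePoint hx.2.2).comp x contDiffAt_snd.snd.contMDiffAt))

theorem mfderiv_mfderiv_conePoint {F : Type*} [NormedAddCommGroup F] [NormedSpace ℝ F]
    {f : DoubleNull → F} {g : DoubleNullCone → F} {g' : DoubleNullCone →L[ℝ] F}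
    (hx : x ∈ coneDomain (EuclideanSpace ℝ (Fin 3)))
    (hf : MDifferentiableAt DoubleNullModel 𝓘(ℝ, F) f (conePoint x)) (hg : HasFDerivAt g g' x)
    (hfg : ∀ y ∈ coneDomain (EuclideanSpace ℝ (Fin 3)), f (conePoint y) = g y)
    (z : DoubleNullCone) :
    mfderiv DoubleNullModel 𝓘(ℝ, F) f (conePoint x)
      (mfderiv 𝓘(ℝ, DoubleNullCone) DoubleNullModel conePoint x z) = g' z := by
  have hcomp : (f ∘ conePoint) =ᶠ[𝓝 x] g := by
    filter_upwards [isOpen_coneDomain.mem_nhds hx] with y hy using hfg y hy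
  refine (mfderiv_comp_apply x hf
    ((contMDiffAt_conePoint hx).mdifferentiableAt (by simp)) z).symm.trans ?_
  rw [mfderiv_eq_fderiv, hcomp.fderiv_eq, hg.fderiv]
  rfl

theorem diffU_mfderiv_conePoint (hx : x ∈ coneDomain (EuclideanSpace ℝ (Fin 3)))
    (z : DoubleNullCone) :
    diffU (conePoint x) (mfderiv 𝓘(ℝ, DoubleNullCone) DoubleNullModel conePoint x z) = z.1 :=
  mfderiv_mfderiv_conePoint hx (hasMFDerivAt_u _).mdifferentiableAt hasFDerivAt_fst
    (fun _ hy => coe_negPoint hy.1) z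

theorem diffV_mfderiv_conePoint (hx : x ∈ coneDomain (EuclideanSpace ℝ (Fin 3)))
    (z : DoubleNullCone) :
    diffV (conePoint x) (mfderiv 𝓘(ℝ, DoubleNullCone) DoubleNullModel conePoint x z) = z.2.1 :=
  mfderiv_mfderiv_conePoint hx (hasMFDerivAt_v _).mdifferentiableAt
    ((ContinuousLinearMap.fst ℝ ℝ (EuclideanSpace ℝ (Fin 3))).comp
      (ContinuousLinearMap.snd ℝ ℝ (ℝ × EuclideanSpace ℝ (Fin 3)))).hasFDerivAt
    (fun _ hy => coe_negPoint hy.2.1) z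

theorem diffSphere_mfderiv_conePoint (hx : x ∈ coneDomain (EuclideanSpace ℝ (Fin 3)))
    (z : DoubleNullCone) :
    diffSphere (conePoint x) (mfderiv 𝓘(ℝ, DoubleNullCone) DoubleNullModel conePoint x z) =
      normalizeDeriv x.2.2 z.2.2 := by
  let pr : DoubleNullCone →L[ℝ] EuclideanSpace ℝ (Fin 3) :=
    (ContinuousLinearMap.snd ℝ ℝ _).comp (ContinuousLinearMap.snd ℝ ℝ _)
  have hpr : HasFDerivAt (fun y => ‖pr y‖⁻¹ • pr y) ((normalizeDeriv x.2.2).comp pr) x :=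
    HasFDerivAt.comp (g := fun y => ‖y‖⁻¹ • y) x (hasFDerivAt_normalize hx.2.2) pr.hasFDerivAt
  exact mfderiv_mfderiv_conePoint hx (hasMFDerivAt_sphere _).mdifferentiableAt hpr
    (fun _ hy => coe_spherePoint hy.2.2) z

theorem doubleNullMetric_mfderiv_conePoint (Ω r : ℝ → ℝ → ℝ)
    (hx : x ∈ coneDomain (EuclideanSpace ℝ (Fin 3))) (z w : DoubleNullCone) :
    doubleNullMetric Ω r (conePoint x)
      (mfderiv 𝓘(ℝ, DoubleNullCone) DoubleNullModel conePoint x z)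
      (mfderiv 𝓘(ℝ, DoubleNullCone) DoubleNullModel conePoint x w) =
    coneMetric (fun u v => Ω u v ^ 2) (fun u v => r u v ^ 2) x z w := by
  have hu : ((conePoint x).1 : ℝ) = x.1 := coe_negPoint hx.1
  have hv : ((conePoint x).2.1 : ℝ) = x.2.1 := coe_negPoint hx.2.1
  refine (doubleNullMetric_apply Ω r _ _ _).trans ?_
  rw [hu, hv, diffU_mfderiv_conePoint hx, diffU_mfderiv_conePoint hx, diffV_mfderiv_conePoint hx,
    diffV_mfderiv_conePoint hx, diffSphere_mfderiv_conePoint hx, diffSphere_mfderiv_conePoint hx,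
    inner_normalizeDeriv hx.2.2, coneMetric]

end ConePoint

section LorentzForm

namespace IsLorentzForm

section Algebra

variable {V : Type*} [AddCommGroup V] [Module ℝ V] {d : ℕ} {B : LinearMap.BilinForm ℝ V}

theorem exists_basis (hB : IsLorentzForm d B) : ∃ b : Module.Basis (Fin (d + 1)) ℝ V,
    ∀ x y, B x y = ∑ i, (if i = 0 then -1 else 1) * (b.repr x i * b.repr y i) := by
  obtain ⟨b, hb⟩ := hB
  refine ⟨b, fun x y => ?_⟩
  conv_lhs => rw [← b.sum_repr x, ← b.sum_repr y]
  simp only [map_sum, map_smul, LinearMap.sum_apply, LinearMap.smul_apply, hb, smul_eq_mul,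
    mul_ite, mul_zero, Finset.sum_ite_eq', Finset.mem_univ, if_true]
  exact Finset.sum_congr rfl fun i _ => by split_ifs <;> ring

theorem symm (hB : IsLorentzForm d B) (x y : V) : B x y = B y x := by
  obtain ⟨b, hb⟩ := hB.exists_basis
  simp only [hb, mul_comm (b.repr x _)]

theorem eq_zero_of_apply_eq_zero (hB : IsLorentzForm d B) {x : V} (hx : ∀ y, B x y = 0) :
    x = 0 := by
  obtain ⟨b, hb⟩ := hB.exists_basis
  refine b.ext_elem fun i => ?_
  have hi : (if i = 0 then -b.repr x i else b.repr x i) = 0 := by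
    simpa [hb, Finsupp.single_apply] using hx (b i)
  rw [map_zero, Finsupp.zero_apply]
  split_ifs at hi
  exacts [neg_eq_zero.1 hi, hi]

end Algebra

section Norm

variable {E : Type*} [NormedAddCommGroup E] [NormedSpace ℝ E] [FiniteDimensional ℝ E] {d : ℕ}

theorem exists_norm_sq_le {B : LinearMap.BilinForm ℝ E} (hB : IsLorentzForm d B) :
    ∃ τ : E →L[ℝ] ℝ, ∃ K > 0, ∀ x, ‖x‖ ^ 2 ≤ K * (B x x + 2 * τ x ^ 2) := by
  obtain ⟨b, hb⟩ := hB.exists_basis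
  let e : E ≃ₗ[ℝ] EuclideanSpace ℝ (Fin (d + 1)) :=
    b.equivFun.trans (WithLp.linearEquiv 2 ℝ (Fin (d + 1) → ℝ)).symm
  obtain ⟨K, hK, he⟩ := e.toLinearMap.exists_antilipschitzWith e.ker
  refine ⟨LinearMap.toContinuousLinearMap (b.coord 0), K ^ 2, by positivity, fun x => ?_⟩
  have hnorm : ‖e x‖ ^ 2 = B x x + 2 * b.repr x 0 ^ 2 := by
    have he (i) : e x i = b.repr x i := rfl
    rw [EuclideanSpace.norm_sq_eq]
    simp only [hb, he, Fin.sum_univ_succ, Real.norm_eq_abs, sq_abs,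
      Fin.succ_ne_zero, if_true, if_false, one_mul, ← sq]
    ring
  calc ‖x‖ ^ 2 ≤ (K * ‖e x‖) ^ 2 := by
        gcongr
        exact ZeroHomClass.bound_of_antilipschitz e.toLinearMap he x
    _ = K ^ 2 * (B x x + 2 * b.repr x 0 ^ 2) := by rw [mul_pow, hnorm]

theorem exists_norm_le {B : E →L[ℝ] E →L[ℝ] ℝ} {B' : LinearMap.BilinForm ℝ E}
    (hB' : IsLorentzForm d B') (hBB' : ∀ x y, B x y = B' x y) : ∃ K > 0, ∀ x, ‖x‖ ≤ K * ‖B x‖ := by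
  have hker : B.toLinearMap.ker = ⊥ := LinearMap.ker_eq_bot'.2 fun x hx =>
    hB'.eq_zero_of_apply_eq_zero fun y => by
      rw [← hBB']
      exact DFunLike.congr_fun hx y
  obtain ⟨K, hK, hB⟩ := B.toLinearMap.exists_antilipschitzWith hker
  exact ⟨K, hK, ZeroHomClass.bound_of_antilipschitz B.toLinearMap hB⟩

end Norm

end IsLorentzForm

theorem eventually_forall_norm_le_mul_apply {E F : Type*} [NormedAddCommGroup E] [NormedSpace ℝ E]
    [NormedAddCommGroup F] [NormedSpace ℝ F] {B : E →L[ℝ] F} {K : ℝ} (hK : 0 < K)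
    (hB : ∀ x, ‖x‖ ≤ K * ‖B x‖) : ∀ᶠ A in 𝓝 B, ∀ x, ‖x‖ ≤ 2 * K * ‖A x‖ := by
  filter_upwards [Metric.ball_mem_nhds B (by positivity : 0 < (2 * K)⁻¹)] with A hA x
  have hAB : K * ‖A - B‖ ≤ 1 / 2 := by
    have := mul_le_mul_of_nonneg_left (mem_ball_iff_norm.1 hA).le hK.le
    rwa [mul_inv, mul_left_comm, mul_inv_cancel₀ hK.ne', mul_one, ← one_div] at this
  have hBx : ‖B x‖ ≤ ‖A x‖ + ‖A - B‖ * ‖x‖ :=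
    calc ‖B x‖ = ‖A x - (A - B) x‖ := by simp
      _ ≤ ‖A x‖ + ‖(A - B) x‖ := norm_sub_le _ _
      _ ≤ _ := by gcongr; exact (A - B).le_opNorm x
  have hx : ‖x‖ ≤ K * ‖A x‖ + K * ‖A - B‖ * ‖x‖ := by
    nlinarith [hB x, mul_le_mul_of_nonneg_left hBx hK.le]
  nlinarith [mul_le_mul_of_nonneg_right hAB (norm_nonneg x)]

section Cone

variable {E : Type*} [NormedAddCommGroup E] [NormedSpace ℝ E] {B : E →L[ℝ] E →L[ℝ] ℝ}

theorem eventually_forall_norm_le_mul_abs_of_nonpos {τ : E →L[ℝ] ℝ} {K : ℝ} (hK : 0 < K)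
    (hB : ∀ x, ‖x‖ ^ 2 ≤ K * (B x x + 2 * τ x ^ 2)) :
    ∀ᶠ A in 𝓝 B, ∀ x, A x x ≤ 0 → ‖x‖ ≤ 2 * √K * |τ x| := by
  filter_upwards [Metric.ball_mem_nhds B (by positivity : 0 < (2 * K)⁻¹)] with A hA x hx
  have hAB : K * ‖A - B‖ ≤ 1 / 2 := by
    have := mul_le_mul_of_nonneg_left
      ((mem_ball_iff_norm (E := E →L[ℝ] E →L[ℝ] ℝ)).1 hA).le hK.le
    rwa [mul_inv, mul_left_comm, mul_inv_cancel₀ hK.ne', mul_one, ← one_div] at this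
  have hBx : B x x ≤ ‖A - B‖ * ‖x‖ ^ 2 := by
    have hsub : (A - B) x x = A x x - B x x := rfl
    have := neg_le_of_abs_le ((A - B).le_opNorm₂ x x)
    nlinarith
  refine (sq_le_sq₀ (norm_nonneg x) (by positivity)).1 ?_
  have hhalf : ‖x‖ ^ 2 ≤ 1 / 2 * ‖x‖ ^ 2 + 2 * K * τ x ^ 2 := by
    nlinarith [hB x, mul_le_mul_of_nonneg_left hBx hK.le,
      mul_le_mul_of_nonneg_right hAB (sq_nonneg ‖x‖)]
  rw [mul_pow, mul_pow, Real.sq_sqrt hK.le, sq_abs]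
  linarith

theorem IsLorentzForm.exists_eventually_bounds [FiniteDimensional ℝ E] {d : ℕ}
    {B' : LinearMap.BilinForm ℝ E} (hB' : IsLorentzForm d B') (hBB' : ∀ x y, B x y = B' x y) :
    ∃ τ : E →L[ℝ] ℝ, ∃ C > 0, ∀ᶠ A in 𝓝 B, (∀ x, ‖x‖ ≤ C * ‖A x‖) ∧ ‖A‖ ≤ C ∧
      ∀ x, A x x ≤ 0 → ‖x‖ ≤ C * |τ x| := by
  obtain ⟨K₁, hK₁, hnd⟩ := hB'.exists_norm_le hBB'
  obtain ⟨τ, K₂, hK₂, hcone⟩ := hB'.exists_norm_sq_le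
  have hnorm : ∀ᶠ A in 𝓝 B, ‖A‖ < ‖B‖ + 1 :=
    (continuous_norm (E := E →L[ℝ] E →L[ℝ] ℝ)).continuousAt.eventually_lt_const (lt_add_one _)
  refine ⟨τ, max (2 * K₁) (max (‖B‖ + 1) (2 * √K₂)), lt_max_of_lt_left (by positivity), ?_⟩
  filter_upwards [eventually_forall_norm_le_mul_apply hK₁ hnd, hnorm,
    eventually_forall_norm_le_mul_abs_of_nonpos hK₂ fun x => (hBB' x x).symm ▸ hcone x]
    with A hA₁ hA₂ hA₃
  refine ⟨fun x => (hA₁ x).trans ?_, hA₂.le.trans (by simp), fun x hx => (hA₃ x hx).trans ?_⟩ <;>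
    gcongr <;> simp

end Cone

end LorentzForm

theorem exists_lipschitzOnWith_sum_smul {α ι F : Type*} [PseudoEMetricSpace α] [Fintype ι]
    [NormedAddCommGroup F] [NormedSpace ℝ F] {f : ι → α → ℝ} {K : Set α} {Λ : ι → NNReal}
    (hf : ∀ i, LipschitzOnWith (Λ i) (f i) K) (c : ι → F) :
    ∃ Λ', LipschitzOnWith Λ' (fun x => ∑ i, f i x • c i) K := by
  have hpi : LipschitzOnWith (∑ i, Λ i) (fun x i => f i x) K := fun x hx y hy =>
    edist_pi_le_iff.2 fun i => (hf i hx hy).trans (by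
      gcongr
      exact Finset.single_le_sum_of_canonicallyOrdered (Finset.mem_univ i))
  exact ⟨_, (Fintype.linearCombination ℝ c).toContinuousLinearMap.lipschitz.comp_lipschitzOnWith
    hpi⟩

section ChartMetric

variable {d : ℕ} {N : Type*} [TopologicalSpace N] [ChartedSpace (EuclideanSpace ℝ (Fin d)) N]

/-- The metric in the coordinates of a chart, as a field of continuous bilinear forms. -/
def chartMetric (g : BilinField (𝓡 d) N)
    (φ : OpenPartialHomeomorph N (EuclideanSpace ℝ (Fin d))) (x : EuclideanSpace ℝ (Fin d)) :
    EuclideanSpace ℝ (Fin d) →L[ℝ] EuclideanSpace ℝ (Fin d) →L[ℝ] ℝ :=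
  ∑ μ, ∑ ν, metricComponent g φ μ ν x •
    (EuclideanSpace.proj (𝕜 := ℝ) μ).smulRight (EuclideanSpace.proj (𝕜 := ℝ) ν)

/-- The pullback of the metric at `φ⁻¹ x` to the coordinate space of the chart `φ`. -/
def pullbackForm (g : BilinField (𝓡 d) N)
    (φ : OpenPartialHomeomorph N (EuclideanSpace ℝ (Fin d))) (x : EuclideanSpace ℝ (Fin d)) :
    LinearMap.BilinForm ℝ (EuclideanSpace ℝ (Fin d)) :=
  LinearMap.compl₁₂ (g (φ.symm x)) (mfderiv (𝓡 d) (𝓡 d) φ.symm x).toLinearMap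
    (mfderiv (𝓡 d) (𝓡 d) φ.symm x).toLinearMap

theorem chartMetric_apply (g : BilinField (𝓡 d) N)
    (φ : OpenPartialHomeomorph N (EuclideanSpace ℝ (Fin d))) (x z w : EuclideanSpace ℝ (Fin d)) :
    chartMetric g φ x z w = pullbackForm g φ x z w := by
  have hsum (z : EuclideanSpace ℝ (Fin d)) : z = ∑ μ, z μ • EuclideanSpace.single μ (1 : ℝ) := by
    ext i
    simp [Finset.sum_apply, Pi.single_apply]
  have hcomp (μ ν : Fin d) : pullbackForm g φ x (EuclideanSpace.single μ (1 : ℝ))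
      (EuclideanSpace.single ν (1 : ℝ)) = metricComponent g φ μ ν x := rfl
  conv_rhs => rw [hsum z, hsum w]
  simp only [chartMetric, map_sum, LinearMap.sum_apply, map_smul, LinearMap.smul_apply, smul_eq_mul,
    sum_apply, smul_apply, ContinuousLinearMap.smulRight_apply, hcomp, EuclideanSpace.proj,
    PiLp.proj_apply]
  rw [Finset.sum_comm]
  refine Finset.sum_congr rfl fun ν _ => ?_
  rw [Finset.mul_sum]
  exact Finset.sum_congr rfl fun μ _ => by ring

theorem IsLocLipschitzField.lipschitzOnWith_chartMetric {g : BilinField (𝓡 d) N}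
    (hg : IsLocLipschitzField g) {φ : OpenPartialHomeomorph N (EuclideanSpace ℝ (Fin d))}
    (hφ : φ ∈ IsManifold.maximalAtlas (𝓡 d) ∞ N) {K : Set (EuclideanSpace ℝ (Fin d))}
    (hK : K ⊆ φ.target) (hKc : IsCompact K) : ∃ Λ, LipschitzOnWith Λ (chartMetric g φ) K := by
  choose Λ hΛ using fun m : Fin d × Fin d => hg φ hφ K hK hKc m.1 m.2
  have hsum : chartMetric g φ = fun x => ∑ m : Fin d × Fin d, metricComponent g φ m.1 m.2 x •
      (EuclideanSpace.proj (𝕜 := ℝ) m.1).smulRight (EuclideanSpace.proj (𝕜 := ℝ) m.2) := by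
    ext1 x
    rw [chartMetric, Fintype.sum_prod_type]
  obtain ⟨Λ', h⟩ := exists_lipschitzOnWith_sum_smul
    (F := EuclideanSpace ℝ (Fin d) →L[ℝ] EuclideanSpace ℝ (Fin d) →L[ℝ] ℝ) hΛ fun m =>
    (EuclideanSpace.proj (𝕜 := ℝ) m.1).smulRight (EuclideanSpace.proj (𝕜 := ℝ) m.2)
  refine ⟨Λ', ?_⟩
  rw [hsum]
  exact h

theorem isLorentzForm_pullbackForm {d : ℕ} {N : Type*} [TopologicalSpace N]
    [ChartedSpace (EuclideanSpace ℝ (Fin (d + 1))) N] {g : BilinField (𝓡 (d + 1)) N}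
    {φ : OpenPartialHomeomorph N (EuclideanSpace ℝ (Fin (d + 1)))}
    (hφ : φ.MDifferentiable (𝓡 (d + 1)) (𝓡 (d + 1))) {x : EuclideanSpace ℝ (Fin (d + 1))}
    (hx : x ∈ φ.target) (hg : IsLorentzForm d (g (φ.symm x))) :
    IsLorentzForm d (pullbackForm g φ x) := by
  obtain ⟨b, hb⟩ := hg
  let e := hφ.symm.mfderiv (x := x) hx
  refine ⟨b.map e.symm.toLinearEquiv, fun i j => ?_⟩
  have he (i) : mfderiv (𝓡 (d + 1)) (𝓡 (d + 1)) φ.symm x (b.map e.symm.toLinearEquiv i) = b i :=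
    e.apply_symm_apply (b i)
  rw [← hb i j]
  exact congr_arg₂ (fun X Y => g (φ.symm x) X Y) (he i) (he j)

end ChartMetric

section BoundaryChart

theorem exists_chart_bounds {d : ℕ} {N : Type*} [TopologicalSpace N]
    [ChartedSpace (EuclideanSpace ℝ (Fin (d + 1))) N] [IsManifold (𝓡 (d + 1)) ∞ N]
    {g : BilinField (𝓡 (d + 1)) N} (hg : IsLocLipschitzField g)
    {φ : OpenPartialHomeomorph N (EuclideanSpace ℝ (Fin (d + 1)))}
    (hφ : φ ∈ IsManifold.maximalAtlas (𝓡 (d + 1)) ∞ N) {y₀ : EuclideanSpace ℝ (Fin (d + 1))}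
    (hy₀ : y₀ ∈ φ.target) (hL : IsLorentzForm d (pullbackForm g φ y₀)) :
    ∃ τ : EuclideanSpace ℝ (Fin (d + 1)) →L[ℝ] ℝ, ∃ C > 0, ∃ ρ > 0, ∃ Λ,
      Metric.closedBall y₀ ρ ⊆ φ.target ∧
      LipschitzOnWith Λ (chartMetric g φ) (Metric.closedBall y₀ ρ) ∧
      ∀ y ∈ Metric.closedBall y₀ ρ, (∀ x, ‖x‖ ≤ C * ‖chartMetric g φ y x‖) ∧
        ‖chartMetric g φ y‖ ≤ C ∧ ∀ x, chartMetric g φ y x x ≤ 0 → ‖x‖ ≤ C * |τ x| := by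
  obtain ⟨ρ₀, hρ₀, hball⟩ := Metric.nhds_basis_closedBall.mem_iff.1 (φ.open_target.mem_nhds hy₀)
  obtain ⟨Λ, hΛ⟩ := hg.lipschitzOnWith_chartMetric hφ hball (isCompact_closedBall y₀ ρ₀)
  obtain ⟨τ, C, hC, hbounds⟩ := hL.exists_eventually_bounds (chartMetric_apply g φ y₀)
  have hcont : ContinuousAt (chartMetric g φ) y₀ :=
    hΛ.continuousOn.continuousAt (Metric.closedBall_mem_nhds _ hρ₀)
  obtain ⟨ρ₁, hρ₁, hball₁⟩ := Metric.nhds_basis_closedBall.mem_iff.1 (hcont.eventually hbounds)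
  have hsub : Metric.closedBall y₀ (min ρ₀ ρ₁) ⊆ Metric.closedBall y₀ ρ₀ :=
    Metric.closedBall_subset_closedBall (min_le_left _ _)
  exact ⟨τ, C, hC, min ρ₀ ρ₁, lt_min hρ₀ hρ₁, Λ, hsub.trans hball, hΛ.mono hsub, fun y hy =>
    hball₁ (Metric.closedBall_subset_closedBall (min_le_right _ _) hy)⟩

variable {d : ℕ} {N : Type*} [TopologicalSpace N]
  [ChartedSpace (EuclideanSpace ℝ (Fin (d + 1))) N]
  {ι : DoubleNull → N} {φ : OpenPartialHomeomorph N (EuclideanSpace ℝ (Fin (d + 1)))}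

/-- The embedding `ι`, read in the homogeneous coordinates of `DoubleNullCone` and the chart `φ`. -/
def boundaryMap (ι : DoubleNull → N)
    (φ : OpenPartialHomeomorph N (EuclideanSpace ℝ (Fin (d + 1)))) (x : DoubleNullCone) :
    EuclideanSpace ℝ (Fin (d + 1)) :=
  φ (ι (conePoint x))

/-- The part of the cone which `ι` maps into the domain of the chart `φ`. -/
def boundaryDomain (ι : DoubleNull → N)
    (φ : OpenPartialHomeomorph N (EuclideanSpace ℝ (Fin (d + 1)))) : Set DoubleNullCone :=
  coneDomain (EuclideanSpace ℝ (Fin 3)) ∩ (fun x => ι (conePoint x)) ⁻¹' φ.source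

theorem contMDiffAt_comp_conePoint (hι : ContMDiff DoubleNullModel (𝓡 (d + 1)) ∞ ι)
    {x : DoubleNullCone} (hx : x ∈ coneDomain (EuclideanSpace ℝ (Fin 3))) :
    ContMDiffAt 𝓘(ℝ, DoubleNullCone) (𝓡 (d + 1)) ∞ (fun x => ι (conePoint x)) x :=
  (hι (conePoint x)).comp x (contMDiffAt_conePoint hx)

theorem isOpen_boundaryDomain (hι : ContMDiff DoubleNullModel (𝓡 (d + 1)) ∞ ι) :
    IsOpen (boundaryDomain ι φ) :=
  ContinuousOn.isOpen_inter_preimage (fun _ hx =>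
    (contMDiffAt_comp_conePoint hι hx).continuousAt.continuousWithinAt) isOpen_coneDomain
    φ.open_source

theorem contDiffAt_boundaryMap [IsManifold (𝓡 (d + 1)) ∞ N]
    (hι : ContMDiff DoubleNullModel (𝓡 (d + 1)) ∞ ι)
    (hφ : φ ∈ IsManifold.maximalAtlas (𝓡 (d + 1)) ∞ N) {x : DoubleNullCone}
    (hx : x ∈ boundaryDomain ι φ) : ContDiffAt ℝ ∞ (boundaryMap ι φ) x :=
  ((contMDiffAt_of_mem_maximalAtlas hφ hx.2).comp x
    (contMDiffAt_comp_conePoint hι hx.1)).contDiffAt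

theorem mem_boundaryDomain_of_mem_closure [T2Space N]
    (hι : ContMDiff DoubleNullModel (𝓡 (d + 1)) ∞ ι)
    {K : Set (EuclideanSpace ℝ (Fin (d + 1)))} (hK : IsCompact K) (hKφ : K ⊆ φ.target)
    {x : DoubleNullCone} (hx : x ∈ coneDomain (EuclideanSpace ℝ (Fin 3)))
    (hxK : x ∈ closure {p ∈ boundaryDomain ι φ | boundaryMap ι φ p ∈ K}) :
    x ∈ boundaryDomain ι φ := by
  have hclosed : IsClosed (φ.symm '' K) :=
    (hK.image_of_continuousOn (φ.continuousOn_symm.mono hKφ)).isClosed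
  have himage : (fun x => ι (conePoint x)) '' {p ∈ boundaryDomain ι φ | boundaryMap ι φ p ∈ K} ⊆
      φ.symm '' K := by
    rintro _ ⟨p, hp, rfl⟩
    exact ⟨_, hp.2, φ.left_inv hp.1.2⟩
  obtain ⟨y, hy, hyx⟩ := closure_minimal himage hclosed
    ((contMDiffAt_comp_conePoint hι hx).continuousAt.continuousWithinAt.mem_closure_image hxK)
  exact ⟨hx, (hyx ▸ φ.map_target (hKφ hy) : ι (conePoint x) ∈ φ.source)⟩

theorem mfderiv_symm_fderiv_boundaryMap [IsManifold (𝓡 (d + 1)) ∞ N]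
    (hι : ContMDiff DoubleNullModel (𝓡 (d + 1)) ∞ ι)
    (hφ : φ ∈ IsManifold.maximalAtlas (𝓡 (d + 1)) ∞ N) {x : DoubleNullCone}
    (hx : x ∈ boundaryDomain ι φ) (z : DoubleNullCone) :
    mfderiv (𝓡 (d + 1)) (𝓡 (d + 1)) φ.symm (boundaryMap ι φ x)
      (fderiv ℝ (boundaryMap ι φ) x z) =
    mfderiv DoubleNullModel (𝓡 (d + 1)) ι (conePoint x)
      (mfderiv 𝓘(ℝ, DoubleNullCone) DoubleNullModel conePoint x z) := by
  have hsymm : MDifferentiableAt (𝓡 (d + 1)) (𝓡 (d + 1)) φ.symm (boundaryMap ι φ x) :=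
    (contMDiffAt_symm_of_mem_maximalAtlas hφ (φ.map_source hx.2)).mdifferentiableAt (by simp)
  have hY := ((contDiffAt_boundaryMap hι hφ hx).differentiableAt (by simp)).mdifferentiableAt
  have hcomp : φ.symm ∘ boundaryMap ι φ =ᶠ[𝓝 x] ι ∘ conePoint := by
    filter_upwards [(isOpen_boundaryDomain hι).mem_nhds hx] with y hy using φ.left_inv hy.2
  have hleft := mfderiv_comp_apply x hsymm hY z
  have hright := mfderiv_comp_apply x ((hι (conePoint x)).mdifferentiableAt (by simp))
    ((contMDiffAt_conePoint hx.1).mdifferentiableAt (by simp)) z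
  rw [mfderiv_eq_fderiv] at hleft
  refine hleft.symm.trans (Eq.trans ?_ hright)
  exact DFunLike.congr_fun (hcomp.mfderiv_eq (I := 𝓘(ℝ, DoubleNullCone)) (I' := 𝓡 (d + 1))) z

theorem pullbackForm_fderiv_boundaryMap [IsManifold (𝓡 (d + 1)) ∞ N]
    (hι : ContMDiff DoubleNullModel (𝓡 (d + 1)) ∞ ι)
    (hφ : φ ∈ IsManifold.maximalAtlas (𝓡 (d + 1)) ∞ N) (g : BilinField (𝓡 (d + 1)) N)
    {x : DoubleNullCone} (hx : x ∈ boundaryDomain ι φ) (z w : DoubleNullCone) :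
    pullbackForm g φ (boundaryMap ι φ x) (fderiv ℝ (boundaryMap ι φ) x z)
      (fderiv ℝ (boundaryMap ι φ) x w) =
    g (ι (conePoint x))
      (mfderiv DoubleNullModel (𝓡 (d + 1)) ι (conePoint x)
        (mfderiv 𝓘(ℝ, DoubleNullCone) DoubleNullModel conePoint x z))
      (mfderiv DoubleNullModel (𝓡 (d + 1)) ι (conePoint x)
        (mfderiv 𝓘(ℝ, DoubleNullCone) DoubleNullModel conePoint x w)) := by
  rw [← mfderiv_symm_fderiv_boundaryMap hι hφ hx, ← mfderiv_symm_fderiv_boundaryMap hι hφ hx]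
  -- All tangent spaces of `N` are the same model space, so `g` can be moved along an equality of
  -- base points.
  let g' : N → LinearMap.BilinForm ℝ (EuclideanSpace ℝ (Fin (d + 1))) := g
  change g' (φ.symm (φ (ι (conePoint x)))) _ _ = g' (ι (conePoint x)) _ _
  rw [φ.left_inv hx.2]
  rfl

theorem IsLocLipExtension.exists_boundaryChart [IsManifold (𝓡 (d + 1)) ∞ N] [T2Space N]
    {Ω r : ℝ → ℝ → ℝ} {g : BilinField (𝓡 (d + 1)) N}
    (hι : IsLocLipExtension DoubleNullModel (doubleNullMetric Ω r) g ι)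
    (hφ : φ ∈ IsManifold.maximalAtlas (𝓡 (d + 1)) ∞ N) {y₀ : EuclideanSpace ℝ (Fin (d + 1))}
    (hy₀ : y₀ ∈ φ.target) :
    ∃ G τ ρ Λ C, 0 < ρ ∧ BoundaryChart (fun u v => Ω u v ^ 2) (fun u v => r u v ^ 2)
      (boundaryMap ι φ) (boundaryDomain ι φ) G τ y₀ ρ Λ C := by
  have hιs : ContMDiff DoubleNullModel (𝓡 (d + 1)) ∞ ι := hι.smoothEmbedding.contMDiff
  have hφd : φ.MDifferentiable (𝓡 (d + 1)) (𝓡 (d + 1)) :=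
    ⟨(contMDiffOn_of_mem_maximalAtlas hφ).mdifferentiableOn (by simp),
      (contMDiffOn_symm_of_mem_maximalAtlas hφ).mdifferentiableOn (by simp)⟩
  obtain ⟨τ, C, hC, ρ, hρ, Λ, hball, hΛ, hbounds⟩ := exists_chart_bounds hι.locLipschitz hφ hy₀
    (isLorentzForm_pullbackForm hφd hy₀ (hι.lorentzian _))
  exact ⟨chartMetric g φ, τ, ρ, Λ, C, hρ,
  { finrank_eq := by
      have hdim : 4 = d + 1 := by simpa using hι.same_dim
      simp [← hdim]
    isOpen := isOpen_boundaryDomain hιs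
    subset := inter_subset_left
    smooth := fun x hx =>
      ((contDiffAt_boundaryMap hιs hφ hx).of_le ENat.LEInfty.out).contDiffWithinAt
    closed := fun x hx hxK =>
      mem_boundaryDomain_of_mem_closure hιs (isCompact_closedBall y₀ ρ) hball hx hxK
    isometric := fun x hx z w => by
      rw [chartMetric_apply, pullbackForm_fderiv_boundaryMap hιs hφ g hx, hι.isometric,
        doubleNullMetric_mfderiv_conePoint Ω r hx.1]
    lipschitzConst_nonneg := Λ.2
    lipschitz := fun x hx y hy => hΛ.norm_sub_le hx hy
    bound_pos := hC
    symm := fun y hy z w => by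
      rw [chartMetric_apply, chartMetric_apply]
      exact (isLorentzForm_pullbackForm hφd (hball hy) (hι.lorentzian _)).symm z w
    nondegenerate := fun y hy => (hbounds y hy).1
    bounded := fun y hy => (hbounds y hy).2.1
    cone := fun y hy => (hbounds y hy).2.2 }⟩

end BoundaryChart

namespace IsBoundedCoefficient

variable {r : ℝ → ℝ → ℝ} {u v : ℝ}

theorem sq (hr : IsBoundedCoefficient r) : IsBoundedCoefficient fun u v => r u v ^ 2 where
  differentiable := hr.differentiable.pow 2
  bounds := fun a ha => by
    obtain ⟨m, hm, M, h⟩ := hr.bounds a ha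
    refine ⟨m ^ 2, by positivity, M ^ 2, fun u hu v hv => ?_⟩
    obtain ⟨hmr, hrM⟩ := h u hu v hv
    have hpos := hr.pos hu.2 hv.2
    constructor <;> gcongr

theorem partialU_sq (hr : IsBoundedCoefficient r) (hu : u < 0) (hv : v < 0) :
    partialU (fun u v => r u v ^ 2) u v = 2 * r u v * partialU r u v := by
  simpa [partialU] using ((hr.differentiableAt_left hu hv).hasDerivAt.fun_pow 2).deriv

theorem partialV_sq (hr : IsBoundedCoefficient r) (hu : u < 0) (hv : v < 0) :
    partialV (fun u v => r u v ^ 2) u v = 2 * r u v * partialV r u v := by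
  simpa [partialV] using ((hr.hasDerivAt_right hu hv).fun_pow 2).deriv

theorem tendsto_partialV_sq (hr : IsBoundedCoefficient r) (hu : u < 0)
    (h : Tendsto (partialV r u) (𝓝[<] 0) atBot) :
    Tendsto (partialV (fun u v => r u v ^ 2) u) (𝓝[<] 0) atBot := by
  obtain ⟨m, hm, M, hb⟩ := hr.bounds u hu
  refine tendsto_atBot_mono' _ ?_ (h.const_mul_atBot (r := 2 * m) (by positivity))
  filter_upwards [h.eventually_le_atBot 0, Ico_mem_nhdsLT hu] with v hv huv
  have hmr : m ≤ r u v := (hb u ⟨le_rfl, hu⟩ v huv).1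
  rw [hr.partialV_sq hu huv.2]
  exact mul_le_mul_of_nonpos_right (by gcongr) hv

theorem eventually_partialU_sq_nonpos (hr : IsBoundedCoefficient r) (hu : u < 0)
    (h : ∀ᶠ v in 𝓝[<] 0, partialU r u v ≤ 0) :
    ∀ᶠ v in 𝓝[<] 0, partialU (fun u v => r u v ^ 2) u v ≤ 0 := by
  filter_upwards [h, self_mem_nhdsWithin] with v hruv hv
  have hpos := hr.pos hu hv
  rw [hr.partialU_sq hu hv]
  exact mul_nonpos_of_nonneg_of_nonpos (by positivity) hruv

end IsBoundedCoefficient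

theorem IsAdmissibleCoefficient.isBoundedCoefficient {f : ℝ → ℝ → ℝ}
    (hf : IsAdmissibleCoefficient f) : IsBoundedCoefficient f where
  differentiable := hf.smooth.differentiableOn (by simp)
  bounds := fun a ha => by
    obtain ⟨F, hF, hFf, hFpos⟩ := hf.extends_pos
    have hK : IsCompact (Icc a 0 ×ˢ Icc a 0) := isCompact_Icc.prod isCompact_Icc
    have hne : (Icc a 0 ×ˢ Icc a 0).Nonempty := ⟨(0, 0), by simp [ha.le]⟩
    have hFK : ContinuousOn F (Icc a 0 ×ˢ Icc a 0) :=
      hF.mono (prod_mono Icc_subset_Iic_self Icc_subset_Iic_self)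
    obtain ⟨p, hp, hmin⟩ := hK.exists_isMinOn hne hFK
    obtain ⟨q, -, hmax⟩ := hK.exists_isMaxOn hne hFK
    refine ⟨F p, hFpos p.1 hp.1.2 p.2 hp.2.2, F q, fun u hu v hv => ?_⟩
    have huv : (u, v) ∈ Icc a 0 ×ˢ Icc a 0 := ⟨Ico_subset_Icc_self hu, Ico_subset_Icc_self hv⟩
    rw [← hFf u hu.2 v hv.2]
    exact ⟨hmin huv, hmax huv⟩

theorem Icc_mem_nhdsGE_of_mem_Ico {c d s : ℝ} (hs : s ∈ Ico c d) : Icc c d ∈ 𝓝[≥] s :=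
  mem_of_superset (Ico_mem_nhdsGE hs.2) fun _ hx => ⟨hs.1.trans hx.1, hx.2.le⟩

theorem derivWithin_Ici_eq_derivWithin_Icc {E : Type*} [NormedAddCommGroup E] [NormedSpace ℝ E]
    {f : ℝ → E} {c d s : ℝ} (hf : DifferentiableOn ℝ f (Icc c d)) (hs : s ∈ Ico c d) :
    derivWithin f (Ici s) s = derivWithin f (Icc c d) s :=
  ((hf s (Ico_subset_Icc_self hs)).hasDerivWithinAt.mono_of_mem_nhdsWithin
    (Icc_mem_nhdsGE_of_mem_Ico hs)).derivWithin (uniqueDiffOn_Ici s s self_mem_Ici)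

section Partition

variable {t : ℕ → ℝ} {a b : ℝ}

theorem exists_mem_Ico_of_tendsto (ht0 : t 0 = a) (htb : Tendsto t atTop (𝓝 b)) {s : ℝ}
    (hs : s ∈ Ico a b) : ∃ n, s ∈ Ico (t n) (t (n + 1)) := by
  classical
  have hex : ∃ n, s < t n := (htb.eventually_const_lt hs.2).exists
  obtain ⟨n, hn⟩ := Nat.exists_eq_succ_of_ne_zero (n := Nat.find hex) fun h =>
    absurd (h ▸ Nat.find_spec hex) (ht0 ▸ hs.1).not_gt
  have hsn : s < t (n + 1) := by simpa only [hn] using Nat.find_spec hex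
  exact ⟨n, not_lt.1 (Nat.find_min hex (by omega)), hsn⟩

theorem Icc_mem_nhdsWithin_Ico {s c : ℝ} (hs : s < c) : Icc a c ∈ 𝓝[Ico a b] s := by
  filter_upwards [self_mem_nhdsWithin, mem_nhdsWithin_of_mem_nhds (Iio_mem_nhds hs)] with x hx hxc
  exact ⟨hx.1, le_of_lt hxc⟩

theorem continuousOn_Ico_of_pieces {X : Type*} [TopologicalSpace X] (ht : Monotone t)
    (ht0 : t 0 = a) (htb : Tendsto t atTop (𝓝 b)) {f : ℝ → X}
    (hf : ∀ n, ContinuousOn f (Icc (t n) (t (n + 1)))) : ContinuousOn f (Ico a b) := by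
  have hinit (n) : ContinuousOn f (Icc a (t n)) := by
    induction n with
    | zero => simp [ht0]
    | succ n ih =>
      rw [← Icc_union_Icc_eq_Icc (b := t n) (ht0 ▸ ht n.zero_le) (ht n.le_succ)]
      exact ih.union_of_isClosed (hf n) isClosed_Icc isClosed_Icc
  intro s hs
  obtain ⟨n, hn⟩ := exists_mem_Ico_of_tendsto ht0 htb hs
  exact (hinit (n + 1) s ⟨hs.1, hn.2.le⟩).mono_of_mem_nhdsWithin (Icc_mem_nhdsWithin_Ico hn.2)

theorem hasDerivWithinAt_Ici_of_pieces {E : Type*} [NormedAddCommGroup E] [NormedSpace ℝ E]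
    (ht0 : t 0 = a) (htb : Tendsto t atTop (𝓝 b)) {f : ℝ → E}
    (hf : ∀ n, DifferentiableOn ℝ f (Icc (t n) (t (n + 1)))) {s : ℝ} (hs : s ∈ Ico a b) :
    HasDerivWithinAt f (derivWithin f (Ici s) s) (Ici s) s := by
  obtain ⟨n, hn⟩ := exists_mem_Ico_of_tendsto ht0 htb hs
  exact ((hf n s (Ico_subset_Icc_self hn)).mono_of_mem_nhdsWithin
    (Icc_mem_nhdsGE_of_mem_Ico hn)).hasDerivWithinAt

section Primitive

open MeasureTheory

variable {f : ℝ → ℝ}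

theorem intervalIntegrable_of_eqOn_Ico {g : ℝ → ℝ} (hab : a ≤ b) (hg : ContinuousOn g (Icc a b))
    (hfg : EqOn f g (Ico a b)) : IntervalIntegrable f volume a b := by
  have hint := hg.intervalIntegrable_of_Icc (μ := volume) hab
  rw [intervalIntegrable_iff_integrableOn_Ico_of_le hab] at hint ⊢
  exact hint.congr_fun hfg.symm measurableSet_Ico

theorem hasDerivWithinAt_integral_Ici {g : ℝ → ℝ} {c d s : ℝ}
    (hg : ContinuousOn g (Icc c d)) (hfg : EqOn f g (Ico c d)) (hs : s ∈ Ico c d)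
    (hint : IntervalIntegrable f volume a s) :
    HasDerivWithinAt (fun x => ∫ y in a..x, f y) (f s) (Ici s) s := by
  have hcd : IntervalIntegrable f volume c d :=
    intervalIntegrable_of_eqOn_Ico (hs.1.trans hs.2.le) hg hfg
  refine intervalIntegral.integral_hasDerivWithinAt_right hint (t := Ioi s)
    ⟨Ioc c d, mem_of_superset (Ioc_mem_nhdsGT hs.2) (Ioc_subset_Ioc_left hs.1),
      hcd.1.aestronglyMeasurable⟩ ?_
  have hgs : ContinuousWithinAt g (Ioi s) s :=
    ((hg s (Ico_subset_Icc_self hs)).mono_of_mem_nhdsWithin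
      (Icc_mem_nhdsGE_of_mem_Ico hs)).mono Ioi_subset_Ici_self
  refine hgs.congr_of_eventuallyEq ?_ (hfg hs)
  filter_upwards [Ioo_mem_nhdsGT hs.2] with x hx using hfg ⟨hs.1.trans hx.1.le, hx.2⟩

theorem exists_hasDerivWithinAt_Ici_of_pieces (ht : Monotone t) (ht0 : t 0 = a)
    (htb : Tendsto t atTop (𝓝 b)) {g : ℕ → ℝ → ℝ}
    (hg : ∀ n, ContinuousOn (g n) (Icc (t n) (t (n + 1))))
    (hfg : ∀ n, EqOn f (g n) (Ico (t n) (t (n + 1)))) :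
    ∃ F : ℝ → ℝ, ContinuousOn F (Ico a b) ∧
      ∀ s ∈ Ico a b, HasDerivWithinAt F (f s) (Ici s) s := by
  have hint (n) : IntervalIntegrable f volume a (t n) := ht0 ▸
    IntervalIntegrable.trans_iterate fun k _ =>
      intervalIntegrable_of_eqOn_Ico (ht k.le_succ) (hg k) (hfg k)
  refine ⟨fun s => ∫ x in a..s, f x, fun s hs => ?_, fun s hs => ?_⟩
  all_goals obtain ⟨n, hn⟩ := exists_mem_Ico_of_tendsto ht0 htb hs
  · have hprim := intervalIntegral.continuousOn_primitive_interval' (hint (n + 1)) left_mem_uIcc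
    rw [uIcc_of_le (hs.1.trans hn.2.le)] at hprim
    exact (hprim s ⟨hs.1, hn.2.le⟩).mono_of_mem_nhdsWithin (Icc_mem_nhdsWithin_Ico hn.2)
  · refine hasDerivWithinAt_integral_Ici (hg n) (hfg n) hn ((hint (n + 1)).mono_set ?_)
    rw [uIcc_of_le hs.1, uIcc_of_le (hs.1.trans hn.2.le)]
    exact Icc_subset_Icc_right hn.2.le

end Primitive

end Partition

section ConeCurve

variable {V : Type*} [NormedAddCommGroup V] [NormedSpace ℝ V] {Q R : ℝ → ℝ → ℝ} {u v : ℝ → ℝ}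
  {t : ℕ → ℝ} {a b : ℝ}

theorem exists_hasDerivWithinAt_nullSpeed (hQ : IsBoundedCoefficient Q)
    (hR : IsBoundedCoefficient R) (ht : StrictMono t) (ht0 : t 0 = a) (htb : Tendsto t atTop (𝓝 b))
    (hu : ∀ n, ContDiffOn ℝ 1 u (Icc (t n) (t (n + 1))))
    (hv : ∀ n, ContDiffOn ℝ 1 v (Icc (t n) (t (n + 1)))) (hu0 : ∀ s, u s < 0)
    (hv0 : ∀ s, v s < 0) :
    ∃ F : ℝ → ℝ, ContinuousOn F (Ico a b) ∧ ∀ s ∈ Ico a b, HasDerivWithinAt F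
      (nullSpeed Q R u v (fun s => derivWithin u (Ici s) s) (fun s => derivWithin v (Ici s) s) s)
      (Ici s) s := by
  have huniq (n) : UniqueDiffOn ℝ (Icc (t n) (t (n + 1))) := uniqueDiffOn_Icc (ht n.lt_succ_self)
  have hcoef {P : ℝ → ℝ → ℝ} (hP : IsBoundedCoefficient P) (n) :
      ContinuousOn (fun s => P (u s) (v s)) (Icc (t n) (t (n + 1))) :=
    hP.differentiable.continuousOn.comp (f := fun s => (u s, v s))
      ((hu n).continuousOn.prodMk (hv n).continuousOn) fun s _ => ⟨hu0 s, hv0 s⟩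
  refine exists_hasDerivWithinAt_Ici_of_pieces ht.monotone ht0 htb
    (g := fun n => nullSpeed Q R u v (derivWithin u (Icc (t n) (t (n + 1))))
      (derivWithin v (Icc (t n) (t (n + 1)))))
    (fun n => (((hcoef hQ n).div (hcoef hR n) fun s _ => (hR.pos (hu0 s) (hv0 s)).ne').mul
      (((hu n).continuousOn_derivWithin (huniq n) le_rfl).mul
        ((hv n).continuousOn_derivWithin (huniq n) le_rfl))).sqrt) fun n s hs => ?_
  simp only [nullSpeed,
    derivWithin_Ici_eq_derivWithin_Icc ((hu n).differentiableOn one_ne_zero) hs,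
    derivWithin_Ici_eq_derivWithin_Icc ((hv n).differentiableOn one_ne_zero) hs]

theorem exists_isConeCurve_of_pieces {θ : ℝ → V} (hQ : IsBoundedCoefficient Q)
    (hR : IsBoundedCoefficient R) (ht : StrictMono t) (ht0 : t 0 = a) (htb : Tendsto t atTop (𝓝 b))
    (hu : ∀ n, ContDiffOn ℝ 1 u (Icc (t n) (t (n + 1))))
    (hv : ∀ n, ContDiffOn ℝ 1 v (Icc (t n) (t (n + 1))))
    (hθ : ∀ n, ContDiffOn ℝ 1 θ (Icc (t n) (t (n + 1))))
    (hu0 : ∀ s, u s < 0) (hv0 : ∀ s, v s < 0) (hθ1 : ∀ s, ‖θ s‖ = 1)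
    (htimelike : ∀ s ∈ Ico a b, 0 < derivWithin u (Ici s) s ∧ 0 < derivWithin v (Ici s) s ∧
      R (u s) (v s) * ‖derivWithin θ (Ici s) s‖ ^ 2 <
        Q (u s) (v s) * (derivWithin u (Ici s) s * derivWithin v (Ici s) s)) :
    ∃ F l, IsConeCurve Q R u v (fun s => derivWithin u (Ici s) s)
      (fun s => derivWithin v (Ici s) s) F l θ (fun s => derivWithin θ (Ici s) s) a b := by
  have hud (n) := (hu n).differentiableOn one_ne_zero
  have hvd (n) := (hv n).differentiableOn one_ne_zero
  have hθd (n) := (hθ n).differentiableOn one_ne_zero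
  obtain ⟨F, hF, hF'⟩ := exists_hasDerivWithinAt_nullSpeed hQ hR ht ht0 htb hu hv hu0 hv0
  obtain ⟨l, hl, hl'⟩ := exists_hasDerivWithinAt_Ici_of_pieces ht.monotone ht0 htb
    (f := fun s => ‖derivWithin θ (Ici s) s‖)
    (fun n => ((hθ n).continuousOn_derivWithin (uniqueDiffOn_Icc (ht n.lt_succ_self)) le_rfl).norm)
    fun n s hs => congr_arg norm (derivWithin_Ici_eq_derivWithin_Icc (hθd n) hs)
  exact ⟨F, l,
  { lt := ht0 ▸ (ht zero_lt_one).trans_le (ht.monotone.ge_of_tendsto htb 1)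
    u_neg := fun s _ => hu0 s
    v_neg := fun s _ => hv0 s
    norm_eq := fun s _ => hθ1 s
    u_cont := continuousOn_Ico_of_pieces ht.monotone ht0 htb fun n => (hu n).continuousOn
    v_cont := continuousOn_Ico_of_pieces ht.monotone ht0 htb fun n => (hv n).continuousOn
    θ_cont := continuousOn_Ico_of_pieces ht.monotone ht0 htb fun n => (hθ n).continuousOn
    F_cont := hF
    l_cont := hl
    u_deriv := fun _ => hasDerivWithinAt_Ici_of_pieces ht0 htb hud
    v_deriv := fun _ => hasDerivWithinAt_Ici_of_pieces ht0 htb hvd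
    θ_deriv := fun _ => hasDerivWithinAt_Ici_of_pieces ht0 htb hθd
    F_deriv := hF'
    l_deriv := hl'
    u'_pos := fun s hs => (htimelike s hs).1
    v'_pos := fun s hs => (htimelike s hs).2.1
    timelike := fun s hs => (htimelike s hs).2.2 }⟩

end ConeCurve

section TimelikeCurve

variable {Ω r : ℝ → ℝ → ℝ} {γ : ℝ → DoubleNull} {a b : ℝ}

theorem IsFutureTimelike.pos_and_lt {p : DoubleNull} {X : TangentSpace DoubleNullModel p}
    (h : IsFutureTimelike (doubleNullMetric Ω r) timeVector p X) :
    0 < diffU p X ∧ 0 < diffV p X ∧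
      r p.1 p.2.1 ^ 2 * ‖diffSphere p X‖ ^ 2 < Ω p.1 p.2.1 ^ 2 * (diffU p X * diffV p X) := by
  obtain ⟨htimelike, hfuture⟩ := h
  rw [doubleNullMetric_apply, real_inner_self_eq_norm_sq] at htimelike
  rw [doubleNullMetric_apply, diffU_timeVector, diffV_timeVector, diffSphere_timeVector,
    inner_zero_right] at hfuture
  have hlt : r p.1 p.2.1 ^ 2 * ‖diffSphere p X‖ ^ 2 <
      Ω p.1 p.2.1 ^ 2 * (diffU p X * diffV p X) := by linarith
  have hmul : 0 < diffU p X * diffV p X :=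
    pos_of_mul_pos_right ((by positivity : (0 : ℝ) ≤ _).trans_lt hlt) (sq_nonneg _)
  have hadd : 0 < diffU p X + diffV p X :=
    pos_of_mul_pos_right (a := Ω p.1 p.2.1 ^ 2) (by linarith) (sq_nonneg _)
  rcases pos_and_pos_or_neg_and_neg_of_mul_pos hmul with hpos | hneg
  · exact ⟨hpos.1, hpos.2, hlt⟩
  · linarith [hneg.1, hneg.2]

theorem derivWithin_Ici_comp_curve {F : Type*} [NormedAddCommGroup F] [NormedSpace ℝ F]
    {P : DoubleNull → F} {c d s : ℝ} (hs : s ∈ Ico c d)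
    (hP : MDifferentiableAt DoubleNullModel 𝓘(ℝ, F) P (γ s))
    (hγ : MDifferentiableWithinAt 𝓘(ℝ, ℝ) DoubleNullModel γ (Icc c d) s) :
    derivWithin (fun x => P (γ x)) (Ici s) s = mfderiv DoubleNullModel 𝓘(ℝ, F) P (γ s)
      (mfderivWithin 𝓘(ℝ, ℝ) DoubleNullModel γ (Icc c d) s (1 : ℝ)) := by
  let D : ℝ →L[ℝ] F := (mfderiv DoubleNullModel 𝓘(ℝ, F) P (γ s)).comp
    (mfderivWithin 𝓘(ℝ, ℝ) DoubleNullModel γ (Icc c d) s)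
  have hD : HasFDerivWithinAt (fun x => P (γ x)) D (Icc c d) s :=
    (hP.hasMFDerivAt.comp_hasMFDerivWithinAt s hγ.hasMFDerivWithinAt).hasFDerivWithinAt
  exact (hD.hasDerivWithinAt.mono_of_mem_nhdsWithin (Icc_mem_nhdsGE_of_mem_Ico hs)).derivWithin
    (uniqueDiffOn_Ici s s self_mem_Ici)

theorem contMDiff_u : ContMDiff DoubleNullModel 𝓘(ℝ, ℝ) ∞ fun x : DoubleNull => (x.1 : ℝ) :=
  contMDiff_subtype_val.comp contMDiff_fst

theorem contMDiff_v : ContMDiff DoubleNullModel 𝓘(ℝ, ℝ) ∞ fun x : DoubleNull => (x.2.1 : ℝ) :=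
  contMDiff_subtype_val.comp (contMDiff_fst.comp contMDiff_snd)

theorem contMDiff_sphere : ContMDiff DoubleNullModel 𝓘(ℝ, EuclideanSpace ℝ (Fin 3)) ∞
    fun x : DoubleNull => (x.2.2 : EuclideanSpace ℝ (Fin 3)) := by
  have : Fact (Module.finrank ℝ (EuclideanSpace ℝ (Fin 3)) = 2 + 1) := ⟨by simp⟩
  exact (contMDiff_coe_sphere (n := 2)).comp (contMDiff_snd.comp contMDiff_snd)

theorem IsFutureTimelikeCurve.exists_isConeCurve
    (hγ : IsFutureTimelikeCurve (doubleNullMetric Ω r) timeVector γ a b)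
    (hΩ : IsBoundedCoefficient Ω) (hr : IsBoundedCoefficient r) :
    ∃ u' v' F l θ', IsConeCurve (fun u v => Ω u v ^ 2) (fun u v => r u v ^ 2)
      (fun s => ((γ s).1 : ℝ)) (fun s => ((γ s).2.1 : ℝ)) u' v' F l
      (fun s => ((γ s).2.2 : EuclideanSpace ℝ (Fin 3))) θ' a b := by
  obtain ⟨t, ht, ht0, htb, hpiece⟩ := hγ
  have hcomp {F : Type} [NormedAddCommGroup F] [NormedSpace ℝ F] {P : DoubleNull → F}
      (hP : ContMDiff DoubleNullModel 𝓘(ℝ, F) ∞ P) (n) :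
      ContDiffOn ℝ 1 (fun s => P (γ s)) (Icc (t n) (t (n + 1))) :=
    (hP.comp_contMDiffOn (hpiece n).1).contDiffOn.of_le (by simp)
  obtain ⟨F, l, hc⟩ := exists_isConeCurve_of_pieces hΩ.sq hr.sq ht ht0 htb (hcomp contMDiff_u)
    (hcomp contMDiff_v) (hcomp contMDiff_sphere) (fun s => (γ s).1.2) (fun s => (γ s).2.1.2)
    (fun s => by simp) fun s hs => by
      obtain ⟨n, hn⟩ := exists_mem_Ico_of_tendsto ht0 htb hs
      have hs' := Ico_subset_Icc_self hn
      have hd := ((hpiece n).1 s hs').mdifferentiableWithinAt (by simp)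
      rw [derivWithin_Ici_comp_curve hn (contMDiff_u.mdifferentiableAt (by simp)) hd,
        derivWithin_Ici_comp_curve hn (contMDiff_v.mdifferentiableAt (by simp)) hd,
        derivWithin_Ici_comp_curve hn (contMDiff_sphere.mdifferentiableAt (by simp)) hd]
      exact ((hpiece n).2 s hs').pos_and_lt
  exact ⟨_, _, F, l, _, hc⟩

theorem IsFutureInextendibleCurve.tendsto_zero_or_tendsto_zero {Q R : ℝ → ℝ → ℝ}
    {u' v' F l : ℝ → ℝ} {θ' : ℝ → EuclideanSpace ℝ (Fin 3)} (hγ : IsFutureInextendibleCurve γ b)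
    (hQ : IsBoundedCoefficient Q) (hR : IsBoundedCoefficient R)
    (hc : IsConeCurve Q R (fun s => ((γ s).1 : ℝ)) (fun s => ((γ s).2.1 : ℝ)) u' v' F l
      (fun s => ((γ s).2.2 : EuclideanSpace ℝ (Fin 3))) θ' a b) :
    Tendsto (fun s => ((γ s).2.1 : ℝ)) (𝓝[<] b) (𝓝 0) ∨
      Tendsto (fun s => ((γ s).1 : ℝ)) (𝓝[<] b) (𝓝 0) := by
  obtain ⟨u₁, hu₁, -⟩ := exists_tendsto_of_monotoneOn hc.lt hc.u_strictMono.monotoneOn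
    fun s hs => (hc.u_neg s hs).le
  obtain ⟨v₁, hv₁, -⟩ := exists_tendsto_of_monotoneOn hc.lt hc.v_strictMono.monotoneOn
    fun s hs => (hc.v_neg s hs).le
  obtain ⟨e, he, hθ⟩ := hc.exists_tendsto_θ hQ hR
  have hu₁0 : u₁ ≤ 0 := le_of_tendsto hu₁ (Eventually.of_forall fun s => (γ s).1.2.le)
  have hv₁0 : v₁ ≤ 0 := le_of_tendsto hv₁ (Eventually.of_forall fun s => (γ s).2.1.2.le)
  rcases hv₁0.eq_or_lt with rfl | hv₁neg
  · exact Or.inl hv₁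
  rcases hu₁0.eq_or_lt with rfl | hu₁neg
  · exact Or.inr hu₁
  refine absurd ⟨(⟨u₁, hu₁neg⟩, ⟨v₁, hv₁neg⟩, ⟨e, by simpa using he⟩), ?_⟩ hγ
  exact (tendsto_subtype_rng.2 hu₁).prodMk_nhds
    ((tendsto_subtype_rng.2 hv₁).prodMk_nhds (tendsto_subtype_rng.2 hθ))

end TimelikeCurve

section BoundaryPoint

variable {d : ℕ} {N : Type*} [TopologicalSpace N] {ι : DoubleNull → N}
  {φ : OpenPartialHomeomorph N (EuclideanSpace ℝ (Fin (d + 1)))} {γ : ℝ → DoubleNull} {q : N}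
  {f : Filter ℝ}

theorem eventually_coneCoord_mem_boundaryDomain (hq : q ∈ φ.source)
    (hγ : Tendsto (ι ∘ γ) f (𝓝 q)) : ∀ᶠ s in f, coneCoord (γ s) ∈ boundaryDomain ι φ := by
  filter_upwards [hγ.eventually (φ.open_source.mem_nhds hq)] with s hs
  exact ⟨coneCoord_mem _, by rwa [mem_preimage, conePoint_coneCoord]⟩

theorem tendsto_boundaryMap_coneCoord (hq : q ∈ φ.source) (hγ : Tendsto (ι ∘ γ) f (𝓝 q)) :
    Tendsto (fun s => boundaryMap ι φ (coneCoord (γ s))) f (𝓝 (φ q)) := by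
  simp only [boundaryMap, conePoint_coneCoord]
  exact (φ.continuousAt hq).tendsto.comp hγ

end BoundaryPoint

theorem eventually_nhdsLT_of_exists_forall_mem_Ico {a : ℝ} {p : ℝ → Prop}
    (h : ∃ c < a, ∀ x ∈ Ico c a, p x) : ∀ᶠ x in 𝓝[<] a, p x :=
  mem_nhdsLT_iff_exists_Ico_subset.2 h

theorem theorem1p2_general {Ω r : ℝ → ℝ → ℝ} (hΩ : IsBoundedCoefficient Ω)
    (hr : IsBoundedCoefficient r) (hrv : ∀ u < 0, Tendsto (partialV r u) (𝓝[<] 0) atBot)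
    (hru : ∀ v < 0, Tendsto (fun u => partialU r u v) (𝓝[<] 0) atBot)
    (hru_nonpos : ∀ u < 0, ∀ᶠ v in 𝓝[<] 0, partialU r u v ≤ 0)
    (hrv_nonpos : ∀ v < 0, ∀ᶠ u in 𝓝[<] 0, partialV r u v ≤ 0) :
    FutureLocLipInextendible.{w} (doubleNullMetric Ω r) timeVector := by
  rintro d N _ _ _ _ g' ι hι ⟨γ, a, b, hγ, hinext, q, hq⟩
  have hqs : q ∈ (chartAt (EuclideanSpace ℝ (Fin (d + 1))) q).source := mem_chart_source _ q
  obtain ⟨G, τ, ρ, Λ, C, hρ, hchart⟩ := hι.exists_boundaryChart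
    (IsManifold.chart_mem_maximalAtlas q) ((chartAt _ q).map_source hqs)
  obtain ⟨u', v', F, l, θ', hc⟩ := hγ.exists_isConeCurve hΩ hr
  have hO := eventually_coneCoord_mem_boundaryDomain hqs hq
  have hY := tendsto_boundaryMap_coneCoord hqs hq
  have hdim : 1 < Module.finrank ℝ (EuclideanSpace ℝ (Fin 3)) := by simp
  rcases hinext.tendsto_zero_or_tendsto_zero hΩ.sq hr.sq hc with hv | hu
  · exact hchart.false_of_curve hρ hΩ.sq hr.sq hc hdim hO hY hv
      (fun u hu => hr.tendsto_partialV_sq hu (hrv u hu))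
      fun u hu => hr.eventually_partialU_sq_nonpos hu (hru_nonpos u hu)
  · exact hchart.swap.false_of_curve hρ hΩ.sq.swap hr.sq.swap hc.swap hdim hO hY hu
      (fun v hv => hr.swap.tendsto_partialV_sq hv (hru v hv))
      fun v hv => hr.swap.eventually_partialU_sq_nonpos hv (hrv_nonpos v hv)

end

theorem theorem1p2 (Ω r : ℝ → ℝ → ℝ)
    (hΩ : IsAdmissibleCoefficient Ω) (hr : IsAdmissibleCoefficient r)
    (hrv : ∀ u < 0, Tendsto (fun v => deriv (fun y => r u y) v) (𝓝[<] 0) atBot)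
    (hru : ∀ v < 0, Tendsto (fun u => deriv (fun x => r x v) u) (𝓝[<] 0) atBot)
    (hru_neg : ∀ u < 0, ∃ v₀ < 0, ∀ v ∈ Ico v₀ 0, deriv (fun x => r x v) u < 0)
    (hrv_neg : ∀ v < 0, ∃ u₀ < 0, ∀ u ∈ Ico u₀ 0, deriv (fun y => r u y) v < 0) :
    FutureLocLipInextendible.{w} (doubleNullMetric Ω r) timeVector :=
  theorem1p2_general hΩ.isBoundedCoefficient hr.isBoundedCoefficient hrv hru
    (fun u hu => (eventually_nhdsLT_of_exists_forall_mem_Ico (hru_neg u hu)).mono fun _ => le_of_lt)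
    fun v hv => (eventually_nhdsLT_of_exists_forall_mem_Ico (hrv_neg v hv)).mono fun _ => le_of_lt
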